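/- **Conventions.** A map is a finite connected graph properly embedded in the sphere, up to orientation-preserving homeomorphism, rooted at an oriented edge, all of whose faces have even degree; the set of maps is $\mathcal M$, and it contains the map $\dagger$ made of a single vertex. The root face $f_*$ is the face on the right of the root edge. For a sequence $\mathsf q=(q_k)_{k\ge 1}$ of nonnegative reals put $w_{\mathsf q}(\mathbf m)=\prod_{f\in \mathrm F(\mathbf m)} q_{\deg(f)/2}$ and $w_{\mathsf q}(\dagger)=1$. The sequence $\mathsf q$ is admissible if $w_{\mathsf q}(\mathcal M)=\sum_{\mathbf m\in\mathcal M}w_{\mathsf q}(\mathbf m)<\infty$; a $\mathsf q$-Boltzmann map $M_{\mathsf q}$ then has law $\mathbb P_{\mathsf q}(\mathbf m)=w_{\mathsf q}(\mathbf m)/w_{\mathsf q}(\mathcal M)$. An island of perimeter $2k$ ($k\ge1$) is a map with edges coloured black or white, whose root face has degree $2k$ and is bounded by a simple cycle (going once around $f_*$, no vertex and no edge is visited twice), whose boundary edges (those incident to $f_*$) are all black, and in which every other edge incident to a boundary vertex is white. For $p\in[0,1]$ let $$I_k(p)=\sum_{\mathbf m\ \text{island of perimeter }2k} p^{\#\mathrm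 E_\bullet(\mathbf m)}(1-p)^{\#\mathrm E_\circ(\mathbf m)}\prod_{f\in\mathrm F(\mathbf m)\setminus\{f_*\}}q_{\deg(f)/2},$$ where $\mathrm E_\bullet(\mathbf m)$ and $\mathrm E_\circ(\mathbf m)$ are the sets of black and white edges that are not boundary edges. **Proposition 3.1.** Let $\mathsf q$ be an admissible weight sequence that is not identically zero, and let $p\in(0,1]$. Given $M_{\mathsf q}$, colour each of its edges black with probability $p$ and white otherwise, independently, and condition on the event that the root edge exists and is black. Let $\mathcal C$ be the percolation cluster of the origin: the connected component of the source of the root edge in the graph of black edges, with the embedding and the root edge inherited from $M_{\mathsf q}$. Put $\tilde q_k=p^kI_k(p)$ for $k\ge1$. Then the conditioning event has positive probability, $I_k(p)<\infty$ for every $k\ge 1$, the weight sequence $\tilde{\mathsf q}$ is admissible, and $\mathcal C$ has the law of a $\tilde{\mathsf q}$-Boltzmann map conditioned to have at least one edge. -/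

import Mathlib

open scoped NNReal ENNReal ProbabilityTheory

/-- Data of a rooted map drawn on an oriented surface, with set of oriented edges ("darts") `D`.
`next` sends a dart to the following one in counterclockwise order around its origin,
`flip` reverses a dart, and `root` is the root edge (an oriented edge).
Vertices, edges and faces are the cycles of `next`, of `flip` and of `d ↦ next (flip d)`. -/
structure CombMap (D : Type) where
  next : Equiv.Perm D
  flip : Equiv.Perm D
  root : D
  flip_flip : ∀ d, flip (flip d) = d
  flip_ne : ∀ d, flip d ≠ d

namespace CombMap

section Basic

variable {D : Type} (m : CombMap D)

/-- The permutation that follows the boundary of the face on the right of each dart. -/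
def faceNext : Equiv.Perm D := m.next * m.flip

/-- Vertices; a dart belongs to the vertex it starts from. -/
def Vertex : Type := Quotient (Equiv.Perm.SameCycle.setoid m.next)

/-- Unoriented edges. -/
def Edge : Type := Quotient (Equiv.Perm.SameCycle.setoid m.flip)

/-- Faces; a dart belongs to the face on its right. -/
def Face : Type := Quotient (Equiv.Perm.SameCycle.setoid m.faceNext)

/-- The origin of a dart. -/
def vertexOf (d : D) : m.Vertex := Quotient.mk _ d

/-- The unoriented edge carrying a dart. -/
def edgeOf (d : D) : m.Edge := Quotient.mk _ d

/-- The face on the right of a dart. -/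
def faceOf (d : D) : m.Face := Quotient.mk _ d

noncomputable instance [Finite D] : Fintype m.Edge :=
  @Fintype.ofFinite _ (inferInstanceAs (Finite (Quotient _)))

noncomputable instance [Finite D] : Fintype m.Face :=
  @Fintype.ofFinite _ (inferInstanceAs (Finite (Quotient _)))

/-- The degree of a face: the number of oriented edges incident to it. -/
noncomputable def degree (f : m.Face) : ℕ := Nat.card {d : D // m.faceOf d = f}

/-- The root face, which lies on the right of the root edge. -/
def rootFace : m.Face := m.faceOf m.root

/-- Every dart can be reached from the root. -/
def IsConnected : Prop :=
  ∀ d, Relation.ReflTransGen (fun a b => b = m.next a ∨ b = m.flip a) m.root d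

/-- Genus zero, by Euler's formula (for connected maps). -/
def IsPlanar : Prop := Nat.card m.Vertex + Nat.card m.Face = Nat.card m.Edge + 2

/-- All faces have even degree. -/
def IsBipartite : Prop := ∀ f : m.Face, Even (m.degree f)

/-- Orientation-preserving and root-preserving isomorphism. -/
def Iso {D' : Type} (m : CombMap D) (m' : CombMap D') : Prop :=
  ∃ e : D ≃ D', (∀ d, e (m.next d) = m'.next (e d)) ∧ (∀ d, e (m.flip d) = m'.flip (e d)) ∧
    e m.root = m'.root

/-- Renaming the darts. -/
def relabel {D' : Type} (e : D ≃ D') : CombMap D' where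
  next := e.permCongr m.next
  flip := e.permCongr m.flip
  root := e m.root
  flip_flip d := by simp [Equiv.permCongr_apply, m.flip_flip]
  flip_ne d h := by
    apply m.flip_ne (e.symm d)
    apply e.injective
    simpa [Equiv.permCongr_apply] using h

/-- The Boltzmann weight: product over all faces `f` of `q (deg f / 2)`. -/
noncomputable def weight [Finite D] (q : ℕ → ℝ≥0) : ℝ≥0 := ∏ f : m.Face, q (m.degree f / 2)

end Basic

section Boundary

variable {D : Type} (m : CombMap D)

/-- An edge of the boundary (that is, incident to the root face). -/
def IsBoundaryEdge (e : m.Edge) : Prop := ∃ d, m.faceOf d = m.rootFace ∧ m.edgeOf d = e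

/-- A vertex of the boundary. -/
def IsBoundaryVertex (v : m.Vertex) : Prop := ∃ d, m.faceOf d = m.rootFace ∧ m.vertexOf d = v

/-- The edge `e` is incident to the vertex `v`. -/
def Incident (e : m.Edge) (v : m.Vertex) : Prop := ∃ d, m.edgeOf d = e ∧ m.vertexOf d = v

/-- The boundary is a simple cycle: going once around the root face, no vertex and no edge is
visited twice. (For perimeter at least `4` the second part follows from the first. In perimeter `2`
it excludes the map with a single edge, whose boundary is not a cycle.) -/
def HasSimpleBoundary : Prop :=
  Set.InjOn m.vertexOf {d | m.faceOf d = m.rootFace} ∧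
    Set.InjOn m.edgeOf {d | m.faceOf d = m.rootFace}

/-- Islands of perimeter `2 * k`; `κ e = true` means that the edge `e` is black (open). -/
structure IsIsland (k : ℕ) (κ : m.Edge → Bool) : Prop where
  connected : m.IsConnected
  planar : m.IsPlanar
  bipartite : m.IsBipartite
  simple : m.HasSimpleBoundary
  perimeter : m.degree m.rootFace = 2 * k
  boundary_black : ∀ e, m.IsBoundaryEdge e → κ e = true
  incident_white : ∀ e v, ¬ m.IsBoundaryEdge e → m.IsBoundaryVertex v → m.Incident e v →
    κ e = false

open Classical in
/-- The contribution of an island: `p` for each black internal edge, `1 - p` for each white internal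
edge, and the Boltzmann weight of all faces except the root face. -/
noncomputable def islandWeight [Finite D] (q : ℕ → ℝ≥0) (p : ℝ≥0) (κ : m.Edge → Bool) : ℝ≥0 :=
  (∏ e : m.Edge with ¬ m.IsBoundaryEdge e, if κ e then p else 1 - p) *
    ∏ f : m.Face with f ≠ m.rootFace, q (m.degree f / 2)

end Boundary

section Induced

variable {D : Type} [Finite D]

lemma exists_return (σ : Equiv.Perm D) (S : Set D) (d : S) :
    ∃ k : ℕ, 0 < k ∧ (σ ^ k) (d : D) ∈ S := by
  refine ⟨orderOf σ, orderOf_pos σ, ?_⟩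
  rw [pow_orderOf_eq_one]
  exact d.2

open Classical in
/-- First return to `S` of the permutation `σ`. -/
noncomputable def firstReturn (σ : Equiv.Perm D) (S : Set D) (d : S) : S :=
  ⟨(σ ^ Nat.find (exists_return σ S d)) (d : D), (Nat.find_spec (exists_return σ S d)).2⟩

lemma firstReturn_injective (σ : Equiv.Perm D) (S : Set D) :
    Function.Injective (firstReturn σ S) := by
  classical
  have key : ∀ (d e : S) (i j : ℕ), 0 < i → i ≤ j → (σ ^ i) (d : D) = (σ ^ j) (e : D) →
      (∀ l, l < j → ¬ (0 < l ∧ (σ ^ l) (e : D) ∈ S)) → d = e := by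
    intro d e i j hi hij h hmin
    have h' : (d : D) = (σ ^ (j - i)) (e : D) := by
      apply (σ ^ i).injective
      rw [h, ← Equiv.Perm.mul_apply, ← pow_add, Nat.add_sub_cancel' hij]
    rcases Nat.eq_zero_or_pos (j - i) with h0 | h0
    · rw [h0] at h'
      exact Subtype.ext (by simpa using h')
    · exact absurd ⟨h0, h' ▸ d.2⟩ (hmin (j - i) (by omega))
  intro d e h
  have h' := congrArg Subtype.val h
  simp only [firstReturn] at h'
  rcases le_total (Nat.find (exists_return σ S d)) (Nat.find (exists_return σ S e)) with hle | hle
  · exact key d e _ _ (Nat.find_spec (exists_return σ S d)).1 hle h'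
      (fun l hl => Nat.find_min (exists_return σ S e) hl)
  · exact (key e d _ _ (Nat.find_spec (exists_return σ S e)).1 hle h'.symm
      (fun l hl => Nat.find_min (exists_return σ S d) hl)).symm

/-- The permutation of `S` induced by `σ`: the cyclic orders obtained by erasing the complement
of `S` from the cycles of `σ`. -/
noncomputable def inducedPerm (σ : Equiv.Perm D) (S : Set D) : Equiv.Perm S :=
  Equiv.ofBijective (firstReturn σ S)
    (Finite.injective_iff_bijective.mp (firstReturn_injective σ S))

end Induced

section Cluster

variable {D : Type} (m : CombMap D)

/-- The origin of `d` is joined by a path of black edges to the origin of the root edge. -/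
def OriginInCluster (κ : m.Edge → Bool) (d : D) : Prop :=
  Relation.ReflTransGen
    (fun a b => m.vertexOf a = m.vertexOf b ∨ (κ (m.edgeOf a) = true ∧ b = m.flip a)) m.root d

/-- The darts of the percolation cluster: black darts starting from a vertex of the cluster. -/
def clusterDarts (κ : m.Edge → Bool) : Set D :=
  {d | κ (m.edgeOf d) = true ∧ m.OriginInCluster κ d}

lemma edgeOf_flip (d : D) : m.edgeOf (m.flip d) = m.edgeOf d :=
  Quotient.sound (s := Equiv.Perm.SameCycle.setoid m.flip)
    (Equiv.Perm.sameCycle_apply_left.mpr (Equiv.Perm.SameCycle.refl _ _))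

lemma flip_mem_clusterDarts (κ : m.Edge → Bool) {d : D} (hd : d ∈ m.clusterDarts κ) :
    m.flip d ∈ m.clusterDarts κ :=
  ⟨by rw [m.edgeOf_flip]; exact hd.1, hd.2.tail (Or.inr ⟨hd.1, rfl⟩)⟩

/-- The percolation cluster of the origin, rooted at the root edge of `m` (which has to be black):
the embedding is inherited from `m` by erasing all the other edges. -/
noncomputable def cluster [Finite D] (κ : m.Edge → Bool) (h : κ (m.edgeOf m.root) = true) :
    CombMap (m.clusterDarts κ) where
  next := inducedPerm m.next (m.clusterDarts κ)
  flip :=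
    { toFun := fun d => ⟨m.flip d, m.flip_mem_clusterDarts κ d.2⟩
      invFun := fun d => ⟨m.flip d, m.flip_mem_clusterDarts κ d.2⟩
      left_inv := fun d => Subtype.ext (m.flip_flip d)
      right_inv := fun d => Subtype.ext (m.flip_flip d) }
  root := ⟨m.root, h, Relation.ReflTransGen.refl⟩
  flip_flip d := Subtype.ext (m.flip_flip d)
  flip_ne d h' := m.flip_ne d (congrArg Subtype.val h')

end Cluster

/-- Isomorphism as an equivalence relation on maps with finitely many darts. -/
instance isoSetoid : Setoid (Σ n : ℕ, CombMap (Fin n)) where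
  r a b := a.2.Iso b.2
  iseqv :=
    { refl := fun _ => ⟨Equiv.refl _, fun _ => rfl, fun _ => rfl, rfl⟩
      symm := by
        rintro a b ⟨e, h1, h2, h3⟩
        refine ⟨e.symm, fun d => ?_, fun d => ?_, ?_⟩
        · apply e.injective; simp [h1]
        · apply e.injective; simp [h2]
        · rw [← h3]; simp
      trans := by
        rintro a b c ⟨e, h1, h2, h3⟩ ⟨e', h1', h2', h3'⟩
        exact ⟨e.trans e', fun d => by simp [h1, h1'], fun d => by simp [h2, h2'],
          by simp [h3, h3']⟩ }

end CombMap

/-- Rooted combinatorial maps with at least one edge, up to isomorphism (no planarity yet). -/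
def MapClass : Type := Quotient CombMap.isoSetoid

/-- A representative of an isomorphism class. All the quantities computed from it below are
invariant under isomorphism. -/
noncomputable def MapClass.rep (c : MapClass) : CombMap (Fin (Quotient.out c).1) :=
  (Quotient.out c).2

/-- Rooted maps up to isomorphism; `none` is the map `†` made of a single vertex. -/
def RootedMap : Type := Option MapClass

namespace RootedMap

instance : MeasurableSpace RootedMap := ⊤

/-- The map `†` made of a single vertex. -/
def vertexMap : RootedMap := none

/-- The isomorphism class of a map with finitely many darts. -/
noncomputable def ofCombMap {D : Type} [Finite D] (m : CombMap D) : RootedMap :=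
  some (Quotient.mk CombMap.isoSetoid ⟨Nat.card D, m.relabel (Finite.equivFin D)⟩)

/-- The set `ℳ` of (finite, connected) planar rooted bipartite maps, including `†`. -/
def planarBipartite : Set RootedMap := fun m =>
  match m with
  | none => True
  | some c => c.rep.IsConnected ∧ c.rep.IsPlanar ∧ c.rep.IsBipartite

/-- The Boltzmann weight, with the convention that `†` has weight `1`. -/
noncomputable def weight (q : ℕ → ℝ≥0) : RootedMap → ℝ≥0
  | none => 1
  | some c => c.rep.weight q

/-- The set of edges. -/
def Edge : RootedMap → Type
  | none => Empty
  | some c => c.rep.Edge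

noncomputable instance : (m : RootedMap) → Fintype m.Edge
  | none => inferInstanceAs (Fintype Empty)
  | some c => inferInstanceAs (Fintype c.rep.Edge)

end RootedMap

/-- The partition function `w_q(ℳ)`. The value `q 0` plays no role. -/
noncomputable def partitionFunction (q : ℕ → ℝ≥0) : ℝ≥0∞ :=
  ∑' m : RootedMap.planarBipartite, (RootedMap.weight q m : ℝ≥0∞)

/-- Admissible weight sequences. -/
def Admissible (q : ℕ → ℝ≥0) : Prop := partitionFunction q ≠ ∞

/-- The law of the `q`-Boltzmann map (for admissible `q`): a map `m` in `ℳ` has probability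
`w_q(m) / w_q(ℳ)`. -/
noncomputable def boltzmann (q : ℕ → ℝ≥0) : MeasureTheory.Measure RootedMap :=
  MeasureTheory.Measure.sum fun m : RootedMap.planarBipartite =>
    ((RootedMap.weight q m : ℝ≥0∞) / partitionFunction q) • MeasureTheory.Measure.dirac m.1

/-- Maps together with a colouring of their edges; `true` is black (open). -/
def PercolatedMap : Type := Σ m : RootedMap, m.Edge → Bool

namespace PercolatedMap

instance : MeasurableSpace PercolatedMap := ⊤

/-- The event that the root edge is black. -/
def rootBlack : Set PercolatedMap := fun x =>
  match x with
  | ⟨none, _⟩ => False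
  | ⟨some c, κ⟩ => (κ : c.rep.Edge → Bool) (c.rep.edgeOf c.rep.root) = true

open Classical in
/-- The percolation cluster of the origin. It is only used when the root edge is black; otherwise
it takes the value `†`. -/
noncomputable def cluster : PercolatedMap → RootedMap
  | ⟨none, _⟩ => RootedMap.vertexMap
  | ⟨some c, κ⟩ =>
    if h : (κ : c.rep.Edge → Bool) (c.rep.edgeOf c.rep.root) = true then
      RootedMap.ofCombMap (c.rep.cluster κ h)
    else RootedMap.vertexMap

end PercolatedMap

/-- The law of a `q`-Boltzmann map with Bernoulli bond percolation of parameter `p`: given the map,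
the edges are independently black with probability `p` and white with probability `1 - p`. -/
noncomputable def percolatedBoltzmann (q : ℕ → ℝ≥0) (p : ℝ≥0) :
    MeasureTheory.Measure PercolatedMap :=
  MeasureTheory.Measure.sum fun x : PercolatedMap =>
    (boltzmann q {x.1} * ((∏ e : x.1.Edge, if x.2 e then p else 1 - p : ℝ≥0) : ℝ≥0∞)) •
      MeasureTheory.Measure.dirac x

/-- The island partition function `I_k(p)`: the sum over (isomorphism classes of) islands of
perimeter `2 * k`, where the root face receives no weight. -/
noncomputable def islandPartition (q : ℕ → ℝ≥0) (p : ℝ≥0) (k : ℕ) : ℝ≥0∞ :=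
  ∑' (c : MapClass) (κ : {κ : c.rep.Edge → Bool // c.rep.IsIsland k κ}),
    (c.rep.islandWeight q p κ.1 : ℝ≥0∞)

/-- The weight sequence `p ^ k * I_k(p)` of the percolation cluster. -/
noncomputable def clusterWeights (q : ℕ → ℝ≥0) (p : ℝ≥0) (k : ℕ) : ℝ≥0 :=
  p ^ k * (islandPartition q p k).toNNReal

/-! Cut a percolated map `m` along the edges of its root cluster `C`. Every edge of `C` is doubled,
and the sphere falls apart into one piece for each face `f` of `C`. The boundary of the piece runs
through the corners of `C` in `f`, which have become distinct vertices, so it is a simple cycle of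
length `deg f`. It is black, and every other edge touching it is white, since a black one would
belong to the cluster: the piece is an island. Conversely, gluing islands into the faces of `C`
produces a map with cluster `C`. Rooted connected maps have no nontrivial automorphism, so the two
operations are mutually inverse on isomorphism classes.

Faces of `m` are the non-root faces of the islands. Edges of `m` are their internal edges together
with the edges of `C`, each of which costs a factor `p`; there are `∑ deg f / 2` of these. Hence the
percolated maps with cluster `C` have total weight `∏ p ^ (deg f / 2) * I_(deg f / 2)(p)`, which is
the weight of `C` for `clusterWeights` (`MapClass.tsum_percWeight`). Taking for `C` a star with `k`
edges, which has one face of degree `2k`, bounds `p ^ k * I_k(p)` by the partition function of `q`.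
Summing over `C` gives admissibility, and normalising gives the law.

The topology is carried by permutations. `IsUnzip` describes the cut map on the darts of `m` and of
`C`, and `IsGlue` its decomposition into pieces. That a cluster of a planar map is planar, and that
its faces are separated, follows by counting from the genus inequality `card_cycles_add_le`, which
is proved with mod 2 incidence matrices. The correspondence rests on `exists_isGlue` (cutting),
`exists_glue` (gluing), `exists_isoOn_glued` and `exists_isoOn_piece` (uniqueness), and
`range_eq_clusterDarts` (the cluster of a glued map). -/

namespace Equiv.Perm

/-! ### Cycles of a permutation and orbits of a pair of permutations -/

variable {W : Type}

/-- The set of cycles of a permutation, fixed points included. -/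
abbrev Cycles (σ : Perm W) : Type := Quotient (SameCycle.setoid σ)

/-- The cycle of an element. -/
abbrev cycleMk (σ : Perm W) (w : W) : Cycles σ := Quotient.mk _ w

lemma cycleMk_eq {σ : Perm W} {a b : W} : cycleMk σ a = cycleMk σ b ↔ σ.SameCycle a b :=
  ⟨fun h => Quotient.exact h, fun h => Quotient.sound h⟩

lemma cycleMk_surjective (σ : Perm W) : Function.Surjective (cycleMk σ) := Quotient.mk_surjective

@[simp] lemma cycleMk_apply (σ : Perm W) (a : W) : cycleMk σ (σ a) = cycleMk σ a :=
  cycleMk_eq.mpr (sameCycle_apply_left.mpr (SameCycle.refl _ _))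

/-- The set of orbits of the group generated by two permutations. -/
abbrev Comp (σ α : Perm W) : Type := Quot fun a b => b = σ a ∨ b = α a

/-- The orbit of an element under the group generated by two permutations. -/
abbrev compMk (σ α : Perm W) (w : W) : Comp σ α := Quot.mk _ w

@[simp] lemma compMk_left (σ α : Perm W) (w : W) : compMk σ α (σ w) = compMk σ α w :=
  (Quot.sound (r := fun a b => b = σ a ∨ b = α a) (Or.inl rfl)).symm

@[simp] lemma compMk_right (σ α : Perm W) (w : W) : compMk σ α (α w) = compMk σ α w :=
  (Quot.sound (r := fun a b => b = σ a ∨ b = α a) (Or.inr rfl)).symm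

lemma SameCycle.of_invariant {X : Type*} {σ : Perm W} {g : W → X} (hg : ∀ w, g (σ w) = g w)
    {a b : W} (h : σ.SameCycle a b) : g a = g b := by
  have key : ∀ (n : ℕ) (c : W), g ((σ ^ n) c) = g c := by
    intro n
    induction n with
    | zero => simp
    | succ n ih => intro c; rw [pow_succ, mul_apply, ih, hg]
  obtain ⟨i, rfl⟩ := h
  obtain ⟨n, rfl | rfl⟩ := i.eq_nat_or_neg
  · rw [zpow_natCast, key]
  · rw [← key n ((σ ^ (-(n : ℤ))) a), zpow_neg, zpow_natCast, ← mul_apply, mul_inv_cancel, one_apply]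

lemma sameCycle_involution {α : Perm W} (hα : ∀ d, α (α d) = d) {a b : W} :
    α.SameCycle a b ↔ b = a ∨ b = α a := by
  constructor
  · intro h
    by_contra hb
    push Not at hb
    have : (a = a ∨ a = α a) = (b = a ∨ b = α a) :=
      h.of_invariant (g := fun c => (c = a ∨ c = α a)) (fun w => by
        refine propext ⟨?_, ?_⟩
        · rintro (h | h)
          · right; rw [← h, hα]
          · left; exact α.injective h
        · rintro (h | h)
          · right; rw [h]
          · left; rw [h, hα])
    simp [hb.1, hb.2] at this
  · rintro (rfl | rfl)
    · rfl
    · exact sameCycle_apply_right.mpr (SameCycle.refl _ _)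

/-- A sum over the elements, gathered according to the cycles of a fixed point free involution. -/
lemma sum_eq_sum_cycles_involution [Fintype W] {α : Perm W} [Fintype (Cycles α)]
    (hα : ∀ d, α (α d) = d) (hne : ∀ d, α d ≠ d) {M : Type*} [AddCommMonoid M] (x : W → M) :
    ∑ d, x d = ∑ e : Cycles α, (x e.out + x (α e.out)) := by
  classical
  rw [← Finset.sum_fiberwise (s := Finset.univ) (g := cycleMk α)]
  refine Finset.sum_congr rfl fun e _ => ?_
  have : (Finset.univ.filter fun d => cycleMk α d = e) = {e.out, α e.out} := by
    ext d
    simp only [Finset.mem_filter, Finset.mem_univ, true_and, Finset.mem_insert,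
      Finset.mem_singleton]
    rw [← sameCycle_involution hα, ← cycleMk_eq, show cycleMk α e.out = e from Quotient.out_eq e,
      eq_comm]
  rw [this, Finset.sum_pair (hne _).symm]

lemma two_mul_card_cycles_involution [Finite W] {α : Perm W}
    (hα : ∀ d, α (α d) = d) (hne : ∀ d, α d ≠ d) :
    2 * Nat.card (Cycles α) = Nat.card W := by
  classical
  cases nonempty_fintype W
  have := sum_eq_sum_cycles_involution hα hne (fun _ => (1 : ℕ))
  simp only [Finset.sum_const, Finset.card_univ, smul_eq_mul, mul_one] at this
  rw [Nat.card_eq_fintype_card, Nat.card_eq_fintype_card, this]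
  ring

/-! ### Mod 2 incidence matrices and the genus inequality -/

section Rank

variable {E V K : Type} [Fintype V] [DecidableEq V]

/-- Mod `2` incidence matrix. -/
def incidence (x y : E → V) : Matrix E V (ZMod 2) :=
  Matrix.of fun e v => (if x e = v then 1 else 0) + (if y e = v then 1 else 0)

/-- A vector in the kernel takes equal values at the two ends of each edge, so by `h` it factors
through `π`. The kernel thus has dimension at most `card K`, and rank-nullity concludes. -/
lemma card_le_rank_incidence [Finite E] [Fintype K] (x y : E → V) (π : V → K)
    (h : ∀ g : V → ZMod 2, (∀ e, g (x e) = g (y e)) → ∃ g' : K → ZMod 2, g = g' ∘ π) :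
    Fintype.card V ≤ (incidence x y).rank + Fintype.card K := by
  have h1 := LinearMap.finrank_range_add_finrank_ker (incidence x y).mulVecLin
  have h2 : Module.finrank (ZMod 2) (LinearMap.ker (incidence x y).mulVecLin) ≤
      Fintype.card K := by
    have hle : LinearMap.ker (incidence x y).mulVecLin ≤
        LinearMap.range (LinearMap.funLeft (ZMod 2) (ZMod 2) π) := by
      intro g hg
      obtain ⟨g', hg'⟩ := h g fun e => by
        have := congrFun (LinearMap.mem_ker.mp hg) e
        simp only [incidence, Matrix.mulVecLin_apply, Matrix.mulVec, dotProduct, Matrix.of_apply,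
          add_mul, ite_mul, one_mul, zero_mul, Finset.sum_add_distrib, Finset.sum_ite_eq,
          Finset.mem_univ, if_true, Pi.zero_apply] at this
        exact CharTwo.add_eq_zero.mp this
      exact ⟨g', hg'.symm⟩
    calc _ ≤ _ := Submodule.finrank_mono hle
      _ ≤ Module.finrank (ZMod 2) (K → ZMod 2) := LinearMap.finrank_range_le _
      _ = _ := by simp
  rw [Module.finrank_fintype_fun_eq_card] at h1
  rw [Matrix.rank]
  omega

end Rank

/-- The genus of a (possibly disconnected) map is nonnegative. -/
theorem card_cycles_add_le [Finite W] (σ α : Perm W) (hα : ∀ d, α (α d) = d)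
    (hne : ∀ d, α d ≠ d) :
    Nat.card (Cycles σ) + Nat.card (Cycles (σ * α)) ≤
      Nat.card (Cycles α) + 2 * Nat.card (Comp σ α) := by
  classical
  cases nonempty_fintype W
  have : Fintype (Cycles σ) := Fintype.ofFinite _
  have : Fintype (Cycles α) := Fintype.ofFinite _
  have : Fintype (Cycles (σ * α)) := Fintype.ofFinite _
  have : Fintype (Comp σ α) := Fintype.ofFinite _
  have hmem : ∀ (e : Cycles α) (d : W), cycleMk α d = e → d = e.out ∨ d = α e.out := by
    intro e d h
    rw [← sameCycle_involution hα, ← cycleMk_eq, show cycleMk α e.out = e from Quotient.out_eq e, h]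
  -- Edges against vertices for `A`, edges against faces for `B`. The orbits of `(σ * α, α)` are
  -- those of `(σ, α)`, so both have corank at most the number of orbits.
  let A := incidence (fun e : Cycles α => cycleMk σ e.out) (fun e => cycleMk σ (α e.out))
  let B := incidence (fun e : Cycles α => cycleMk (σ * α) e.out)
    (fun e => cycleMk (σ * α) (α e.out))
  have hinv : ∀ {X : Type} (g : W → X), (∀ e : Cycles α, g e.out = g (α e.out)) →
      ∀ d, g (α d) = g d := by
    intro X g hg d
    rcases hmem _ d rfl with h | h
    · have := hg (cycleMk α d)
      rw [← h] at this
      exact this.symm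
    · have h' : α d = (cycleMk α d).out := by
        conv_lhs => rw [h, hα]
      have := hg (cycleMk α d)
      rw [← h', hα] at this
      exact this
  have hA : Fintype.card (Cycles σ) ≤ A.rank + Fintype.card (Comp σ α) := by
    refine card_le_rank_incidence _ _ (Quotient.lift (Quot.mk _) ?_) ?_
    · intro a b h
      exact SameCycle.of_invariant (compMk_left σ α) h
    · intro g hg
      have h1 := hinv (g ∘ cycleMk σ) hg
      refine ⟨Quot.lift (g ∘ cycleMk σ) ?_, ?_⟩
      · rintro a b (rfl | rfl)
        · simp
        · exact (h1 a).symm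
      · ext c; induction c using Quotient.inductionOn; rfl
  have hB : Fintype.card (Cycles (σ * α)) ≤ B.rank + Fintype.card (Comp σ α) := by
    refine card_le_rank_incidence _ _ (Quotient.lift (Quot.mk _) ?_) ?_
    · intro a b h
      refine SameCycle.of_invariant (fun w => ?_) h
      rw [mul_apply]
      exact (compMk_left σ α _).trans (compMk_right σ α _)
    · intro g hg
      have h1 := hinv (g ∘ cycleMk (σ * α)) hg
      refine ⟨Quot.lift (g ∘ cycleMk (σ * α)) ?_, ?_⟩
      · rintro a b (rfl | rfl)
        · have h2 := h1 a
          have h3 := cycleMk_apply (σ * α) (α a)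
          rw [mul_apply, hα] at h3
          simp only [Function.comp_apply] at h2 ⊢
          rw [h3, h2]
        · exact (h1 a).symm
      · ext c; induction c using Quotient.inductionOn; rfl
  -- A face passes from `d` to `σ (α d)`, which has the same origin as `α d`. So along a face `f`,
  -- as many darts start at `v` as end at `v`, and the two counts cancel mod 2.
  have hAB : A.transpose * B = 0 := by
    ext v f
    let g : W → ZMod 2 := fun d => if cycleMk σ d = v then 1 else 0
    let u : W → ZMod 2 := fun d => if cycleMk (σ * α) d = f then 1 else 0
    have hg : ∀ d, g (α d) = g ((σ * α) d) := fun d => by simp [g]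
    have hu : ∀ d, u d = u ((σ * α) d) := fun d => by
      simp only [u]; rw [cycleMk_apply]
    have h1 := sum_eq_sum_cycles_involution hα hne fun d => g d * u d
    have h2 := sum_eq_sum_cycles_involution hα hne fun d => g (α d) * u d
    have h3 : ∑ d, g (α d) * u d = ∑ d, g d * u d := by
      rw [← Equiv.sum_comp (σ * α) fun d => g d * u d]
      exact Finset.sum_congr rfl fun d _ => by rw [hg, hu d]
    calc (A.transpose * B) v f
        = ∑ e : Cycles α, (g e.out + g (α e.out)) * (u e.out + u (α e.out)) := rfl
      _ = (∑ d, g d * u d) + ∑ d, g (α d) * u d := by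
          rw [h1, h2, ← Finset.sum_add_distrib]
          refine Finset.sum_congr rfl fun e _ => ?_
          rw [hα]; ring
      _ = 0 := by rw [h3, CharTwo.add_self_eq_zero]
  have := Matrix.rank_add_rank_le_card_of_mul_eq_zero hAB
  rw [Matrix.rank_transpose] at this
  simp only [Nat.card_eq_fintype_card]
  omega

/-- For permutations of a finite set, orbits are reached by forward moves. -/
lemma reflTransGen_of_comp_eq [Finite W] {σ α : Perm W} {a b : W}
    (h : compMk σ α a = compMk σ α b) :
    Relation.ReflTransGen (fun a b => b = σ a ∨ b = α a) a b := by
  -- Backward moves are compositions of forward ones: from `τ w`, a further `orderOf τ - 1` steps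
  -- lead back to `w`.
  have hpow : ∀ (τ : Perm W), (∀ w, Relation.ReflTransGen (fun a b => b = σ a ∨ b = α a) w (τ w)) →
      ∀ w, Relation.ReflTransGen (fun a b => b = σ a ∨ b = α a) (τ w) w := by
    intro τ hτ w
    have h1 : ∀ n : ℕ, Relation.ReflTransGen (fun a b => b = σ a ∨ b = α a) (τ w)
        ((τ ^ n) (τ w)) := by
      intro n
      induction n with
      | zero => exact Relation.ReflTransGen.refl
      | succ n ih => rw [pow_succ', mul_apply]; exact ih.trans (hτ _)
    have h2 := h1 (orderOf τ - 1)
    rwa [← mul_apply, ← pow_succ, Nat.sub_add_cancel (orderOf_pos τ), pow_orderOf_eq_one,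
      one_apply] at h2
  have h' := Quot.eqvGen_exact h
  induction h' with
  | rel x y hxy => exact Relation.ReflTransGen.single hxy
  | refl x => exact Relation.ReflTransGen.refl
  | trans x y z _ _ ih1 ih2 =>
    exact (ih1 (Quot.eqvGen_sound ‹_›)).trans (ih2 (Quot.eqvGen_sound ‹_›))
  | symm x y hxy ih =>
    replace ih := ih (Quot.eqvGen_sound hxy)
    clear h hxy
    induction ih with
    | refl => exact Relation.ReflTransGen.refl
    | tail _ hbc ih =>
      refine Relation.ReflTransGen.trans ?_ ih
      rcases hbc with rfl | rfl
      · exact hpow σ (fun w => Relation.ReflTransGen.single (Or.inl rfl)) _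
      · exact hpow α (fun w => Relation.ReflTransGen.single (Or.inr rfl)) _

end Equiv.Perm

/-- Two families of classes (given by class maps `cl` and `cl'`) that satisfy `P` and `P'` are in
bijection, by a map which is induced by a map between elements. -/
lemma exists_equiv_of_classes {X Y Q Q' : Type*} {cl : X → Q} {cl' : Y → Q'}
    (hcl : Function.Surjective cl) (hcl' : Function.Surjective cl') {P : Q → Prop} {P' : Q' → Prop}
    (θ : X → Y) (h1 : ∀ x, P (cl x) → P' (cl' (θ x)))
    (h2 : ∀ x x', P (cl x) → P (cl x') → (cl x = cl x' ↔ cl' (θ x) = cl' (θ x')))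
    (h3 : ∀ y, P' (cl' y) → ∃ x, P (cl x) ∧ cl' (θ x) = cl' y) :
    ∃ e : {c // P c} ≃ {c // P' c}, ∀ x (h : P (cl x)), (e ⟨cl x, h⟩).1 = cl' (θ x) := by
  choose r hr using hcl
  let f : {c // P c} → {c // P' c} := fun c =>
    ⟨cl' (θ (r c.1)), h1 _ (by rw [hr]; exact c.2)⟩
  have hf : ∀ x (h : P (cl x)), (f ⟨cl x, h⟩).1 = cl' (θ x) := fun x h =>
    (h2 _ _ (by rw [hr]; exact h) h).mp (hr _)
  have hb : Function.Bijective f := by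
    constructor
    · rintro ⟨c, hc⟩ ⟨d, hd⟩ h
      have h' := congrArg Subtype.val h
      have := (h2 (r c) (r d) (by rw [hr]; exact hc) (by rw [hr]; exact hd)).mpr h'
      rw [hr, hr] at this
      exact Subtype.ext this
    · rintro ⟨c, hc⟩
      obtain ⟨y, rfl⟩ := hcl' c
      obtain ⟨x, hx, hxy⟩ := h3 y hc
      exact ⟨⟨cl x, hx⟩, Subtype.ext ((hf x hx).trans hxy)⟩
  exact ⟨Equiv.ofBijective f hb, hf⟩

/-! ### Elementary facts on rooted maps -/

namespace CombMap
open Equiv Equiv.Perm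

variable {D E W : Type}

section Basic

variable (m : CombMap D)

lemma vertexOf_eq_iff {a b : D} : m.vertexOf a = m.vertexOf b ↔ m.next.SameCycle a b :=
  cycleMk_eq

lemma edgeOf_eq_iff {a b : D} : m.edgeOf a = m.edgeOf b ↔ b = a ∨ b = m.flip a :=
  cycleMk_eq.trans (sameCycle_involution m.flip_flip)

lemma faceOf_eq_iff {a b : D} : m.faceOf a = m.faceOf b ↔ m.faceNext.SameCycle a b :=
  cycleMk_eq

lemma faceOf_faceNext (a : D) : m.faceOf (m.faceNext a) = m.faceOf a := cycleMk_apply _ _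

lemma vertexOf_next (a : D) : m.vertexOf (m.next a) = m.vertexOf a := cycleMk_apply _ _

lemma vertexOf_surjective : Function.Surjective m.vertexOf := Quotient.mk_surjective

lemma edgeOf_surjective : Function.Surjective m.edgeOf := Quotient.mk_surjective

lemma faceOf_surjective : Function.Surjective m.faceOf := Quotient.mk_surjective

instance [Finite D] : Finite m.Vertex := inferInstanceAs (Finite (Quotient _))

instance [Finite D] : Finite m.Edge := inferInstanceAs (Finite (Quotient _))

instance [Finite D] : Finite m.Face := inferInstanceAs (Finite (Quotient _))

@[simp] lemma faceNext_flip (a : D) : m.faceNext (m.flip a) = m.next a := by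
  simp [faceNext, m.flip_flip]

lemma faceNext_apply (a : D) : m.faceNext a = m.next (m.flip a) := rfl

lemma two_mul_card_edge [Finite D] : 2 * Nat.card m.Edge = Nat.card D :=
  two_mul_card_cycles_involution m.flip_flip m.flip_ne

lemma isConnected_iff : m.IsConnected ↔ ∀ P : D → Prop, P m.root → (∀ d, P d → P (m.next d)) →
    (∀ d, P d → P (m.flip d)) → ∀ d, P d := by
  constructor
  · intro h P h0 h1 h2 d
    induction h d with
    | refl => exact h0
    | tail _ hbc ih =>
      rcases hbc with rfl | rfl
      · exact h1 _ ih
      · exact h2 _ ih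
  · intro h
    exact h _ Relation.ReflTransGen.refl (fun d hd => hd.tail (Or.inl rfl))
      (fun d hd => hd.tail (Or.inr rfl))

lemma IsConnected.induction {m : CombMap D} (h : m.IsConnected) {P : D → Prop} (h0 : P m.root)
    (h1 : ∀ d, P d → P (m.next d)) (h2 : ∀ d, P d → P (m.flip d)) (d : D) : P d :=
  m.isConnected_iff.mp h P h0 h1 h2 d

lemma isConnected_of_compMk [Finite D]
    (h : ∀ d, compMk m.next m.flip m.root = compMk m.next m.flip d) : m.IsConnected :=
  fun d => reflTransGen_of_comp_eq (h d)

lemma IsConnected.card_comp {m : CombMap D} (h : m.IsConnected) :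
    Nat.card (Comp m.next m.flip) = 1 := by
  rw [Nat.card_eq_one_iff_unique]
  refine ⟨⟨?_⟩, ⟨Quot.mk _ m.root⟩⟩
  have key : ∀ a, compMk m.next m.flip a = compMk m.next m.flip m.root :=
    h.induction rfl (fun d hd => by rw [compMk_left, hd]) (fun d hd => by rw [compMk_right, hd])
  intro x y
  induction x using Quot.inductionOn
  induction y using Quot.inductionOn
  exact (key _).trans (key _).symm

lemma IsConnected.card_le [Finite D] {m : CombMap D} (h : m.IsConnected) :
    Nat.card m.Vertex + Nat.card m.Face ≤ Nat.card m.Edge + 2 := by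
  have := card_cycles_add_le m.next m.flip m.flip_flip m.flip_ne
  rw [h.card_comp] at this
  exact this

end Basic

/-! ### Submaps with inherited cyclic orders, and unzipping along a submap -/

/-- The cyclic orders of `C` are obtained from those of `m` by erasing the darts that do not come
from `C`. -/
def IsInduced (m : CombMap D) (C : CombMap E) (j : E → D) : Prop :=
  ∀ s, ∃ k, 0 < k ∧ (m.next ^ k) (j s) = j (C.next s) ∧
    ∀ i, 0 < i → i < k → (m.next ^ i) (j s) ∉ Set.range j

section Induced

variable {m : CombMap D} {C : CombMap E} {j : E → D}

lemma IsInduced.sameCycle_next (h : IsInduced m C j) (s : E) :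
    m.next.SameCycle (j s) (j (C.next s)) := by
  obtain ⟨k, -, hk, -⟩ := h s
  rw [← hk]
  exact sameCycle_pow_right.mpr (SameCycle.refl _ _)

/-- For the forward direction, induct on the number of `m.next` steps from `j s` to `j t`: a nonzero
number of steps cannot be smaller than the first return time, so the walk passes through `j (C.next
s)`. -/
lemma IsInduced.sameCycle_iff [Finite D] (h : IsInduced m C j) (hj : Function.Injective j)
    {s t : E} : m.next.SameCycle (j s) (j t) ↔ C.next.SameCycle s t := by
  constructor
  · intro hst
    obtain ⟨n, hn⟩ := hst.exists_nat_pow_eq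
    clear hst
    induction n using Nat.strong_induction_on generalizing s with
    | _ n ih =>
      rcases Nat.eq_zero_or_pos n with rfl | hpos
      · exact hj (show j s = j t by simpa using hn) ▸ SameCycle.refl _ _
      · obtain ⟨k, hk0, hk, hmin⟩ := h s
        by_cases hnk : n < k
        · exact absurd ⟨t, hn.symm⟩ (hmin n hpos hnk)
        · push Not at hnk
          have : (m.next ^ (n - k)) (j (C.next s)) = j t := by
            rw [← hk, ← mul_apply, ← pow_add, Nat.sub_add_cancel hnk, hn]
          exact sameCycle_apply_left.mp (ih (n - k) (by omega) this)
  · intro hst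
    have := hst.of_invariant (g := fun s => cycleMk m.next (j s))
      (fun w => (cycleMk_eq.mpr (h.sameCycle_next w)).symm)
    exact cycleMk_eq.mp this

end Induced

/-- `(σ, α)` is obtained from `m` by unzipping the edges of its submap `C`: the darts `inr s` are
new, and they run along the holes that replace the faces of `C`. -/
structure IsUnzip (m : CombMap D) (C : CombMap E) (σ α : Perm W) (j : E → D)
    (Ψ : D ⊕ E ≃ W) : Prop where
  inj : Function.Injective j
  j_flip : ∀ s, j (C.flip s) = m.flip (j s)
  j_root : j C.root = m.root
  α_j : ∀ s, α (Ψ (Sum.inl (j s))) = Ψ (Sum.inr s)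
  α_inr : ∀ s, α (Ψ (Sum.inr s)) = Ψ (Sum.inl (j s))
  α_inl : ∀ d, d ∉ Set.range j → α (Ψ (Sum.inl d)) = Ψ (Sum.inl (m.flip d))
  φ_inl : ∀ d, σ (α (Ψ (Sum.inl d))) = Ψ (Sum.inl (m.faceNext d))
  φ_inr : ∀ s, σ (α (Ψ (Sum.inr (C.faceNext s)))) = Ψ (Sum.inr s)

namespace IsUnzip

variable {m : CombMap D} {C : CombMap E} {σ α : Perm W} {j : E → D} {Ψ : D ⊕ E ≃ W}

/-- Each vertex is on the boundary of at most one hole, and is visited once. -/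
def Simple (_ : IsUnzip m C σ α j Ψ) : Prop :=
  ∀ s t, σ.SameCycle (Ψ (Sum.inr s)) (Ψ (Sum.inr t)) → s = t

variable (h : IsUnzip m C σ α j Ψ)
include h

lemma flip_mem {d : D} : m.flip d ∈ Set.range j ↔ d ∈ Set.range j := by
  constructor
  · rintro ⟨s, hs⟩
    exact ⟨C.flip s, by rw [h.j_flip, hs, m.flip_flip]⟩
  · rintro ⟨s, rfl⟩
    exact ⟨C.flip s, h.j_flip s⟩

lemma σ_inr (s : E) : σ (Ψ (Sum.inr s)) = Ψ (Sum.inl (m.next (j (C.flip s)))) := by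
  rw [← h.α_j, h.φ_inl, h.j_flip, faceNext_apply]

lemma σ_j (s : E) : σ (Ψ (Sum.inl (j (C.faceNext s)))) = Ψ (Sum.inr s) := by
  rw [← h.α_inr, h.φ_inr]

lemma σ_inl {d : D} (hd : d ∉ Set.range j) :
    σ (Ψ (Sum.inl d)) = Ψ (Sum.inl (m.next d)) := by
  have h1 : m.flip d ∉ Set.range j := fun h' => hd (h.flip_mem.mp h')
  have h2 := h.α_inl _ h1
  rw [m.flip_flip] at h2
  rw [← h2, h.φ_inl, faceNext_flip]

lemma α_α (w : W) : α (α w) = w := by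
  obtain ⟨u, rfl⟩ := Ψ.surjective w
  rcases u with d | s
  · by_cases hd : d ∈ Set.range j
    · obtain ⟨s, rfl⟩ := hd
      rw [h.α_j, h.α_inr]
    · rw [h.α_inl _ hd, h.α_inl _ (fun h' => hd (h.flip_mem.mp h')), m.flip_flip]
  · rw [h.α_inr, h.α_j]

lemma α_ne (w : W) : α w ≠ w := by
  obtain ⟨u, rfl⟩ := Ψ.surjective w
  rcases u with d | s
  · by_cases hd : d ∈ Set.range j
    · obtain ⟨s, rfl⟩ := hd
      rw [h.α_j]; simp
    · rw [h.α_inl _ hd]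
      simpa using m.flip_ne d
  · rw [h.α_inr]; simp

/-- Turning around a vertex of the unzipped map from a new dart sweeps the corner of `C` that
follows `s`: the darts of `m` after `j s`, up to the next dart of `C`. -/
lemma pow_inr (s : E) (k : ℕ) (hk : ∀ i, 0 < i → i < k → (m.next ^ i) (j s) ∉ Set.range j) (i : ℕ)
    (hi : 0 < i) (hik : i ≤ k) :
    (σ ^ i) (Ψ (Sum.inr (C.flip s))) = Ψ (Sum.inl ((m.next ^ i) (j s))) := by
  induction i with
  | zero => omega
  | succ i ih =>
    rcases Nat.eq_zero_or_pos i with rfl | hi'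
    · simp [h.σ_inr, C.flip_flip]
    · rw [pow_succ', mul_apply, ih hi' (by omega), h.σ_inl (hk i hi' (by omega)), pow_succ',
        mul_apply]

/-- Let `j r` be the first dart of `C` after `j s`. The sweep started at `inr (C.flip s)` ends at
`inr (C.faceNext.symm r)`. Both new darts are at the same vertex, so they coincide, which says `r =
C.next s`. -/
lemma isInduced_of_simple [Finite D] (hs : h.Simple) : IsInduced m C j := by
  classical
  intro s
  have hex : ∃ k, 0 < k ∧ (m.next ^ k) (j s) ∈ Set.range j :=
    ⟨orderOf m.next, orderOf_pos _, by rw [pow_orderOf_eq_one]; exact ⟨s, rfl⟩⟩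
  have hmin : ∀ i, 0 < i → i < Nat.find hex → (m.next ^ i) (j s) ∉ Set.range j :=
    fun i hi hik hmem => Nat.find_min hex hik ⟨hi, hmem⟩
  obtain ⟨hpos, r, hr⟩ := Nat.find_spec hex
  refine ⟨Nat.find hex, hpos, ?_, hmin⟩
  have h1 := h.pow_inr s _ hmin _ hpos le_rfl
  have h2 : (σ ^ (Nat.find hex + 1)) (Ψ (Sum.inr (C.flip s))) =
      Ψ (Sum.inr (C.faceNext.symm r)) := by
    rw [pow_succ', mul_apply, h1, ← hr, ← h.σ_j, apply_symm_apply]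
  have h3 := hs (C.flip s) (C.faceNext.symm r)
    (by rw [← h2]; exact sameCycle_pow_right.mpr (SameCycle.refl _ _))
  rw [← hr, eq_symm_apply, faceNext_flip] at *
  rw [h3]

/-- The sweep from `inr s` reaches `j (C.faceNext s)` and then closes up at `inr s`, so it meets no
other new dart. The induction removes full turns of length `k + 1`. -/
lemma simple_of_isInduced [Finite W] (hI : IsInduced m C j) : h.Simple := by
  intro s t hst
  obtain ⟨n, hn⟩ := hst.exists_nat_pow_eq
  clear hst
  induction n using Nat.strong_induction_on with
  | _ n ih =>
    rcases Nat.eq_zero_or_pos n with rfl | hpos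
    · simpa using hn
    · obtain ⟨k, hk0, hk, hmin⟩ := hI (C.flip s)
      have h1 := h.pow_inr _ k hmin
      rw [C.flip_flip] at h1
      by_cases hnk : n ≤ k
      · rw [h1 n hpos hnk] at hn
        simp at hn
      · push Not at hnk
        refine ih (n - (k + 1)) (by omega) ?_
        have h2 : (σ ^ (k + 1)) (Ψ (Sum.inr s)) = Ψ (Sum.inr s) := by
          rw [pow_succ', mul_apply, h1 k hk0 le_rfl, hk, ← h.σ_j s, faceNext_apply]
        rw [← h2, ← mul_apply, ← pow_add, Nat.sub_add_cancel hnk, hn]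

/-- Zipping back sends vertices to vertices. A new dart `inr s` is the reverse of `j s`, so it
starts from the origin of `j (C.flip s)`. -/
lemma vertex_invariant (hI : IsInduced m C j) (w : W) :
    Sum.elim (cycleMk m.next) (fun s => cycleMk m.next (j (C.flip s))) (Ψ.symm (σ w)) =
      Sum.elim (cycleMk m.next) (fun s => cycleMk m.next (j (C.flip s))) (Ψ.symm w) := by
  obtain ⟨u, rfl⟩ := Ψ.surjective w
  rcases u with d | s
  · by_cases hd : d ∈ Set.range j
    · obtain ⟨s, rfl⟩ := hd
      obtain ⟨t, rfl⟩ := C.faceNext.surjective s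
      rw [h.σ_j]
      simpa [cycleMk_eq, faceNext_apply] using hI.sameCycle_next (C.flip t)
    · rw [h.σ_inl hd]
      simp
  · rw [h.σ_inr]
    simp

lemma vertex_label_eq (hI : IsInduced m C j) {w w' : W} (hw : σ.SameCycle w w') :
    Sum.elim (cycleMk m.next) (fun s => cycleMk m.next (j (C.flip s))) (Ψ.symm w) =
      Sum.elim (cycleMk m.next) (fun s => cycleMk m.next (j (C.flip s))) (Ψ.symm w') :=
  hw.of_invariant (g := fun w => Sum.elim (cycleMk m.next)
    (fun s => cycleMk m.next (j (C.flip s))) (Ψ.symm w)) (h.vertex_invariant hI)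

lemma sameCycle_of_inl_inr (hI : IsInduced m C j) {d : D} {s : E}
    (hd : σ.SameCycle (Ψ (Sum.inl d)) (Ψ (Sum.inr s))) : m.next.SameCycle d (j (C.flip s)) := by
  have := h.vertex_label_eq hI hd
  simpa [cycleMk_eq] using this

lemma sameCycle_of_inl_inl (hI : IsInduced m C j) {d d' : D}
    (hd : σ.SameCycle (Ψ (Sum.inl d)) (Ψ (Sum.inl d'))) : m.next.SameCycle d d' := by
  have := h.vertex_label_eq hI hd
  simpa [cycleMk_eq] using this

/-- When a vertex of `m` met by `C` is cut open, each of the resulting vertices carries a new dart.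
-/
lemma exists_sameCycle_inr [Finite D] {d : D} {s : E} (hd : m.next.SameCycle (j s) d) :
    ∃ t, σ.SameCycle (Ψ (Sum.inl d)) (Ψ (Sum.inr t)) := by
  have hj : ∀ s, ∃ t, σ.SameCycle (Ψ (Sum.inl (j s))) (Ψ (Sum.inr t)) := fun s => by
    obtain ⟨t, rfl⟩ := C.faceNext.surjective s
    exact ⟨t, by rw [← h.σ_j]; exact sameCycle_apply_right.mpr (SameCycle.refl _ _)⟩
  obtain ⟨n, rfl⟩ := hd.exists_nat_pow_eq
  clear hd
  induction n with
  | zero => exact hj s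
  | succ n ih =>
    obtain ⟨t, ht⟩ := ih
    rw [pow_succ', mul_apply]
    by_cases hr : (m.next ^ n) (j s) ∈ Set.range j
    · obtain ⟨r, hr⟩ := hr
      refine ⟨C.flip r, ?_⟩
      rw [← hr]
      have := h.σ_inr (C.flip r)
      rw [C.flip_flip] at this
      rw [← this]
      exact sameCycle_apply_left.mpr (SameCycle.refl _ _)
    · refine ⟨t, ?_⟩
      rw [← h.σ_inl hr]
      exact sameCycle_apply_left.mpr ht

/-- Vertices of `m` away from `C` are unchanged (`e1`), and those met by `C` are the vertices of `C`
(`e2`). The latter are replaced by the corners of `C`, one for each new dart (`e3`). -/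
lemma card_vertex [Finite D] [Finite E] [Finite W] (hI : IsInduced m C j) :
    Nat.card (Cycles σ) + Nat.card C.Vertex = Nat.card m.Vertex + Nat.card E := by
  classical
  have hS := h.simple_of_isInduced hI
  let P : Cycles m.next → Prop := fun c => ∃ s, c = cycleMk m.next (j s)
  let P' : Cycles σ → Prop := fun c => ∃ s, c = cycleMk σ (Ψ (Sum.inr s))
  obtain ⟨e1, -⟩ : ∃ e : {c // ¬ P c} ≃ {c // ¬ P' c}, ∀ x (hx : ¬ P (cycleMk m.next x)),
      (e ⟨cycleMk m.next x, hx⟩).1 = cycleMk σ (Ψ (Sum.inl x)) := by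
    refine exists_equiv_of_classes (cycleMk_surjective _) (cycleMk_surjective _)
      (fun d => Ψ (Sum.inl d)) ?_ ?_ ?_
    · rintro d hd ⟨s, hs⟩
      exact hd ⟨C.flip s, cycleMk_eq.mpr (h.sameCycle_of_inl_inr hI (cycleMk_eq.mp hs))⟩
    · intro d d' hd hd'
      rw [cycleMk_eq, cycleMk_eq]
      refine ⟨fun hdd => ?_, h.sameCycle_of_inl_inl hI⟩
      obtain ⟨n, rfl⟩ := hdd.exists_nat_pow_eq
      clear hdd hd'
      induction n with
      | zero => exact SameCycle.refl _ _
      | succ n ih =>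
        refine ih.trans ?_
        rw [pow_succ', mul_apply, ← h.σ_inl]
        · exact sameCycle_apply_right.mpr (SameCycle.refl _ _)
        · rintro ⟨s, hs⟩
          refine hd ⟨s, ?_⟩
          rw [cycleMk_eq, hs]
          exact sameCycle_pow_right.mpr (SameCycle.refl _ _)
    · intro w hw
      obtain ⟨u, rfl⟩ := Ψ.surjective w
      rcases u with d | s
      · refine ⟨d, ?_, rfl⟩
        rintro ⟨s, hs⟩
        obtain ⟨t, ht⟩ := h.exists_sameCycle_inr (cycleMk_eq.mp hs.symm)
        exact hw ⟨t, cycleMk_eq.mpr ht⟩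
      · exact absurd ⟨s, rfl⟩ hw
  obtain ⟨e2, -⟩ : ∃ e : {c : C.Vertex // True} ≃ {c // P c}, ∀ x (hx : True),
      (e ⟨C.vertexOf x, hx⟩).1 = cycleMk m.next (j x) := by
    refine exists_equiv_of_classes C.vertexOf_surjective (cycleMk_surjective _) j ?_ ?_ ?_
    · intro s _; exact ⟨s, rfl⟩
    · intro s t _ _
      rw [vertexOf_eq_iff, cycleMk_eq, hI.sameCycle_iff h.inj]
    · rintro d ⟨s, hs⟩
      exact ⟨s, trivial, hs.symm⟩
  obtain ⟨e3, -⟩ : ∃ e : {c : E // True} ≃ {c // P' c}, ∀ x (hx : True),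
      (e ⟨id x, hx⟩).1 = cycleMk σ (Ψ (Sum.inr x)) := by
    refine exists_equiv_of_classes Function.surjective_id (cycleMk_surjective _)
      (fun s => Ψ (Sum.inr s)) ?_ ?_ ?_
    · intro s _; exact ⟨s, rfl⟩
    · intro s t _ _
      refine ⟨fun hst => by rw [show s = t from hst], fun hst => hS s t (cycleMk_eq.mp hst)⟩
    · rintro d ⟨s, hs⟩
      exact ⟨s, trivial, hs.symm⟩
  have c1 : Nat.card m.Vertex = Nat.card {c // P c} + Nat.card {c // ¬ P c} := by
    rw [← Nat.card_sum]; exact (Nat.card_congr (Equiv.sumCompl P)).symm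
  have c2 : Nat.card (Cycles σ) = Nat.card {c // P' c} + Nat.card {c // ¬ P' c} := by
    rw [← Nat.card_sum]; exact (Nat.card_congr (Equiv.sumCompl P')).symm
  have c3 := Nat.card_congr (e2.symm.trans (Equiv.subtypeUnivEquiv fun _ => trivial))
  have c4 := Nat.card_congr (e3.symm.trans (Equiv.subtypeUnivEquiv fun _ => trivial))
  have c5 := Nat.card_congr e1
  omega

/-- The faces of the unzipped map are the faces of `m` and the holes. -/
lemma face_invariant (w : W) :
    Sum.map m.faceOf C.faceOf (Ψ.symm ((σ * α) w)) = Sum.map m.faceOf C.faceOf (Ψ.symm w) := by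
  obtain ⟨u, rfl⟩ := Ψ.surjective w
  rcases u with d | s
  · rw [mul_apply, h.φ_inl]
    simp [faceOf_faceNext]
  · obtain ⟨t, rfl⟩ := C.faceNext.surjective s
    rw [mul_apply, h.φ_inr]
    simp [faceOf_faceNext]

lemma face_label_eq {w w' : W} (hw : (σ * α).SameCycle w w') :
    Sum.map m.faceOf C.faceOf (Ψ.symm w) = Sum.map m.faceOf C.faceOf (Ψ.symm w') :=
  hw.of_invariant (g := fun w => Sum.map m.faceOf C.faceOf (Ψ.symm w)) h.face_invariant

lemma sameCycle_face_inl {d d' : D} :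
    (σ * α).SameCycle (Ψ (Sum.inl d)) (Ψ (Sum.inl d')) ↔ m.faceOf d = m.faceOf d' := by
  constructor
  · intro hd
    simpa using h.face_label_eq hd
  · intro hd
    rw [← cycleMk_eq]
    refine (m.faceOf_eq_iff.mp hd).of_invariant (g := fun d => cycleMk (σ * α) (Ψ (Sum.inl d)))
      fun w => ?_
    have : Ψ (Sum.inl (m.faceNext w)) = (σ * α) (Ψ (Sum.inl w)) := (h.φ_inl w).symm
    simp only [this, cycleMk_apply]

lemma sameCycle_face_inr {s t : E} :
    (σ * α).SameCycle (Ψ (Sum.inr s)) (Ψ (Sum.inr t)) ↔ C.faceOf s = C.faceOf t := by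
  constructor
  · intro hd
    simpa using h.face_label_eq hd
  · intro hd
    rw [← cycleMk_eq]
    refine (C.faceOf_eq_iff.mp hd).of_invariant (g := fun d => cycleMk (σ * α) (Ψ (Sum.inr d)))
      fun w => ?_
    have : Ψ (Sum.inr w) = (σ * α) (Ψ (Sum.inr (C.faceNext w))) := (h.φ_inr w).symm
    simp only [this, cycleMk_apply]

lemma not_sameCycle_face {d : D} {s : E} :
    ¬ (σ * α).SameCycle (Ψ (Sum.inl d)) (Ψ (Sum.inr s)) := by
  intro hd
  simpa using h.face_label_eq hd

lemma card_face [Finite D] [Finite E] :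
    Nat.card (Cycles (σ * α)) = Nat.card m.Face + Nat.card C.Face := by
  obtain ⟨e1, -⟩ : ∃ e : {c : m.Face ⊕ C.Face // True} ≃ {c : Cycles (σ * α) // True},
      ∀ x (hx : True), (e ⟨Sum.map m.faceOf C.faceOf x, hx⟩).1 = cycleMk (σ * α) (Ψ x) := by
    refine exists_equiv_of_classes (m.faceOf_surjective.sumMap C.faceOf_surjective)
      (cycleMk_surjective _) Ψ (fun _ _ => trivial) ?_ ?_
    · rintro (d | s) (d' | s') _ _
      · rw [cycleMk_eq, h.sameCycle_face_inl]; simp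
      · rw [cycleMk_eq]; simp [h.not_sameCycle_face]
      · rw [cycleMk_eq, sameCycle_comm]; simp [h.not_sameCycle_face]
      · rw [cycleMk_eq, h.sameCycle_face_inr]; simp
    · intro w _
      exact ⟨Ψ.symm w, trivial, by simp⟩
  rw [← Nat.card_sum]
  exact Nat.card_congr ((Equiv.subtypeUnivEquiv fun _ => trivial).symm.trans
    (e1.symm.trans (Equiv.subtypeUnivEquiv fun _ => trivial)))

omit h in
lemma card_edge [Finite D] [Finite E] (h : IsUnzip m C σ α j Ψ) :
    Nat.card (Cycles α) = Nat.card m.Edge + Nat.card C.Edge := by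
  have : Finite W := Finite.of_equiv _ Ψ
  have h1 := two_mul_card_cycles_involution h.α_α h.α_ne
  have h2 := m.two_mul_card_edge
  have h3 := C.two_mul_card_edge
  rw [← Nat.card_congr Ψ, Nat.card_sum] at h1
  omega

end IsUnzip

end CombMap

/-! ### Disjoint unions of maps -/

namespace Equiv.Perm

variable {ι : Type*} {X : ι → Type*}

lemma sameCycle_sigmaCongrRight {τ : ∀ i, Perm (X i)} {a b : Σ i, X i} :
    (Perm.sigmaCongrRight τ).SameCycle a b ↔
      (⟨a.1, Quotient.mk (SameCycle.setoid (τ a.1)) a.2⟩ :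
        Σ i, Quotient (SameCycle.setoid (τ i))) = ⟨b.1, Quotient.mk _ b.2⟩ := by
  constructor
  · rintro ⟨i, rfl⟩
    have : ∀ i : ℤ, (Perm.sigmaCongrRight τ ^ i) a = ⟨a.1, (τ a.1 ^ i) a.2⟩ := by
      have h1 : ∀ (n : ℕ) a, (Perm.sigmaCongrRight τ ^ n) a = ⟨a.1, (τ a.1 ^ n) a.2⟩ := by
        intro n
        induction n with
        | zero => simp
        | succ n ih =>
          intro a
          rw [pow_succ', mul_apply, ih]
          simp [pow_succ', Equiv.sigmaCongrRight]
      intro i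
      obtain ⟨n, rfl | rfl⟩ := i.eq_nat_or_neg
      · simpa using h1 n a
      · rw [zpow_neg, zpow_natCast, inv_eq_iff_eq, h1]
        simp
    rw [this]
    refine Sigma.ext rfl (heq_of_eq ?_)
    exact Quotient.sound (sameCycle_zpow_right.mpr (SameCycle.refl _ _))
  · obtain ⟨i, x⟩ := a
    obtain ⟨k, y⟩ := b
    intro h
    obtain rfl : i = k := congrArg Sigma.fst h
    have h' : (τ i).SameCycle x y := Quotient.exact (eq_of_heq (Sigma.mk.inj h).2)
    have key : ∀ (n : ℕ) x, (Perm.sigmaCongrRight τ ^ n) ⟨i, x⟩ = ⟨i, (τ i ^ n) x⟩ := by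
      intro n
      induction n with
      | zero => simp
      | succ n ih =>
        intro x
        rw [pow_succ', mul_apply, ih]
        simp [pow_succ', Equiv.sigmaCongrRight]
    obtain ⟨n, rfl⟩ := h'
    obtain ⟨n, rfl | rfl⟩ := n.eq_nat_or_neg
    · exact ⟨n, by simpa using key n x⟩
    · refine SameCycle.symm ⟨n, ?_⟩
      rw [zpow_natCast, key]
      simp

end Equiv.Perm

namespace CombMap
open Equiv Equiv.Perm

variable {D E : Type}

/-- A chosen dart on each face. -/
noncomputable def faceRep (C : CombMap E) (f : C.Face) : E := Quotient.out f

@[simp] lemma faceOf_faceRep (C : CombMap E) (f : C.Face) : C.faceOf (C.faceRep f) = f :=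
  Quotient.out_eq f

lemma degree_eq_ncard (m : CombMap D) (f : m.Face) : m.degree f = {d | m.faceOf d = f}.ncard := rfl

section Family

variable {ι : Type} {X : ι → Type} (J : ∀ i, CombMap (X i))

/-- Disjoint union of the vertex permutations of a family of maps. -/
def sigmaNext : Perm (Σ i, X i) := Perm.sigmaCongrRight fun i => (J i).next

/-- Disjoint union of the edge permutations of a family of maps. -/
def sigmaFlip : Perm (Σ i, X i) := Perm.sigmaCongrRight fun i => (J i).flip

@[simp] lemma sigmaNext_apply (w : Σ i, X i) : sigmaNext J w = ⟨w.1, (J w.1).next w.2⟩ := rfl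

@[simp] lemma sigmaFlip_apply (w : Σ i, X i) : sigmaFlip J w = ⟨w.1, (J w.1).flip w.2⟩ := rfl

/-- The face of an element of a disjoint union of maps. -/
def sigmaFace (w : Σ i, X i) : Σ i, (J i).Face := ⟨w.1, (J w.1).faceOf w.2⟩

/-- The edge of an element of a disjoint union of maps. -/
def sigmaEdge (w : Σ i, X i) : Σ i, (J i).Edge := ⟨w.1, (J w.1).edgeOf w.2⟩

/-- The vertex of an element of a disjoint union of maps. -/
def sigmaVertex (w : Σ i, X i) : Σ i, (J i).Vertex := ⟨w.1, (J w.1).vertexOf w.2⟩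

variable {J}

lemma sigmaFace_eq {a b : Σ i, X i} :
    sigmaFace J a = sigmaFace J b ↔ (sigmaNext J * sigmaFlip J).SameCycle a b := by
  rw [sigmaNext, sigmaFlip, Perm.sigmaCongrRight_mul, sameCycle_sigmaCongrRight]
  rfl

lemma sigmaVertex_eq {a b : Σ i, X i} :
    sigmaVertex J a = sigmaVertex J b ↔ (sigmaNext J).SameCycle a b := by
  rw [sigmaNext, sameCycle_sigmaCongrRight]
  rfl

lemma sigmaEdge_eq {a b : Σ i, X i} :
    sigmaEdge J a = sigmaEdge J b ↔ b = a ∨ b = sigmaFlip J a := by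
  rw [← sameCycle_involution (fun w => by simp [(J w.1).flip_flip]), sigmaFlip,
    sameCycle_sigmaCongrRight]
  rfl

lemma sigmaEdge_surjective : Function.Surjective (sigmaEdge J) := by
  rintro ⟨i, e⟩
  obtain ⟨x, rfl⟩ := (J i).edgeOf_surjective e
  exact ⟨⟨i, x⟩, rfl⟩

lemma sigmaFace_surjective : Function.Surjective (sigmaFace J) := by
  rintro ⟨i, e⟩
  obtain ⟨x, rfl⟩ := (J i).faceOf_surjective e
  exact ⟨⟨i, x⟩, rfl⟩

lemma sigmaVertex_surjective : Function.Surjective (sigmaVertex J) := by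
  rintro ⟨i, e⟩
  obtain ⟨x, rfl⟩ := (J i).vertexOf_surjective e
  exact ⟨⟨i, x⟩, rfl⟩

lemma degree_eq_ncard_sigma (i : ι) (f : (J i).Face) :
    (J i).degree f = {w | sigmaFace J w = ⟨i, f⟩}.ncard := by
  rw [degree_eq_ncard, ← Set.ncard_image_of_injective _ (sigma_mk_injective (i := i))]
  congr 1
  ext ⟨k, x⟩
  constructor
  · rintro ⟨y, hy, h⟩
    rw [← h]
    exact Sigma.ext rfl (heq_of_eq hy)
  · intro h
    obtain rfl : k = i := congrArg Sigma.fst h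
    exact ⟨x, eq_of_heq (Sigma.mk.inj h).2, rfl⟩

lemma card_cycles_sigmaNext [Fintype ι] [∀ i, Finite (X i)] :
    Nat.card (Cycles (sigmaNext J)) = ∑ i, Nat.card (J i).Vertex := by
  rw [← Nat.card_sigma]
  obtain ⟨e, -⟩ := exists_equiv_of_classes (cycleMk_surjective (sigmaNext J))
    (sigmaVertex_surjective (J := J)) (P := fun _ => True) (P' := fun _ => True) id
    (fun _ _ => trivial) (fun x y _ _ => by rw [cycleMk_eq, ← sigmaVertex_eq]; rfl)
    (fun y _ => ⟨y, trivial, rfl⟩)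
  exact Nat.card_congr ((Equiv.subtypeUnivEquiv fun _ => trivial).symm.trans
    (e.trans (Equiv.subtypeUnivEquiv fun _ => trivial)))

lemma card_cycles_sigmaFace [Fintype ι] [∀ i, Finite (X i)] :
    Nat.card (Cycles (sigmaNext J * sigmaFlip J)) = ∑ i, Nat.card (J i).Face := by
  rw [← Nat.card_sigma]
  obtain ⟨e, -⟩ := exists_equiv_of_classes (cycleMk_surjective (sigmaNext J * sigmaFlip J))
    (sigmaFace_surjective (J := J)) (P := fun _ => True) (P' := fun _ => True) id
    (fun _ _ => trivial) (fun x y _ _ => by rw [cycleMk_eq, ← sigmaFace_eq]; rfl)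
    (fun y _ => ⟨y, trivial, rfl⟩)
  exact Nat.card_congr ((Equiv.subtypeUnivEquiv fun _ => trivial).symm.trans
    (e.trans (Equiv.subtypeUnivEquiv fun _ => trivial)))

lemma card_cycles_sigmaFlip [Fintype ι] [∀ i, Finite (X i)] :
    Nat.card (Cycles (sigmaFlip J)) = ∑ i, Nat.card (J i).Edge := by
  rw [← Nat.card_sigma]
  obtain ⟨e, -⟩ := exists_equiv_of_classes (cycleMk_surjective (sigmaFlip J))
    (sigmaEdge_surjective (J := J)) (P := fun _ => True) (P' := fun _ => True) id
    (fun _ _ => trivial) (fun x y _ _ => by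
      rw [cycleMk_eq, sameCycle_involution (fun w => by simp [(J w.1).flip_flip]), ← sigmaEdge_eq]
      rfl)
    (fun y _ => ⟨y, trivial, rfl⟩)
  exact Nat.card_congr ((Equiv.subtypeUnivEquiv fun _ => trivial).symm.trans
    (e.trans (Equiv.subtypeUnivEquiv fun _ => trivial)))

end Family

/-! ### Gluing maps into the faces of `C`: dictionary between the glued map and its pieces -/

/-- `m` is obtained by gluing the maps `J f` into the faces `f` of `C`. -/
structure IsGlue (m : CombMap D) (κ : m.Edge → Bool) (C : CombMap E) {X : C.Face → Type}
    (J : ∀ f, CombMap (X f)) (κJ : ∀ f, (J f).Edge → Bool) (j : E → D)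
    (Ψ : D ⊕ E ≃ Σ f, X f) : Prop extends IsUnzip m C (sigmaNext J) (sigmaFlip J) j Ψ where
  fst_inr : ∀ s, (Ψ (Sum.inr s)).1 = C.faceOf s
  root_eq : ∀ f, Ψ (Sum.inr (C.faceRep f)) = ⟨f, (J f).root⟩
  color : ∀ d, κ (m.edgeOf d) = κJ _ ((J _).edgeOf (Ψ (Sum.inl d)).2)

namespace IsGlue

variable {m : CombMap D} {κ : m.Edge → Bool} {C : CombMap E} {X : C.Face → Type}
  {J : ∀ f, CombMap (X f)} {κJ : ∀ f, (J f).Edge → Bool} {j : E → D} {Ψ : D ⊕ E ≃ Σ f, X f}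
  (h : IsGlue m κ C J κJ j Ψ)
include h

lemma sigmaFace_inr (s : E) :
    sigmaFace J (Ψ (Sum.inr s)) = ⟨C.faceOf s, (J (C.faceOf s)).rootFace⟩ := by
  have h1 := h.root_eq (C.faceOf s)
  have : sigmaFace J (Ψ (Sum.inr s)) = sigmaFace J (Ψ (Sum.inr (C.faceRep (C.faceOf s)))) := by
    rw [sigmaFace_eq, h.sameCycle_face_inr, faceOf_faceRep]
  rw [this, h1]
  rfl

lemma sigmaFace_inl_ne (d : D) (f : C.Face) :
    sigmaFace J (Ψ (Sum.inl d)) ≠ ⟨f, (J f).rootFace⟩ := by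
  intro h'
  have h1 := h.sigmaFace_inr (C.faceRep f)
  rw [faceOf_faceRep, ← h', eq_comm, sigmaFace_eq] at h1
  exact h.not_sameCycle_face h1

/-- The holes are the root faces: the new darts of `f` form one face, which contains the root of `J
f`, and no dart of `m` lies on it. -/
lemma faceOf_eq_rootFace_iff {f : C.Face} {x : X f} :
    (J f).faceOf x = (J f).rootFace ↔ ∃ s, Ψ (Sum.inr s) = ⟨f, x⟩ := by
  constructor
  · intro hx
    have hx' : sigmaFace J ⟨f, x⟩ = ⟨f, (J f).rootFace⟩ := by rw [← hx]; rfl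
    obtain ⟨u, hu⟩ := Ψ.surjective ⟨f, x⟩
    rcases u with d | s
    · rw [← hu] at hx'
      exact absurd hx' (h.sigmaFace_inl_ne d f)
    · exact ⟨s, hu⟩
  · rintro ⟨s, hs⟩
    have h1 := h.sigmaFace_inr s
    rw [hs] at h1
    obtain rfl : f = C.faceOf s := congrArg Sigma.fst h1
    exact eq_of_heq (Sigma.mk.inj h1).2

lemma isBoundaryEdge_iff {w : Σ f, X f} : (J w.1).IsBoundaryEdge ((J w.1).edgeOf w.2) ↔
    ∃ s, w = Ψ (Sum.inr s) ∨ w = Ψ (Sum.inl (j s)) := by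
  constructor
  · rintro ⟨y, hy, hyw⟩
    obtain ⟨s, hs⟩ := h.faceOf_eq_rootFace_iff.mp hy
    have : sigmaEdge J ⟨w.1, y⟩ = sigmaEdge J w := Sigma.ext rfl (heq_of_eq hyw)
    rw [← hs, sigmaEdge_eq, h.α_inr] at this
    exact ⟨s, this⟩
  · rintro ⟨s, hs⟩
    have h1 : (J (Ψ (Sum.inr s)).1).faceOf (Ψ (Sum.inr s)).2 = (J _).rootFace :=
      h.faceOf_eq_rootFace_iff.mpr ⟨s, rfl⟩
    rcases hs with rfl | rfl
    · exact ⟨_, h1, rfl⟩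
    · rw [← h.α_inr]
      exact ⟨_, h1, ((J _).edgeOf_flip _).symm⟩

lemma degree_rootFace (f : C.Face) : (J f).degree (J f).rootFace = C.degree f := by
  rw [degree_eq_ncard_sigma, degree_eq_ncard,
    ← Set.ncard_image_of_injective _ (Ψ.injective.comp Sum.inr_injective)]
  congr 1
  ext w
  obtain ⟨u, rfl⟩ := Ψ.surjective w
  rcases u with d | s
  · simp [h.sigmaFace_inl_ne]
  · simp only [Set.mem_ofPred_eq, h.sigmaFace_inr, Set.mem_image, Function.comp_apply,
      EmbeddingLike.apply_eq_iff_eq, Sum.inr.injEq, exists_eq_right]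
    refine ⟨fun h' => congrArg Sigma.fst h', fun h' => by rw [h']⟩

lemma sigmaFace_inl_eq {d d' : D} :
    sigmaFace J (Ψ (Sum.inl d)) = sigmaFace J (Ψ (Sum.inl d')) ↔ m.faceOf d = m.faceOf d' := by
  rw [sigmaFace_eq, h.sameCycle_face_inl]

lemma degree_faceOf_inl (d : D) :
    (J (Ψ (Sum.inl d)).1).degree ((J _).faceOf (Ψ (Sum.inl d)).2) = m.degree (m.faceOf d) := by
  rw [degree_eq_ncard_sigma, degree_eq_ncard,
    ← Set.ncard_image_of_injective _ (Ψ.injective.comp Sum.inl_injective)]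
  congr 1
  ext w
  obtain ⟨u, rfl⟩ := Ψ.surjective w
  rcases u with d' | s
  · refine ⟨fun hw => ⟨d', h.sigmaFace_inl_eq.mp hw, rfl⟩, ?_⟩
    rintro ⟨d'', hd, he⟩
    obtain rfl : d'' = d' := by simpa using he
    exact h.sigmaFace_inl_eq.mpr hd
  · simp only [Set.mem_ofPred_eq, Set.mem_image, Function.comp_apply, EmbeddingLike.apply_eq_iff_eq,
      reduceCtorEq, and_false, exists_false, iff_false]
    rw [h.sigmaFace_inr]
    intro h'
    exact h.sigmaFace_inl_ne d _ h'.symm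

/-- Different pieces share no vertex, so the global condition can be tested piece by piece. -/
lemma simple_iff : h.Simple ↔
    ∀ f, Set.InjOn (J f).vertexOf {d | (J f).faceOf d = (J f).rootFace} := by
  constructor
  · intro hS f x hx y hy hxy
    obtain ⟨s, hs⟩ := h.faceOf_eq_rootFace_iff.mp hx
    obtain ⟨t, ht⟩ := h.faceOf_eq_rootFace_iff.mp hy
    have : sigmaVertex J (Ψ (Sum.inr s)) = sigmaVertex J (Ψ (Sum.inr t)) := by
      rw [hs, ht]; exact Sigma.ext rfl (heq_of_eq hxy)
    obtain rfl := hS s t (sigmaVertex_eq.mp this)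
    rw [hs] at ht
    exact eq_of_heq (Sigma.mk.inj ht).2
  · intro hJ s t hst
    have hst := sigmaVertex_eq.mpr hst
    have hf : ∀ s, (J (Ψ (Sum.inr s)).1).faceOf (Ψ (Sum.inr s)).2 = (J _).rootFace :=
      fun s => h.faceOf_eq_rootFace_iff.mpr ⟨s, rfl⟩
    have hs := hf s
    have ht := hf t
    suffices Ψ (Sum.inr s) = Ψ (Sum.inr t) by simpa using this
    generalize Ψ (Sum.inr s) = a at *
    generalize Ψ (Sum.inr t) = b at *
    obtain ⟨f, x⟩ := a
    obtain ⟨g, y⟩ := b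
    obtain rfl : f = g := congrArg Sigma.fst hst
    have := hJ f hs ht (eq_of_heq (Sigma.mk.inj hst).2)
    simp only at this
    rw [this]

/-- The reverse of a new dart is a dart of `m`, so no edge has both its darts on the boundary. -/
lemma injOn_edgeOf (f : C.Face) :
    Set.InjOn (J f).edgeOf {d | (J f).faceOf d = (J f).rootFace} := by
  intro x hx y hy hxy
  obtain ⟨s, hs⟩ := h.faceOf_eq_rootFace_iff.mp hx
  obtain ⟨t, ht⟩ := h.faceOf_eq_rootFace_iff.mp hy
  have : sigmaEdge J (Ψ (Sum.inr s)) = sigmaEdge J (Ψ (Sum.inr t)) := by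
    rw [hs, ht]; exact Sigma.ext rfl (heq_of_eq hxy)
  rw [sigmaEdge_eq, h.α_inr] at this
  have : Ψ (Sum.inr t) = Ψ (Sum.inr s) := by simpa using this
  rw [hs, ht] at this
  exact (eq_of_heq (Sigma.mk.inj this).2).symm

end IsGlue

end CombMap

namespace CombMap
open Equiv Equiv.Perm

variable {D E : Type}

lemma OriginInCluster.of_sameCycle {m : CombMap D} {κ : m.Edge → Bool} {a b : D}
    (ha : m.OriginInCluster κ a) (hab : m.next.SameCycle a b) : m.OriginInCluster κ b :=
  ha.tail (Or.inl (m.vertexOf_eq_iff.mpr hab))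

namespace IsGlue

variable {m : CombMap D} {κ : m.Edge → Bool} {C : CombMap E} {X : C.Face → Type}
  {J : ∀ f, CombMap (X f)} {κJ : ∀ f, (J f).Edge → Bool} {j : E → D} {Ψ : D ⊕ E ≃ Σ f, X f}
  (h : IsGlue m κ C J κJ j Ψ)
include h

lemma color_inl {d : D} {f : C.Face} {x : X f} (hx : Ψ (Sum.inl d) = ⟨f, x⟩) :
    κJ f ((J f).edgeOf x) = κ (m.edgeOf d) := by
  have := h.color d
  rw [hx] at this
  exact this.symm

lemma color_inr {s : E} {f : C.Face} {x : X f} (hx : Ψ (Sum.inr s) = ⟨f, x⟩) :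
    κJ f ((J f).edgeOf x) = κ (m.edgeOf (j s)) := by
  rw [← edgeOf_flip]
  apply h.color_inl
  rw [← h.α_inr, hx]
  rfl

lemma not_isBoundaryEdge {d : D} {f : C.Face} {x : X f} (hx : Ψ (Sum.inl d) = ⟨f, x⟩) :
    ¬ (J f).IsBoundaryEdge ((J f).edgeOf x) ↔ d ∉ Set.range j := by
  rw [h.isBoundaryEdge_iff (w := ⟨f, x⟩), ← hx]
  simp [eq_comm]

lemma isBoundaryEdge_inr {s : E} {f : C.Face} {x : X f} (hx : Ψ (Sum.inr s) = ⟨f, x⟩) :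
    (J f).IsBoundaryEdge ((J f).edgeOf x) := by
  rw [h.isBoundaryEdge_iff (w := ⟨f, x⟩), ← hx]
  exact ⟨s, Or.inl rfl⟩

/-- Send the darts of the pieces to orbits of `m`, with `inr s` going to the orbit of `j s`. This is
constant on each piece, and its value at the root of each piece is the common orbit of the darts of
`C`. -/
lemma isConnected (hC : C.IsConnected) (hI : IsInduced m C j) [Finite D]
    (hJ : ∀ f, (J f).IsConnected) : m.IsConnected := by
  apply isConnected_of_compMk
  have hj : ∀ s, compMk m.next m.flip (j s) = compMk m.next m.flip m.root := by
    refine hC.induction (by rw [h.j_root]) (fun s hs => ?_) (fun s hs => ?_)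
    · rw [← hs]
      exact ((hI.sameCycle_next s).of_invariant (compMk_left m.next m.flip)).symm
    · rw [h.j_flip, compMk_right, hs]
  let g : (Σ f, X f) → Comp m.next m.flip := fun w =>
    Sum.elim (compMk m.next m.flip) (fun s => compMk m.next m.flip (j s)) (Ψ.symm w)
  have hα : ∀ w, g (sigmaFlip J w) = g w := by
    intro w
    obtain ⟨u, rfl⟩ := Ψ.surjective w
    rcases u with d | s
    · by_cases hd : d ∈ Set.range j
      · obtain ⟨s, rfl⟩ := hd
        rw [h.α_j]; simp [g]
      · rw [h.α_inl _ hd]; simp [g]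
    · rw [h.α_inr]; simp [g]
  have hσ : ∀ w, g (sigmaNext J w) = g w := by
    intro w
    obtain ⟨u, rfl⟩ := Ψ.surjective w
    rcases u with d | s
    · by_cases hd : d ∈ Set.range j
      · obtain ⟨s, rfl⟩ := hd
        obtain ⟨t, rfl⟩ := C.faceNext.surjective s
        rw [h.σ_j]; simp [g, hj]
      · rw [h.σ_inl hd]; simp [g]
    · rw [h.σ_inr]; simp [g, hj]
  have key : ∀ f (x : X f), g ⟨f, x⟩ = compMk m.next m.flip m.root := by
    intro f
    refine (hJ f).induction ?_ (fun x hx => ?_) (fun x hx => ?_)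
    · rw [← h.root_eq]; simp [g, hj]
    · rw [← hx]; exact hσ ⟨f, x⟩
    · rw [← hx]; exact hα ⟨f, x⟩
  intro d
  have := key _ (Ψ (Sum.inl d)).2
  simp only [g, Sigma.eta, symm_apply_apply, Sum.elim_inl] at this
  exact this.symm

lemma card_relations [Finite D] [Finite E] [Fintype C.Face] [∀ f, Finite (X f)]
    (hI : IsInduced m C j) :
    (∑ f, Nat.card (J f).Vertex) + Nat.card C.Vertex = Nat.card m.Vertex + 2 * Nat.card C.Edge ∧
    ∑ f, Nat.card (J f).Face = Nat.card m.Face + Nat.card C.Face ∧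
    ∑ f, Nat.card (J f).Edge = Nat.card m.Edge + Nat.card C.Edge := by
  refine ⟨?_, ?_, ?_⟩
  · rw [← card_cycles_sigmaNext, h.card_vertex hI, two_mul_card_edge]
  · rw [← card_cycles_sigmaFace, h.card_face]
  · rw [← card_cycles_sigmaFlip, h.card_edge]

/-- Sum Euler's formula over the pieces and substitute `card_relations`; Euler's formula for `C`
absorbs the excess. -/
lemma isPlanar [Finite D] [Finite E] [∀ f, Finite (X f)] (hI : IsInduced m C j)
    (hC : C.IsPlanar) (hJ : ∀ f, (J f).IsPlanar) : m.IsPlanar := by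
  obtain ⟨h1, h2, h3⟩ := h.card_relations hI
  have h4 : ∑ f, (Nat.card (J f).Vertex + Nat.card (J f).Face) =
      ∑ f, (Nat.card (J f).Edge + 2) := Finset.sum_congr rfl fun f _ => hJ f
  rw [Finset.sum_add_distrib, Finset.sum_add_distrib, Finset.sum_const, smul_eq_mul,
    Finset.card_univ, ← Nat.card_eq_fintype_card] at h4
  unfold IsPlanar at hC ⊢
  omega

lemma isBipartite (hJ : ∀ f, (J f).IsBipartite) : m.IsBipartite := by
  intro c
  obtain ⟨d, rfl⟩ := m.faceOf_surjective c
  rw [← h.degree_faceOf_inl]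
  exact hJ _ _

/-- The darts of `C` are black and joined to the root. A black path cannot leave them: at a vertex
of `C`, any other edge is an internal edge of a piece touching the boundary, hence white. -/
lemma range_eq_clusterDarts [Finite D] (hI : IsInduced m C j) (hC : C.IsConnected)
    (hb : ∀ f e, (J f).IsBoundaryEdge e → κJ f e = true)
    (hw : ∀ f e v, ¬ (J f).IsBoundaryEdge e → (J f).IsBoundaryVertex v → (J f).Incident e v →
      κJ f e = false) : Set.range j = m.clusterDarts κ := by
  have hblack : ∀ s, κ (m.edgeOf (j s)) = true := fun s => by
    rw [← h.color_inr (x := (Ψ (Sum.inr s)).2) rfl]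
    exact hb _ _ (h.isBoundaryEdge_inr rfl)
  have horig : ∀ s, m.OriginInCluster κ (j s) := by
    refine hC.induction ?_ (fun s hs => ?_) (fun s hs => ?_)
    · rw [h.j_root]; exact Relation.ReflTransGen.refl
    · exact hs.of_sameCycle (hI.sameCycle_next s)
    · rw [h.j_flip]; exact hs.tail (Or.inr ⟨hblack s, rfl⟩)
  have key : ∀ d, (∃ s, m.next.SameCycle (j s) d) → κ (m.edgeOf d) = true → d ∈ Set.range j := by
    rintro d ⟨s, hs⟩ hd
    by_contra hr
    obtain ⟨t, ht⟩ := h.exists_sameCycle_inr hs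
    have h1 := (h.not_isBoundaryEdge (x := (Ψ (Sum.inl d)).2) rfl).mpr hr
    have hv := sigmaVertex_eq.mpr ht
    -- After cutting, `d` still starts from a vertex that carries a new dart, hence from the
    -- boundary of its piece.
    have h2 : (J (Ψ (Sum.inl d)).1).IsBoundaryVertex ((J _).vertexOf (Ψ (Sum.inl d)).2) := by
      generalize hx : Ψ (Sum.inl d) = a at hv
      generalize hy : Ψ (Sum.inr t) = b at hv
      obtain ⟨f, x⟩ := a
      obtain ⟨g, y⟩ := b
      obtain rfl : f = g := congrArg Sigma.fst hv
      exact ⟨y, h.faceOf_eq_rootFace_iff.mpr ⟨t, hy⟩, (eq_of_heq (Sigma.mk.inj hv).2).symm⟩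
    have h3 := hw _ _ _ h1 h2 ⟨_, rfl, rfl⟩
    rw [← h.color, hd] at h3
    exact absurd h3 (by simp)
  have hP : ∀ d, m.OriginInCluster κ d → ∃ s, m.next.SameCycle (j s) d := by
    intro d hd
    induction hd with
    | refl => exact ⟨C.root, by rw [h.j_root]⟩
    | tail _ hbc ih =>
      obtain ⟨s, hs⟩ := ih
      rcases hbc with hbc | ⟨hbc, rfl⟩
      · exact ⟨s, hs.trans (m.vertexOf_eq_iff.mp hbc)⟩
      · obtain ⟨t, rfl⟩ := key _ ⟨s, hs⟩ hbc
        exact ⟨C.flip t, by rw [h.j_flip]⟩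
  ext d
  constructor
  · rintro ⟨s, rfl⟩
    exact ⟨hblack s, horig s⟩
  · rintro ⟨h1, h2⟩
    exact key d (hP d h2) h1

end IsGlue

section Connected

variable {m : CombMap D} {κ : m.Edge → Bool} {C : CombMap E} {j : E → D}

/-- Follow a black path of `m`. Each edge it crosses is in `C`, and by `sameCycle_iff` two darts of
`C` around one vertex of `m` are also around one vertex of `C`. -/
lemma isConnected_of_range_eq_clusterDarts [Finite D] [Finite E] (hinj : Function.Injective j)
    (j_flip : ∀ s, j (C.flip s) = m.flip (j s)) (j_root : j C.root = m.root)
    (hI : IsInduced m C j) (hr : Set.range j = m.clusterDarts κ) : C.IsConnected := by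
  apply isConnected_of_compMk
  have key : ∀ d, m.OriginInCluster κ d → ∃ s, compMk C.next C.flip C.root =
      compMk C.next C.flip s ∧ m.next.SameCycle (j s) d := by
    intro d hd
    induction hd with
    | refl => exact ⟨C.root, rfl, by rw [j_root]⟩
    | @tail b c hd hbc ih =>
      obtain ⟨s, hs, hsd⟩ := ih
      rcases hbc with hbc | ⟨hbc, rfl⟩
      · exact ⟨s, hs, hsd.trans (m.vertexOf_eq_iff.mp hbc)⟩
      · obtain ⟨t, rfl⟩ : b ∈ Set.range j := by rw [hr]; exact ⟨hbc, hd⟩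
        refine ⟨C.flip t, ?_, by rw [j_flip]⟩
        rw [compMk_right, hs]
        exact ((hI.sameCycle_iff hinj).mp hsd).of_invariant (compMk_left C.next C.flip)
  intro s
  have : j s ∈ m.clusterDarts κ := hr ▸ ⟨s, rfl⟩
  obtain ⟨t, ht, hts⟩ := key _ this.2
  rw [ht]
  exact ((hI.sameCycle_iff hinj).mp hts).of_invariant (compMk_left C.next C.flip)

end Connected

namespace IsUnzip

variable {W : Type} {m : CombMap D} {C : CombMap E} {σ α : Perm W} {j : E → D} {Ψ : D ⊕ E ≃ W}
  (h : IsUnzip m C σ α j Ψ)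
include h

lemma compMk_inr (s : E) : compMk σ α (Ψ (Sum.inr s)) =
    compMk σ α (Ψ (Sum.inr (C.faceRep (C.faceOf s)))) := by
  have : (σ * α).SameCycle (Ψ (Sum.inr s)) (Ψ (Sum.inr (C.faceRep (C.faceOf s)))) := by
    rw [h.sameCycle_face_inr, faceOf_faceRep]
  exact this.of_invariant (g := compMk σ α) fun w => by rw [mul_apply, compMk_left, compMk_right]

/-- No piece lacks a hole: propagating from the root of `m`, every dart of `m` shares its orbit with
some new dart. -/
lemma compMk_surjective (hm : m.IsConnected) :
    Function.Surjective fun f : C.Face => compMk σ α (Ψ (Sum.inr (C.faceRep f))) := by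
  have hj : ∀ s, compMk σ α (Ψ (Sum.inl (j s))) = compMk σ α (Ψ (Sum.inr s)) := fun s => by
    rw [← h.α_inr, compMk_right]
  have key : ∀ d, ∃ s, compMk σ α (Ψ (Sum.inr s)) = compMk σ α (Ψ (Sum.inl d)) := by
    refine hm.induction ?_ (fun d hd => ?_) (fun d hd => ?_)
    · exact ⟨C.root, by rw [← h.j_root, hj]⟩
    · by_cases hr : d ∈ Set.range j
      · obtain ⟨s, rfl⟩ := hr
        refine ⟨C.flip s, ?_⟩
        have := h.σ_inr (C.flip s)
        rw [C.flip_flip] at this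
        rw [← this, compMk_left]
      · rwa [← h.σ_inl hr, compMk_left]
    · by_cases hr : d ∈ Set.range j
      · obtain ⟨s, rfl⟩ := hr
        exact ⟨C.flip s, by rw [← h.j_flip, hj]⟩
      · rwa [← h.α_inl _ hr, compMk_right]
  intro c
  obtain ⟨w, rfl⟩ := Quot.exists_rep c
  obtain ⟨u, rfl⟩ := Ψ.surjective w
  rcases u with d | s
  · obtain ⟨s, hs⟩ := key d
    exact ⟨C.faceOf s, (h.compMk_inr s).symm.trans hs⟩
  · exact ⟨C.faceOf s, (h.compMk_inr s).symm⟩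

omit h in
/-- A connected submap of a planar map is planar, and separates its faces. -/
lemma isPlanar_and_bijective [Finite D] [Finite E] (h : IsUnzip m C σ α j Ψ)
    (hI : IsInduced m C j) (hm : m.IsConnected) (hp : m.IsPlanar) (hC : C.IsConnected) :
    C.IsPlanar ∧
      Function.Bijective fun f : C.Face => compMk σ α (Ψ (Sum.inr (C.faceRep f))) := by
  have : Finite W := Finite.of_equiv _ Ψ
  have h1 := card_cycles_add_le σ α h.α_α h.α_ne
  have h2 := h.card_vertex hI
  have h3 := h.card_edge
  have h4 := h.card_face
  have h5 := hC.card_le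
  have h6 := C.two_mul_card_edge
  have hsurj := h.compMk_surjective hm
  have h7 : Nat.card (Comp σ α) ≤ Nat.card C.Face := Nat.card_le_card_of_surjective _ hsurj
  unfold IsPlanar at hp ⊢
  -- With `K` orbits, the counts and the planarity of `m` turn the genus inequality into `2 + E + F
  -- ≤ V + 2 * K` for the edges, faces and vertices of `C`. Since `K ≤ F` and `V + F ≤ E + 2`,
  -- equality holds throughout.
  refine ⟨by omega, ?_⟩
  have h8 : Nat.card C.Face = Nat.card (Comp σ α) := by omega
  cases nonempty_fintype (Comp σ α)
  rw [Nat.card_eq_fintype_card, Nat.card_eq_fintype_card] at h8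
  exact (Fintype.bijective_iff_surjective_and_card _).mpr ⟨hsurj, h8⟩

end IsUnzip

end CombMap

/-! ### Cutting a percolated map along its cluster -/

namespace CombMap
open Equiv Equiv.Perm

variable {D E : Type}

section Unzip

variable {m : CombMap D} {C : CombMap E} {j : E → D}

open Classical in
/-- The edge permutation of the unzipped map. -/
noncomputable def unzipFlip (m : CombMap D) (j : E → D) : D ⊕ E → D ⊕ E :=
  Sum.elim (fun d => if h : d ∈ Set.range j then Sum.inr h.choose else Sum.inl (m.flip d))
    fun s => Sum.inl (j s)

lemma unzipFlip_j (m : CombMap D) (hj : Function.Injective j) (s : E) :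
    unzipFlip m j (Sum.inl (j s)) = Sum.inr s := by
  have h : j s ∈ Set.range j := ⟨s, rfl⟩
  simp only [unzipFlip, Sum.elim_inl, dif_pos h]
  exact congrArg Sum.inr (hj h.choose_spec)

lemma unzipFlip_inl (m : CombMap D) {d : D} (hd : d ∉ Set.range j) :
    unzipFlip m j (Sum.inl d) = Sum.inl (m.flip d) := by
  simp only [unzipFlip, Sum.elim_inl, dif_neg hd]

lemma unzipFlip_involutive (hj : Function.Injective j)
    (j_flip : ∀ s, j (C.flip s) = m.flip (j s)) : Function.Involutive (unzipFlip m j) := by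
  rintro (d | s)
  · by_cases hd : d ∈ Set.range j
    · obtain ⟨s, rfl⟩ := hd
      rw [unzipFlip_j m hj]
      rfl
    · rw [unzipFlip_inl m hd, unzipFlip_inl, m.flip_flip]
      rintro ⟨s, hs⟩
      exact hd ⟨C.flip s, by rw [j_flip, hs, m.flip_flip]⟩
  · exact unzipFlip_j m hj s

/-- Edges and faces are prescribed, and the vertex permutation `φ * α` is forced. New faces use
`C.faceNext.symm`, as a hole is walked against the orientation of the face of `C` it replaces. -/
lemma exists_isUnzip (hj : Function.Injective j) (j_flip : ∀ s, j (C.flip s) = m.flip (j s))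
    (j_root : j C.root = m.root) :
    ∃ σ α : Perm (D ⊕ E), IsUnzip m C σ α j (Equiv.refl _) := by
  let α : Perm (D ⊕ E) := (unzipFlip_involutive hj j_flip).toPerm
  let φ : Perm (D ⊕ E) := Equiv.sumCongr m.faceNext C.faceNext.symm
  have hα : ∀ w, α w = unzipFlip m j w := fun _ => rfl
  have hαα : ∀ w, α (α w) = w := unzipFlip_involutive hj j_flip
  refine ⟨φ * α, α, hj, j_flip, j_root, fun s => ?_, fun s => rfl, fun d hd => ?_, fun d => ?_,
    fun s => ?_⟩
  · exact unzipFlip_j m hj s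
  · exact unzipFlip_inl m hd
  · rw [mul_apply, hαα]; rfl
  · rw [mul_apply, hαα]; simp [φ]

end Unzip

section Restrict

variable {W ι : Type} {σ α : Perm W} {g : W → ι}

/-- The restriction of a pair of permutations to a level of an invariant function. -/
def restrict (hα : ∀ w, α (α w) = w) (hne : ∀ w, α w ≠ w) (gσ : ∀ w, g (σ w) = g w)
    (gα : ∀ w, g (α w) = g w) (i : ι) (r : {w // g w = i}) : CombMap {w // g w = i} where
  next := σ.subtypePerm fun w => by rw [gσ]
  flip := α.subtypePerm fun w => by rw [gα]
  root := r
  flip_flip w := Subtype.ext (hα w)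
  flip_ne w h := hne w (congrArg Subtype.val h)

lemma restrict_isConnected [Finite W] (hα : ∀ w, α (α w) = w) (hne : ∀ w, α w ≠ w)
    (gσ : ∀ w, g (σ w) = g w) (gα : ∀ w, g (α w) = g w) (i : ι) (r : {w // g w = i})
    (hg : ∀ w, g w = i → compMk σ α r = compMk σ α w) :
    (restrict hα hne gσ gα i r).IsConnected := by
  rw [isConnected_iff]
  intro P h0 h1 h2
  have key : ∀ w, Relation.ReflTransGen (fun a b => b = σ a ∨ b = α a) (r : W) w →
      ∃ h : g w = i, P ⟨w, h⟩ := by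
    intro w hw
    induction hw with
    | refl => exact ⟨r.2, h0⟩
    | tail _ hbc ih =>
      obtain ⟨hb, hP⟩ := ih
      rcases hbc with rfl | rfl
      · exact ⟨(gσ _).trans hb, h1 _ hP⟩
      · exact ⟨(gα _).trans hb, h2 _ hP⟩
  rintro ⟨w, hw⟩
  exact (key w (reflTransGen_of_comp_eq (hg w hw))).2

end Restrict

lemma sum_degree [Finite D] (m : CombMap D) : ∑ f, m.degree f = Nat.card D := by
  rw [← Nat.card_congr (Equiv.sigmaFiberEquiv m.faceOf), Nat.card_sigma]
  rfl

/-- The degrees sum to twice the number of edges. -/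
lemma even_degree_of_others [Finite D] (m : CombMap D) (f : m.Face)
    (h : ∀ f', f' ≠ f → Even (m.degree f')) : Even (m.degree f) := by
  classical
  have h2 : Even (∑ f' ∈ Finset.univ.erase f, m.degree f') :=
    Finset.even_sum _ fun f' hf' => h f' (Finset.ne_of_mem_erase hf')
  have h3 := Finset.add_sum_erase Finset.univ m.degree (Finset.mem_univ f)
  have h4 : Even (m.degree f + ∑ f' ∈ Finset.univ.erase f, m.degree f') := by
    rw [h3, m.sum_degree, ← m.two_mul_card_edge]
    exact even_two_mul _
  exact (Nat.even_add.mp h4).mpr h2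

/-- Cutting a percolated planar map along the cluster of the origin. -/
theorem exists_isGlue [Finite D] [Finite E] {m : CombMap D} {κ : m.Edge → Bool} {C : CombMap E}
    {j : E → D} (hm : m.IsConnected) (hp : m.IsPlanar) (hb : m.IsBipartite)
    (hj : Function.Injective j) (j_flip : ∀ s, j (C.flip s) = m.flip (j s))
    (j_root : j C.root = m.root) (hI : IsInduced m C j)
    (hr : Set.range j = m.clusterDarts κ) :
    C.IsConnected ∧ C.IsPlanar ∧ C.IsBipartite ∧ ∃ (X : C.Face → Type) (_ : ∀ f, Finite (X f))
      (J : ∀ f, CombMap (X f)) (κJ : ∀ f, (J f).Edge → Bool) (Ψ : D ⊕ E ≃ Σ f, X f),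
      IsGlue m κ C J κJ j Ψ ∧ ∀ f, (J f).IsIsland (C.degree f / 2) (κJ f) := by
  classical
  have hC := isConnected_of_range_eq_clusterDarts hj j_flip j_root hI hr
  obtain ⟨σ, α, hU⟩ := exists_isUnzip hj j_flip j_root
  obtain ⟨hCp, hbij⟩ := hU.isPlanar_and_bijective hI hm hp hC
  -- Orbits of the unzipped map are indexed by the faces of `C`; the pieces are the fibres of this
  -- indexing.
  let B := Equiv.ofBijective _ hbij
  let g : D ⊕ E → C.Face := fun w => B.symm (compMk σ α w)
  have gσ : ∀ w, g (σ w) = g w := fun w => by simp only [g, compMk_left]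
  have gα : ∀ w, g (α w) = g w := fun w => by simp only [g, compMk_right]
  have ginr : ∀ s, g (Sum.inr s) = C.faceOf s := fun s => by
    simp only [g]
    rw [Equiv.symm_apply_eq]
    exact hU.compMk_inr s
  let X : C.Face → Type := fun f => {w // g w = f}
  let J : ∀ f, CombMap (X f) := fun f => restrict hU.α_α hU.α_ne gσ gα f
    ⟨Sum.inr (C.faceRep f), by rw [ginr, faceOf_faceRep]⟩
  let Ψ : D ⊕ E ≃ Σ f, X f := (Equiv.sigmaFiberEquiv g).symm
  have hΨ : ∀ w (f : C.Face) (hw : g w = f), Ψ w = ⟨f, ⟨w, hw⟩⟩ := fun w f hw => by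
    subst hw; rfl
  have hα : ∀ w, sigmaFlip J (Ψ w) = Ψ (α w) := fun w =>
    (hΨ (α w) (g w) (gα w)).symm
  have hσ : ∀ w, sigmaNext J (Ψ w) = Ψ (σ w) := fun w =>
    (hΨ (σ w) (g w) (gσ w)).symm
  let c : D ⊕ E → Bool := Sum.elim (fun d => κ (m.edgeOf d)) fun s => κ (m.edgeOf (j s))
  have hc : ∀ w, c (α w) = c w := by
    rintro (d | s)
    · by_cases hd : d ∈ Set.range j
      · obtain ⟨s, rfl⟩ := hd
        rw [show α (Sum.inl (j s)) = Sum.inr s from hU.α_j s]; rfl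
      · rw [show α (Sum.inl d) = Sum.inl (m.flip d) from hU.α_inl d hd]
        simp [c, edgeOf_flip]
    · rw [show α (Sum.inr s) = Sum.inl (j s) from hU.α_inr s]; rfl
  let κJ : ∀ f, (J f).Edge → Bool := fun f e => c (Quotient.out e : X f).1
  have hκ : ∀ f x, κJ f ((J f).edgeOf x) = c x.1 := by
    intro f x
    have : (J f).edgeOf (Quotient.out ((J f).edgeOf x)) = (J f).edgeOf x := Quotient.out_eq _
    rw [eq_comm, edgeOf_eq_iff] at this
    rcases this with h | h
    · exact congrArg (fun y : X f => c y.1) h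
    · exact (congrArg (fun y : X f => c y.1) h).trans (hc _)
  have hG : IsGlue m κ C J κJ j Ψ :=
    { inj := hj
      j_flip := j_flip
      j_root := j_root
      α_j := fun s => by rw [hα]; exact congrArg Ψ (hU.α_j s)
      α_inr := fun s => by rw [hα]; exact congrArg Ψ (hU.α_inr s)
      α_inl := fun d hd => by rw [hα]; exact congrArg Ψ (hU.α_inl d hd)
      φ_inl := fun d => by rw [hα, hσ]; exact congrArg Ψ (hU.φ_inl d)
      φ_inr := fun s => by rw [hα, hσ]; exact congrArg Ψ (hU.φ_inr s)
      fst_inr := ginr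
      root_eq := fun f => hΨ _ f (by rw [ginr, faceOf_faceRep])
      color := fun d => (hκ _ (Ψ (Sum.inl d)).2).symm }
  have hJc : ∀ f, (J f).IsConnected := by
    intro f
    refine restrict_isConnected hU.α_α hU.α_ne gσ gα f _ fun w hw => ?_
    have : B (g w) = compMk σ α w := by simp [g]
    rw [← this, hw]
    rfl
  have hJp : ∀ f, (J f).IsPlanar := by
    have : ∀ f, Finite (X f) := fun f => inferInstance
    obtain ⟨h1, h2, h3⟩ := hG.card_relations hI
    have h5 : ∑ f, (Nat.card (J f).Vertex + Nat.card (J f).Face) =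
        ∑ f, (Nat.card (J f).Edge + 2) := by
      rw [Finset.sum_add_distrib, Finset.sum_add_distrib, Finset.sum_const, smul_eq_mul,
        Finset.card_univ, ← Nat.card_eq_fintype_card]
      unfold IsPlanar at hp hCp
      omega
    -- Each piece satisfies `V + F ≤ E + 2` and the two sides have equal sums, so equality holds for
    -- every piece.
    have := (Finset.sum_eq_sum_iff_of_le fun f _ => (hJc f).card_le).mp h5
    exact fun f => this f (Finset.mem_univ f)
  have hJb : ∀ f, (J f).IsBipartite := by
    have h1 : ∀ f c, c ≠ (J f).rootFace → Even ((J f).degree c) := by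
      intro f c hc
      obtain ⟨x, rfl⟩ := (J f).faceOf_surjective c
      obtain ⟨u, hu⟩ := Ψ.surjective ⟨f, x⟩
      rcases u with d | s
      · have := hG.degree_faceOf_inl d
        rw [hu] at this
        rw [this]
        exact hb _
      · exact absurd (hG.faceOf_eq_rootFace_iff.mpr ⟨s, hu⟩) hc
    intro f c
    by_cases hc : c = (J f).rootFace
    -- The other faces of the piece are faces of `m`. Evenness of the root face then transfers to
    -- the face of `C`.
    · exact hc ▸ even_degree_of_others _ _ (h1 f)
    · exact h1 f c hc
  have hCb : C.IsBipartite := fun f => by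
    rw [← hG.degree_rootFace]
    exact hJb _ _
  refine ⟨hC, hCp, hCb, X, fun f => inferInstance, J, κJ, Ψ, hG, fun f => ?_⟩
  refine ⟨hJc f, hJp f, hJb f, ⟨?_, hG.injOn_edgeOf f⟩, ?_, ?_, ?_⟩
  · exact hG.simple_iff.mp (hG.simple_of_isInduced hI) f
  · rw [hG.degree_rootFace, Nat.two_mul_div_two_of_even (hCb f)]
  · rintro e ⟨x, hx, rfl⟩
    obtain ⟨s, hs⟩ := hG.faceOf_eq_rootFace_iff.mp hx
    rw [hG.color_inr hs]
    have : j s ∈ m.clusterDarts κ := hr ▸ ⟨s, rfl⟩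
    exact this.1
  · rintro e v he ⟨y, hy, rfl⟩ ⟨x, rfl, hxy⟩
    obtain ⟨s, hs⟩ := hG.faceOf_eq_rootFace_iff.mp hy
    obtain ⟨u, hu⟩ := Ψ.surjective ⟨f, x⟩
    rcases u with d | t
    · have hd := (hG.not_isBoundaryEdge hu).mp he
      rw [hG.color_inl hu]
      -- A black dart starting from a boundary vertex starts from a vertex of the cluster in `m`, so
      -- it would be a dart of `C`.
      by_contra hκd
      refine hd ?_
      rw [hr]
      refine ⟨by simpa using hκd, ?_⟩
      have h1 : (sigmaNext J).SameCycle (Ψ (Sum.inl d)) (Ψ (Sum.inr s)) := by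
        rw [← sigmaVertex_eq, hu, hs]
        exact Sigma.ext rfl (heq_of_eq hxy)
      have h2 := hG.sameCycle_of_inl_inr hI h1
      have h3 : j (C.flip s) ∈ m.clusterDarts κ := hr ▸ ⟨_, rfl⟩
      exact h3.2.of_sameCycle h2.symm
    · exact absurd (hG.isBoundaryEdge_inr hu) he

end CombMap

/-! ### Constructing the glued map -/

namespace Equiv.Perm

variable {Y Y' : Type}

lemma zpow_apply_eq_self_iff_ncard_dvd [Finite Y] (τ : Perm Y) (y : Y) (n : ℤ) :
    (τ ^ n) y = y ↔ (({s | τ.SameCycle y s}.ncard : ℕ) : ℤ) ∣ n := by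
  have h1 : {s | τ.SameCycle y s} = MulAction.orbit (Subgroup.zpowers τ) y := by
    ext s
    constructor
    · rintro ⟨i, rfl⟩
      exact ⟨⟨τ ^ i, i, rfl⟩, rfl⟩
    · rintro ⟨⟨_, i, rfl⟩, rfl⟩
      exact ⟨i, rfl⟩
  have h2 : {s | τ.SameCycle y s}.ncard = Function.minimalPeriod (τ • ·) y := by
    rw [h1, ← Nat.card_coe_set_eq, Nat.card_congr (MulAction.orbitZPowersEquiv τ y), Nat.card_zmod]
  rw [h2, ← MulAction.zpow_smul_eq_iff_minimalPeriod_dvd]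
  rfl

/-- Cycles of the same length are isomorphic. -/
lemma exists_cycle_map [Finite Y] [Finite Y'] (τ : Perm Y) (τ' : Perm Y') (y : Y) (y' : Y')
    (hcard : {s | τ.SameCycle y s}.ncard = {s | τ'.SameCycle y' s}.ncard) :
    ∃ β : Y → Y', β y = y' ∧ (∀ s, τ.SameCycle y s → β (τ s) = τ' (β s)) ∧
      Set.InjOn β {s | τ.SameCycle y s} ∧ β '' {s | τ.SameCycle y s} = {s | τ'.SameCycle y' s} := by
  classical
  -- Equal lengths mean equal periods, so sending `τ ^ n` applied to `y` to `τ' ^ n` applied to `y'`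
  -- is well defined and injective.
  have hper : ∀ n n' : ℤ, (τ ^ n) y = (τ ^ n') y ↔ (τ' ^ n) y' = (τ' ^ n') y' := by
    have h1 : ∀ n : ℤ, (τ ^ n) y = y ↔ (τ' ^ n) y' = y' := fun n => by
      rw [zpow_apply_eq_self_iff_ncard_dvd, zpow_apply_eq_self_iff_ncard_dvd, hcard]
    intro n n'
    have h2 : ∀ {Z : Type} (ρ : Perm Z) (z : Z),
        (ρ ^ n) z = (ρ ^ n') z ↔ (ρ ^ (-n' + n)) z = z := fun ρ z => by
      rw [zpow_add, mul_apply, zpow_neg, inv_eq_iff_eq]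
    rw [h2, h2, h1]
  let β : Y → Y' := fun s => if h : τ.SameCycle y s then (τ' ^ h.choose) y' else y'
  have hβ : ∀ n : ℤ, β ((τ ^ n) y) = (τ' ^ n) y' := fun n => by
    have h : τ.SameCycle y ((τ ^ n) y) := ⟨n, rfl⟩
    simp only [β, dif_pos h]
    exact (hper _ _).mp h.choose_spec
  refine ⟨β, by simpa using hβ 0, ?_, ?_, ?_⟩
  · rintro s ⟨n, rfl⟩
    have := hβ (1 + n)
    rw [zpow_add, zpow_add, zpow_one, zpow_one, mul_apply, mul_apply] at this
    rw [this, hβ]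
  · rintro _ ⟨n, rfl⟩ _ ⟨n', rfl⟩ h
    rw [hβ, hβ] at h
    exact (hper _ _).mpr h
  · ext s
    constructor
    · rintro ⟨_, ⟨n, rfl⟩, rfl⟩
      exact ⟨n, (hβ n).symm⟩
    · rintro ⟨n, rfl⟩
      exact ⟨_, ⟨n, rfl⟩, hβ n⟩

end Equiv.Perm

namespace CombMap
open Equiv Equiv.Perm

variable {E : Type}

/-- Labelling of the boundaries of a family of maps by the darts of `C`. -/
lemma exists_boundary_label [Finite E] (C : CombMap E) {X : C.Face → Type} [∀ f, Finite (X f)]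
    (J : ∀ f, CombMap (X f)) (hdeg : ∀ f, (J f).degree (J f).rootFace = C.degree f) :
    ∃ β : E → Σ f, X f, Function.Injective β ∧ (∀ s, (β s).1 = C.faceOf s) ∧
      (∀ f, β (C.faceRep f) = ⟨f, (J f).root⟩) ∧
      (∀ s, (sigmaNext J * sigmaFlip J) (β (C.faceNext s)) = β s) ∧
      Set.range β = {w | (J w.1).faceOf w.2 = (J w.1).rootFace} := by
  have hset : ∀ {D : Type} (m : CombMap D) (d : D),
      {s | m.faceNext.SameCycle d s} = {s | m.faceOf s = m.faceOf d} := fun m d => by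
    ext s
    exact (m.faceOf_eq_iff.symm.trans eq_comm)
  have hset' : ∀ {D : Type} (m : CombMap D) (d : D),
      {s | (m.faceNext⁻¹).SameCycle d s} = {s | m.faceOf s = m.faceOf d} := fun m d => by
    rw [← hset]
    ext s
    exact sameCycle_inv
  have h1 : ∀ f, ∃ β : E → X f, β (C.faceRep f) = (J f).root ∧
      (∀ s, C.faceOf s = f → β (C.faceNext s) = (J f).faceNext⁻¹ (β s)) ∧
      Set.InjOn β {s | C.faceOf s = f} ∧
      β '' {s | C.faceOf s = f} = {x | (J f).faceOf x = (J f).rootFace} := by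
    intro f
    have hc : {s | C.faceNext.SameCycle (C.faceRep f) s} = {s | C.faceOf s = f} := by
      rw [hset, faceOf_faceRep]
    -- The inverse appears because the boundary of the piece is walked opposite to the face of `C`.
    obtain ⟨β, b1, b2, b3, b4⟩ := exists_cycle_map C.faceNext (J f).faceNext⁻¹ (C.faceRep f)
      (J f).root (by rw [hc, hset']; exact (hdeg f).symm)
    rw [hc] at b3 b4
    rw [hset'] at b4
    refine ⟨β, b1, fun s hs => b2 s ?_, b3, b4⟩
    have : s ∈ {s | C.faceNext.SameCycle (C.faceRep f) s} := by rw [hc]; exact hs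
    exact this
  choose b b1 b2 b3 b4 using h1
  refine ⟨fun s => ⟨C.faceOf s, b (C.faceOf s) s⟩, ?_, fun s => rfl, ?_, ?_, ?_⟩
  · intro s t hst
    have h2 : C.faceOf s = C.faceOf t := congrArg Sigma.fst hst
    have h3 := (Sigma.mk.inj hst).2
    refine b3 (C.faceOf t) h2 rfl ?_
    rw [h2] at h3
    exact eq_of_heq h3
  · intro f
    have : ∀ g, g = f → (⟨g, b g (C.faceRep f)⟩ : Σ f, X f) = ⟨f, (J f).root⟩ := by
      rintro g rfl
      rw [b1]
    exact this _ (faceOf_faceRep C f)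
  · intro s
    have : ∀ g, g = C.faceOf s → (sigmaNext J * sigmaFlip J) ⟨g, b g (C.faceNext s)⟩ =
        ⟨C.faceOf s, b (C.faceOf s) s⟩ := by
      rintro g rfl
      rw [b2 _ s rfl]
      refine Sigma.ext rfl (heq_of_eq ?_)
      exact apply_symm_apply (J (C.faceOf s)).faceNext _
    exact this _ (C.faceOf_faceNext s)
  · ext ⟨f, x⟩
    constructor
    · rintro ⟨s, hs⟩
      obtain rfl : C.faceOf s = f := congrArg Sigma.fst hs
      have h3 := eq_of_heq (Sigma.mk.inj hs).2
      have : x ∈ {x | (J (C.faceOf s)).faceOf x = (J (C.faceOf s)).rootFace} := by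
        rw [← b4]; exact ⟨s, rfl, h3⟩
      exact this
    · intro hx
      have : x ∈ b f '' {s | C.faceOf s = f} := by rw [b4]; exact hx
      obtain ⟨s, rfl, rfl⟩ := this
      exact ⟨s, rfl⟩

/-- Gluing a family of maps with simple boundaries into the faces of `C`. -/
theorem exists_glue [Finite E] (C : CombMap E) {X : C.Face → Type} [∀ f, Finite (X f)]
    (J : ∀ f, CombMap (X f)) (κJ : ∀ f, (J f).Edge → Bool)
    (hdeg : ∀ f, (J f).degree (J f).rootFace = C.degree f)
    (hs : ∀ f, (J f).HasSimpleBoundary) (hb : ∀ f e, (J f).IsBoundaryEdge e → κJ f e = true) :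
    ∃ (D : Type) (_ : Finite D) (m : CombMap D) (κ : m.Edge → Bool) (j : E → D)
      (Ψ : D ⊕ E ≃ Σ f, X f), IsGlue m κ C J κJ j Ψ := by
  classical
  obtain ⟨β, binj, bfst, broot, bnext, brange⟩ := exists_boundary_label C J hdeg
  -- The boundary darts `β s` are discarded, and the reverse of `β s` becomes the dart `j s` of the
  -- glued map.
  let D : Type := {w : Σ f, X f // w ∉ Set.range β}
  have hmem : ∀ {w : Σ f, X f}, w ∈ Set.range β ↔ (J w.1).faceOf w.2 = (J w.1).rootFace := by
    intro w; rw [brange]; rfl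
  have hφ : ∀ w, (sigmaNext J * sigmaFlip J) w ∉ Set.range β ↔ w ∉ Set.range β := by
    intro w
    rw [hmem, hmem]
    exact not_congr (by rw [← (J w.1).faceOf_faceNext w.2]; rfl)
  have hff : ∀ w, sigmaFlip J (sigmaFlip J w) = w := fun w => by simp [(J w.1).flip_flip]
  -- This is where the boundary must not use an edge twice: the reverse of a boundary dart would
  -- otherwise be discarded too.
  have hflip : ∀ s, sigmaFlip J (β s) ∉ Set.range β := by
    intro s hs'
    have h1 := hmem.mp hs'
    have h2 := hmem.mp ⟨s, rfl⟩
    have h3 := (hs (β s).1).2 h1 h2 ((J _).edgeOf_flip _)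
    exact (J _).flip_ne _ h3
  let j : E → D := fun s => ⟨sigmaFlip J (β s), hflip s⟩
  have hj : Function.Injective j := fun s t hst =>
    binj ((sigmaFlip J).injective (congrArg Subtype.val hst))
  have hjr : ∀ {d : D}, d ∈ Set.range j ↔ sigmaFlip J d.1 ∈ Set.range β := by
    intro d
    constructor
    · rintro ⟨s, rfl⟩
      exact ⟨s, (hff _).symm⟩
    · rintro ⟨s, hs'⟩
      exact ⟨s, Subtype.ext ((congrArg (sigmaFlip J) hs').trans (hff _))⟩
  -- Along `C`, the two sides of an edge are sewn together: the reverse of `j s` is `j (C.flip s)`.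
  -- Other edges are kept.
  let F : D → D := fun d =>
    if h : sigmaFlip J d.1 ∈ Set.range β then j (C.flip h.choose) else ⟨sigmaFlip J d.1, h⟩
  have hFj : ∀ s, F (j s) = j (C.flip s) := by
    intro s
    have h : sigmaFlip J (j s).1 ∈ Set.range β := hjr.mp ⟨s, rfl⟩
    simp only [F, dif_pos h]
    have : h.choose = s := binj (h.choose_spec.trans (hff _))
    rw [this]
  have hF : ∀ d : D, d ∉ Set.range j → (F d).1 = sigmaFlip J d.1 := by
    intro d hd
    have h : sigmaFlip J d.1 ∉ Set.range β := fun h => hd (hjr.mpr h)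
    simp only [F, dif_neg h]
  have hFF : ∀ d, F (F d) = d := by
    intro d
    by_cases hd : d ∈ Set.range j
    · obtain ⟨s, rfl⟩ := hd
      rw [hFj, hFj, C.flip_flip]
    · apply Subtype.ext
      rw [hF, hF d hd, hff]
      intro h'
      rw [hjr, hF d hd, hff] at h'
      exact d.2 h'
  have hFne : ∀ d, F d ≠ d := by
    intro d
    by_cases hd : d ∈ Set.range j
    · obtain ⟨s, rfl⟩ := hd
      rw [hFj]
      exact fun h => C.flip_ne s (hj h)
    · intro h'
      have := congrArg Subtype.val h'
      rw [hF d hd] at this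
      exact (J _).flip_ne d.1.2 (eq_of_heq (Sigma.mk.inj this).2)
  let α : Perm D := Function.Involutive.toPerm F hFF
  let φ : Perm D := (sigmaNext J * sigmaFlip J).subtypePerm hφ
  let m : CombMap D :=
    { next := φ * α
      flip := α
      root := j C.root
      flip_flip := hFF
      flip_ne := hFne }
  have hface : ∀ d, m.faceNext d = φ d := fun d => congrArg φ (hFF d)
  let Ψ : D ⊕ E ≃ Σ f, X f := Equiv.ofBijective (Sum.elim Subtype.val β) (by
    constructor
    · rintro (d | s) (d' | s') h
      · exact congrArg Sum.inl (Subtype.ext h)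
      · exact absurd ⟨s', h.symm⟩ d.2
      · exact absurd ⟨s, h⟩ d'.2
      · exact congrArg Sum.inr (binj h)
    · intro w
      by_cases hw : w ∈ Set.range β
      · obtain ⟨s, rfl⟩ := hw
        exact ⟨Sum.inr s, rfl⟩
      · exact ⟨Sum.inl ⟨w, hw⟩, rfl⟩)
  let c : (Σ f, X f) → Bool := fun w => κJ w.1 ((J w.1).edgeOf w.2)
  have hcflip : ∀ w, c (sigmaFlip J w) = c w := fun w =>
    congrArg (κJ w.1) ((J w.1).edgeOf_flip w.2)
  have hcβ : ∀ s, c (β s) = true := fun s => hb _ _ ⟨_, hmem.mp ⟨s, rfl⟩, rfl⟩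
  have hcF : ∀ d, c (F d).1 = c d.1 := by
    intro d
    by_cases hd : d ∈ Set.range j
    · obtain ⟨s, rfl⟩ := hd
      rw [hFj, hcflip, hcflip, hcβ, hcβ]
    · rw [hF d hd, hcflip]
  let κ : m.Edge → Bool := fun e => c (Quotient.out e : D).1
  refine ⟨D, inferInstance, m, κ, j, Ψ, ?_⟩
  exact
    { inj := hj
      j_flip := fun s => (hFj s).symm
      j_root := rfl
      α_j := fun s => hff (β s)
      α_inr := fun s => rfl
      α_inl := fun d hd => (hF d hd).symm
      φ_inl := fun d => (congrArg Subtype.val (hface d)).symm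
      φ_inr := bnext
      fst_inr := bfst
      root_eq := broot
      color := fun d => by
        have : m.edgeOf (Quotient.out (m.edgeOf d)) = m.edgeOf d := Quotient.out_eq _
        rw [eq_comm, edgeOf_eq_iff] at this
        rcases this with h | h
        · exact congrArg (fun y : D => c y.1) h
        · exact (congrArg (fun y : D => c y.1) h).trans (hcF _) }

end CombMap

lemma prod_filter_eq_of_classes {X Y Q Q' M : Type*} [Fintype Q] [Fintype Q'] [CommMonoid M]
    {cl : X → Q} {cl' : Y → Q'} (hcl : Function.Surjective cl) (hcl' : Function.Surjective cl')
    (P : Q → Prop) (P' : Q' → Prop) [DecidablePred P] [DecidablePred P'] (θ : X → Y)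
    (h1 : ∀ x, P (cl x) → P' (cl' (θ x)))
    (h2 : ∀ x x', P (cl x) → P (cl x') → (cl x = cl x' ↔ cl' (θ x) = cl' (θ x')))
    (h3 : ∀ y, P' (cl' y) → ∃ x, P (cl x) ∧ cl' (θ x) = cl' y) (F : Q → M) (F' : Q' → M)
    (hF : ∀ x, P (cl x) → F (cl x) = F' (cl' (θ x))) :
    ∏ c with P c, F c = ∏ c with P' c, F' c := by
  obtain ⟨e, he⟩ := exists_equiv_of_classes hcl hcl' θ h1 h2 h3
  rw [← Finset.prod_subtype_eq_prod_filter, ← Finset.prod_subtype_eq_prod_filter,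
    Finset.subtype_univ, Finset.subtype_univ]
  refine Fintype.prod_equiv e _ _ ?_
  rintro ⟨c, hc⟩
  obtain ⟨x, rfl⟩ := hcl c
  rw [he, hF x hc]

/-! ### Isomorphisms, and uniqueness of cutting and gluing -/

namespace CombMap
open Equiv Equiv.Perm

variable {D D' D'' E : Type}

/-- The bijection `e` is an isomorphism of rooted maps. -/
structure IsoOn (m : CombMap D) (m' : CombMap D') (e : D ≃ D') : Prop where
  next : ∀ d, e (m.next d) = m'.next (e d)
  flip : ∀ d, e (m.flip d) = m'.flip (e d)
  root : e m.root = m'.root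

namespace IsoOn

variable {m : CombMap D} {m' : CombMap D'} {m'' : CombMap D''} {e : D ≃ D'}

lemma symm (h : IsoOn m m' e) : IsoOn m' m e.symm where
  next d := by rw [Equiv.symm_apply_eq, h.next, Equiv.apply_symm_apply]
  flip d := by rw [Equiv.symm_apply_eq, h.flip, Equiv.apply_symm_apply]
  root := by rw [Equiv.symm_apply_eq, h.root]

lemma trans {e' : D' ≃ D''} (h : IsoOn m m' e) (h' : IsoOn m' m'' e') :
    IsoOn m m'' (e.trans e') where
  next d := by simp [h.next, h'.next]
  flip d := by simp [h.flip, h'.flip]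
  root := by simp [h.root, h'.root]

/-- Rigidity: the image of the root determines the images of all darts reached from it. -/
lemma unique {e' : D ≃ D'} (h : IsoOn m m' e) (h' : IsoOn m m' e') (hm : m.IsConnected) :
    e = e' := by
  ext d
  exact hm.induction (P := fun d => e d = e' d) (by rw [h.root, h'.root])
    (fun d hd => by rw [h.next, h'.next, hd]) (fun d hd => by rw [h.flip, h'.flip, hd]) d

lemma sameCycle_iff {σ : Perm D} {σ' : Perm D'} (h : ∀ d, e (σ d) = σ' (e d)) (a b : D) :
    σ.SameCycle a b ↔ σ'.SameCycle (e a) (e b) := by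
  constructor
  · intro hab
    rw [← cycleMk_eq]
    exact hab.of_invariant (g := fun d => cycleMk σ' (e d)) fun w => by rw [h, cycleMk_apply]
  · intro hab
    have h' : ∀ d, e.symm (σ' d) = σ (e.symm d) := fun d => by
      rw [Equiv.symm_apply_eq, h, Equiv.apply_symm_apply]
    have := hab.of_invariant (g := fun d => cycleMk σ (e.symm d)) fun w => by
      rw [h', cycleMk_apply]
    simpa [cycleMk_eq] using this

variable (h : IsoOn m m' e)
include h

lemma faceNext (d : D) : e (m.faceNext d) = m'.faceNext (e d) := by
  rw [faceNext_apply, faceNext_apply, h.next, h.flip]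

lemma vertexOf_eq {a b : D} :
    m'.vertexOf (e a) = m'.vertexOf (e b) ↔ m.vertexOf a = m.vertexOf b := by
  rw [vertexOf_eq_iff, vertexOf_eq_iff, sameCycle_iff h.next]

lemma edgeOf_eq {a b : D} : m'.edgeOf (e a) = m'.edgeOf (e b) ↔ m.edgeOf a = m.edgeOf b := by
  rw [edgeOf_eq_iff, edgeOf_eq_iff, ← h.flip, e.apply_eq_iff_eq, e.apply_eq_iff_eq]

lemma faceOf_eq {a b : D} : m'.faceOf (e a) = m'.faceOf (e b) ↔ m.faceOf a = m.faceOf b := by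
  rw [faceOf_eq_iff, faceOf_eq_iff, sameCycle_iff h.faceNext]

lemma degree_faceOf (d : D) : m'.degree (m'.faceOf (e d)) = m.degree (m.faceOf d) := by
  rw [degree_eq_ncard, degree_eq_ncard, ← Set.ncard_image_of_injective _ e.injective]
  congr 1
  ext a
  obtain ⟨a, rfl⟩ := e.surjective a
  simp [h.faceOf_eq]

lemma faceOf_eq_rootFace {a : D} :
    m'.faceOf (e a) = m'.rootFace ↔ m.faceOf a = m.rootFace := by
  rw [rootFace, ← h.root, h.faceOf_eq, rootFace]

lemma isBoundaryEdge {a : D} :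
    m'.IsBoundaryEdge (m'.edgeOf (e a)) ↔ m.IsBoundaryEdge (m.edgeOf a) := by
  unfold IsBoundaryEdge
  rw [← e.exists_congr_right]
  simp only [h.faceOf_eq_rootFace, h.edgeOf_eq]

lemma isConnected (hm : m.IsConnected) : m'.IsConnected := by
  rw [isConnected_iff]
  intro P h0 h1 h2 d
  obtain ⟨d, rfl⟩ := e.surjective d
  exact hm.induction (P := fun d => P (e d)) (by rwa [h.root])
    (fun d hd => by rw [h.next]; exact h1 _ hd) (fun d hd => by rw [h.flip]; exact h2 _ hd) d

lemma isBipartite (hm : m.IsBipartite) : m'.IsBipartite := by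
  intro f
  obtain ⟨d, rfl⟩ := m'.faceOf_surjective f
  obtain ⟨d, rfl⟩ := e.surjective d
  rw [h.degree_faceOf]
  exact hm _

lemma card_vertex : Nat.card m.Vertex = Nat.card m'.Vertex :=
  Nat.card_congr (Quotient.congr e (sameCycle_iff h.next))

lemma card_edge : Nat.card m.Edge = Nat.card m'.Edge :=
  Nat.card_congr (Quotient.congr e (sameCycle_iff h.flip))

lemma card_face : Nat.card m.Face = Nat.card m'.Face :=
  Nat.card_congr (Quotient.congr e (sameCycle_iff h.faceNext))

lemma isPlanar (hm : m.IsPlanar) : m'.IsPlanar := by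
  unfold IsPlanar at *
  rw [← h.card_vertex, ← h.card_edge, ← h.card_face, hm]

lemma isIsland {κ : m.Edge → Bool} {κ' : m'.Edge → Bool}
    (hκ : ∀ d, κ' (m'.edgeOf (e d)) = κ (m.edgeOf d)) {k : ℕ} (hm : m.IsIsland k κ) :
    m'.IsIsland k κ' where
  connected := h.isConnected hm.connected
  planar := h.isPlanar hm.planar
  bipartite := h.isBipartite hm.bipartite
  simple := by
    constructor
    · intro a ha b hb hab
      obtain ⟨a, rfl⟩ := e.surjective a
      obtain ⟨b, rfl⟩ := e.surjective b
      rw [hm.simple.1 (h.faceOf_eq_rootFace.mp ha) (h.faceOf_eq_rootFace.mp hb)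
        (h.vertexOf_eq.mp hab)]
    · intro a ha b hb hab
      obtain ⟨a, rfl⟩ := e.surjective a
      obtain ⟨b, rfl⟩ := e.surjective b
      rw [hm.simple.2 (h.faceOf_eq_rootFace.mp ha) (h.faceOf_eq_rootFace.mp hb)
        (h.edgeOf_eq.mp hab)]
  perimeter := by
    rw [rootFace, ← h.root, h.degree_faceOf]
    exact hm.perimeter
  boundary_black := by
    intro c hc
    obtain ⟨a, rfl⟩ := m'.edgeOf_surjective c
    obtain ⟨a, rfl⟩ := e.surjective a
    rw [hκ]
    exact hm.boundary_black _ (h.isBoundaryEdge.mp hc)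
  incident_white := by
    rintro _ _ hc ⟨b, hb, hbv⟩ ⟨a, rfl, rfl⟩
    obtain ⟨a, rfl⟩ := e.surjective a
    obtain ⟨b, rfl⟩ := e.surjective b
    rw [hκ]
    exact hm.incident_white _ _ (fun h' => hc (h.isBoundaryEdge.mpr h'))
      ⟨b, h.faceOf_eq_rootFace.mp hb, h.vertexOf_eq.mp hbv⟩ ⟨a, rfl, rfl⟩

end IsoOn

/-- The first return of `m.next` to a set of darts depends only on that set. -/
lemma IsInduced.next_eq {E' : Type} {m : CombMap D} {C : CombMap E} {C' : CombMap E'} {j : E → D}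
    {j' : E' → D} (h : IsInduced m C j) (h' : IsInduced m C' j')
    (hr : Set.range j = Set.range j') {s : E} {s' : E'} (hs : j s = j' s') :
    j (C.next s) = j' (C'.next s') := by
  obtain ⟨k, hk0, hk, hmin⟩ := h s
  obtain ⟨k', hk0', hk', hmin'⟩ := h' s'
  rw [← hs] at hk' hmin'
  rcases lt_trichotomy k k' with hlt | rfl | hlt
  · exact absurd (by rw [hk, ← hr]; exact ⟨_, rfl⟩) (hmin' k hk0 hlt)
  · rw [← hk, hk']
  · exact absurd (by rw [hk', hr]; exact ⟨_, rfl⟩) (hmin k' hk0' hlt)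

lemma IsInduced.eq {m : CombMap D} {C : CombMap E} {j j' : E → D} (hC : C.IsConnected)
    (h : IsInduced m C j) (h' : IsInduced m C j') (hroot : j C.root = j' C.root)
    (hflip : ∀ s, j (C.flip s) = m.flip (j s)) (hflip' : ∀ s, j' (C.flip s) = m.flip (j' s))
    (hr : Set.range j = Set.range j') : j = j' := by
  funext s
  exact hC.induction (P := fun s => j s = j' s) hroot (fun s hs => h.next_eq h' hr hs)
    (fun s hs => by rw [hflip, hflip', hs]) s

namespace IsGlue

variable {m : CombMap D} {κ : m.Edge → Bool} {C : CombMap E} {X X' : C.Face → Type}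
  {J : ∀ f, CombMap (X f)} {κJ : ∀ f, (J f).Edge → Bool} {j j' : E → D} {Ψ : D ⊕ E ≃ Σ f, X f}
  {J' : ∀ f, CombMap (X' f)} {κJ' : ∀ f, (J' f).Edge → Bool} {Ψ' : D ⊕ E ≃ Σ f, X' f}

/-- The glued map is determined by its pieces. -/
lemma exists_isoOn_glued {m' : CombMap D'} {κ' : m'.Edge → Bool} {j' : E → D'}
    {Ψ' : D' ⊕ E ≃ Σ f, X f} (h : IsGlue m κ C J κJ j Ψ) (h' : IsGlue m' κ' C J κJ j' Ψ') :
    ∃ e : D ≃ D', IsoOn m m' e ∧ ∀ d, κ' (m'.edgeOf (e d)) = κ (m.edgeOf d) := by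
  -- The labellings agree at the chosen dart of each face, and `φ_inr` propagates the agreement
  -- around the face.
  have hinr : ∀ s, Ψ (Sum.inr s) = Ψ' (Sum.inr s) := by
    intro s
    have h1 : C.faceNext.SameCycle (C.faceRep (C.faceOf s)) s :=
      C.faceOf_eq_iff.mp (faceOf_faceRep _ _)
    have h2 := h1.of_invariant (g := fun s => Ψ (Sum.inr s) = Ψ' (Sum.inr s)) fun t => by
      rw [← h.φ_inr t, ← h'.φ_inr t, (sigmaNext J).apply_eq_iff_eq, (sigmaFlip J).apply_eq_iff_eq]
    rw [← h2, h.root_eq, h'.root_eq]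
  have hex : ∀ d, ∃ d', Ψ' (Sum.inl d') = Ψ (Sum.inl d) := by
    intro d
    obtain ⟨u, hu⟩ := Ψ'.surjective (Ψ (Sum.inl d))
    rcases u with d' | s
    · exact ⟨d', hu⟩
    · rw [← hinr] at hu
      simp at hu
  choose e he using hex
  have hinj : Function.Injective e := fun a b hab => by
    have := he a
    rw [hab, he b] at this
    simpa using this.symm
  have hsurj : Function.Surjective e := by
    intro d'
    obtain ⟨u, hu⟩ := Ψ.surjective (Ψ' (Sum.inl d'))
    rcases u with d | s
    · refine ⟨d, ?_⟩
      have := he d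
      rw [hu] at this
      simpa using this
    · rw [hinr] at hu
      simp at hu
  have hj : ∀ s, e (j s) = j' s := by
    intro s
    have := he (j s)
    rw [← h.α_inr, hinr, h'.α_inr] at this
    simpa using this
  have hflip : ∀ d, e (m.flip d) = m'.flip (e d) := by
    intro d
    by_cases hd : d ∈ Set.range j
    · obtain ⟨s, rfl⟩ := hd
      rw [← h.j_flip, hj, hj, h'.j_flip]
    · have hd' : e d ∉ Set.range j' := by
        rintro ⟨s, hs⟩
        rw [← hj] at hs
        exact hd ⟨s, hinj hs⟩
      have h1 := he (m.flip d)
      rw [← h.α_inl d hd, ← he d, h'.α_inl _ hd'] at h1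
      simpa using h1
  have hface : ∀ d, e (m.faceNext d) = m'.faceNext (e d) := by
    intro d
    have h1 := he (m.faceNext d)
    rw [← h.φ_inl d, ← he d, h'.φ_inl] at h1
    simpa using h1
  refine ⟨Equiv.ofBijective e ⟨hinj, hsurj⟩, ⟨fun d => ?_, hflip, ?_⟩, fun d => ?_⟩
  · show e (m.next d) = m'.next (e d)
    rw [← faceNext_flip, hface, hflip, faceNext_flip]
  · show e m.root = m'.root
    rw [← h.j_root, hj, h'.j_root]
  · show κ' (m'.edgeOf (e d)) = κ (m.edgeOf d)
    rw [← h.color_inl (x := (Ψ (Sum.inl d)).2) rfl]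
    exact (h'.color_inl (he d)).symm

/-- The pieces of a glued map are determined by this map. -/
lemma exists_isoOn_piece (h : IsGlue m κ C J κJ j Ψ) (h' : IsGlue m κ C J' κJ' j Ψ')
    (hJ : ∀ f, (J f).IsConnected) (f : C.Face) :
    ∃ e : X f ≃ X' f, IsoOn (J f) (J' f) e ∧
      ∀ x, κJ' f ((J' f).edgeOf (e x)) = κJ f ((J f).edgeOf x) := by
  let Θ : (Σ f, X f) ≃ Σ f, X' f := Ψ.symm.trans Ψ'
  have hΘ : ∀ u, Θ (Ψ u) = Ψ' u := fun u => by simp [Θ]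
  have hflip : ∀ w, Θ (sigmaFlip J w) = sigmaFlip J' (Θ w) := by
    intro w
    obtain ⟨u, rfl⟩ := Ψ.surjective w
    rcases u with d | s
    · by_cases hd : d ∈ Set.range j
      · obtain ⟨s, rfl⟩ := hd
        rw [h.α_j, hΘ, hΘ, h'.α_j]
      · rw [h.α_inl _ hd, hΘ, hΘ, h'.α_inl _ hd]
    · rw [h.α_inr, hΘ, hΘ, h'.α_inr]
  have hφ : ∀ w, Θ (sigmaNext J (sigmaFlip J w)) = sigmaNext J' (sigmaFlip J' (Θ w)) := by
    intro w
    obtain ⟨u, rfl⟩ := Ψ.surjective w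
    rcases u with d | s
    · rw [h.φ_inl, hΘ, hΘ, h'.φ_inl]
    · obtain ⟨t, rfl⟩ := C.faceNext.surjective s
      rw [h.φ_inr, hΘ, hΘ, h'.φ_inr]
  have hnext : ∀ w, Θ (sigmaNext J w) = sigmaNext J' (Θ w) := by
    intro w
    have := hφ (sigmaFlip J w)
    rwa [h.α_α, hflip, h'.α_α] at this
  have hcol : ∀ w, κJ' _ ((J' _).edgeOf (Θ w).2) = κJ _ ((J _).edgeOf w.2) := by
    intro w
    obtain ⟨u, rfl⟩ := Ψ.surjective w
    rw [hΘ]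
    rcases u with d | s
    · rw [← h.color, ← h'.color]
    · rw [h.color_inr (x := (Ψ (Sum.inr s)).2) rfl, h'.color_inr (x := (Ψ' (Sum.inr s)).2) rfl]
  have hroot : ∀ f, Θ ⟨f, (J f).root⟩ = ⟨f, (J' f).root⟩ := fun f => by
    rw [← h.root_eq, hΘ, h'.root_eq]
  -- `Θ` commutes with both permutations and preserves roots, so connectedness keeps each piece over
  -- its face.
  have hfib : ∀ f (x : X f), ∃ y, Θ ⟨f, x⟩ = ⟨f, y⟩ := by
    intro f
    refine (hJ f).induction ⟨_, hroot f⟩ (fun x hx => ?_) (fun x hx => ?_)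
    · obtain ⟨y, hy⟩ := hx
      have := hnext ⟨f, x⟩
      rw [hy] at this
      exact ⟨_, this⟩
    · obtain ⟨y, hy⟩ := hx
      have := hflip ⟨f, x⟩
      rw [hy] at this
      exact ⟨_, this⟩
  choose e he using hfib
  have hmk : ∀ {g} {a b : X' g}, (⟨g, a⟩ : Σ f, X' f) = ⟨g, b⟩ → a = b := fun hab =>
    eq_of_heq (Sigma.mk.inj hab).2
  have hinj : Function.Injective (e f) := fun a b hab => by
    have := he f a
    rw [hab, ← he f b, Θ.apply_eq_iff_eq] at this
    exact eq_of_heq (Sigma.mk.inj this).2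
  have hsurj : Function.Surjective (e f) := by
    intro y
    obtain ⟨⟨g, x⟩, hx⟩ := Θ.surjective ⟨f, y⟩
    rw [he] at hx
    obtain rfl : g = f := congrArg Sigma.fst hx
    exact ⟨x, hmk hx⟩
  refine ⟨Equiv.ofBijective (e f) ⟨hinj, hsurj⟩, ⟨fun x => ?_, fun x => ?_, ?_⟩, fun x => ?_⟩
  · exact hmk ((he f _).symm.trans ((hnext ⟨f, x⟩).trans (congrArg (sigmaNext J') (he f x))))
  · exact hmk ((he f _).symm.trans ((hflip ⟨f, x⟩).trans (congrArg (sigmaFlip J') (he f x))))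
  · exact hmk ((he f _).symm.trans (hroot f))
  · have := hcol ⟨f, x⟩
    rw [he] at this
    exact this

/-- Replacing the glued map and the pieces by isomorphic ones. -/
lemma congr {m' : CombMap D'} {κ' : m'.Edge → Bool} (h : IsGlue m κ C J κJ j Ψ) {e : D ≃ D'}
    (he : IsoOn m m' e) (hκ : ∀ d, κ' (m'.edgeOf (e d)) = κ (m.edgeOf d))
    {e' : ∀ f, X f ≃ X' f} (he' : ∀ f, IsoOn (J f) (J' f) (e' f))
    (hκ' : ∀ f x, κJ' f ((J' f).edgeOf (e' f x)) = κJ f ((J f).edgeOf x)) :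
    ∃ Ψ', IsGlue m' κ' C J' κJ' (e ∘ j) Ψ' := by
  let Θ := Equiv.sigmaCongrRight e'
  have hflip : ∀ w, sigmaFlip J' (Θ w) = Θ (sigmaFlip J w) := fun w =>
    Sigma.ext rfl (heq_of_eq ((he' _).flip _).symm)
  have hnext : ∀ w, sigmaNext J' (Θ w) = Θ (sigmaNext J w) := fun w =>
    Sigma.ext rfl (heq_of_eq ((he' _).next _).symm)
  obtain ⟨Ψ', hl, hr⟩ : ∃ Ψ' : D' ⊕ E ≃ Σ f, X' f,
      (∀ d, Ψ' (Sum.inl (e d)) = Θ (Ψ (Sum.inl d))) ∧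
        ∀ s, Ψ' (Sum.inr s) = Θ (Ψ (Sum.inr s)) :=
    ⟨((Equiv.sumCongr e (Equiv.refl E)).symm.trans Ψ).trans Θ,
      fun d => congrArg (fun d => Θ (Ψ (Sum.inl d))) (e.symm_apply_apply d), fun s => rfl⟩
  refine ⟨Ψ',
    { inj := e.injective.comp h.inj
      j_flip := fun s => by simp [h.j_flip, he.flip]
      j_root := by simp [h.j_root, he.root]
      α_j := fun s => ?_
      α_inr := fun s => ?_
      α_inl := fun d hd => ?_
      φ_inl := fun d => ?_
      φ_inr := fun s => ?_
      fst_inr := fun s => ?_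
      root_eq := fun f => ?_
      color := fun d => ?_ }⟩
  · rw [Function.comp_apply, hl, hflip, h.α_j, hr]
  · rw [Function.comp_apply, hl, hr, hflip, h.α_inr]
  · obtain ⟨d, rfl⟩ := e.surjective d
    have hd' : d ∉ Set.range j := fun ⟨s, hs⟩ => hd ⟨s, congrArg e hs⟩
    rw [hl, hflip, h.α_inl d hd', ← he.flip, hl]
  · obtain ⟨d, rfl⟩ := e.surjective d
    rw [hl, hflip, hnext, h.φ_inl, ← he.faceNext, hl]
  · rw [hr, hr, hflip, hnext, h.φ_inr]
  · rw [hr]; exact h.fst_inr s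
  · rw [hr, h.root_eq]
    exact Sigma.ext rfl (heq_of_eq (he' f).root)
  · obtain ⟨d, rfl⟩ := e.surjective d
    rw [hκ, h.color, ← hκ', hl]
    rfl

end IsGlue

end CombMap

/-! ### Weights of glued maps -/

namespace CombMap
open Equiv Equiv.Perm

variable {D E : Type}

lemma prod_sigma_filter {ι M : Type*} [Fintype ι] {Q : ι → Type*} [∀ i, Fintype (Q i)]
    [CommMonoid M] (P : ∀ i, Q i → Prop) [∀ i, DecidablePred (P i)] (F : ∀ i, Q i → M) :
    ∏ x : Σ i, Q i with P x.1 x.2, F x.1 x.2 = ∏ i, ∏ c with P i c, F i c := by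
  simp only [Finset.prod_filter]
  exact Fintype.prod_sigma _

lemma IsBipartite.sum_half_degree [Finite D] {m : CombMap D} (h : m.IsBipartite) :
    ∑ f, m.degree f / 2 = Nat.card m.Edge := by
  have h1 := m.sum_degree
  have h2 : ∑ f, m.degree f = 2 * ∑ f, m.degree f / 2 := by
    rw [Finset.mul_sum]
    exact Finset.sum_congr rfl fun f _ => (Nat.two_mul_div_two_of_even (h f)).symm
  rw [h2, ← m.two_mul_card_edge] at h1
  omega

namespace IsGlue

variable [Finite D] [Finite E] {m : CombMap D} {κ : m.Edge → Bool} {C : CombMap E}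
  {X : C.Face → Type} [∀ f, Finite (X f)]
  {J : ∀ f, CombMap (X f)} {κJ : ∀ f, (J f).Edge → Bool} {j : E → D} {Ψ : D ⊕ E ≃ Σ f, X f}

open Classical in
lemma prod_face {M : Type*} [CommMonoid M] (h : IsGlue m κ C J κJ j Ψ) (g : ℕ → M) :
    ∏ c : m.Face, g (m.degree c) =
      ∏ f, ∏ c : (J f).Face with c ≠ (J f).rootFace, g ((J f).degree c) := by
  rw [← prod_sigma_filter (fun f (c : (J f).Face) => c ≠ (J f).rootFace)
    fun f c => g ((J f).degree c), ← Finset.filter_true Finset.univ]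
  refine prod_filter_eq_of_classes m.faceOf_surjective (sigmaFace_surjective (J := J))
    (fun _ => True) (fun x => x.2 ≠ (J x.1).rootFace) (fun d => Ψ (Sum.inl d)) ?_ ?_ ?_ _ _ ?_
  · intro d _ h'
    exact h.sigmaFace_inl_ne d _ (Sigma.ext rfl (heq_of_eq h'))
  · exact fun d d' _ _ => h.sigmaFace_inl_eq.symm
  · intro w hw
    obtain ⟨u, rfl⟩ := Ψ.surjective w
    rcases u with d | s
    · exact ⟨d, trivial, rfl⟩
    · exact absurd (h.faceOf_eq_rootFace_iff.mpr ⟨s, rfl⟩) hw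
  · intro d _
    rw [← h.degree_faceOf_inl]
    rfl

open Classical in
-- The edges of `m` are those of `C`, all black, and the internal edges of the pieces.
lemma prod_edge {M : Type*} [CommMonoid M] (h : IsGlue m κ C J κJ j Ψ)
    (hb : ∀ f e, (J f).IsBoundaryEdge e → κJ f e = true) (g : Bool → M) :
    ∏ e : m.Edge, g (κ e) = g true ^ Nat.card C.Edge *
      ∏ f, ∏ e : (J f).Edge with ¬ (J f).IsBoundaryEdge e, g (κJ f e) := by
  let P : m.Edge → Prop := fun e => ∃ s, e = m.edgeOf (j s)
  have hP : ∀ d, P (m.edgeOf d) ↔ d ∈ Set.range j := by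
    intro d
    constructor
    · rintro ⟨s, hs⟩
      rcases m.edgeOf_eq_iff.mp hs with hs | hs
      · exact ⟨s, hs⟩
      · exact h.flip_mem.mp ⟨s, hs⟩
    · rintro ⟨s, rfl⟩
      exact ⟨s, rfl⟩
  rw [← Finset.prod_filter_mul_prod_filter_not Finset.univ P]
  congr 1
  · have h1 : ∏ e : C.Edge with True, g true = ∏ e : m.Edge with P e, g (κ e) := by
      refine prod_filter_eq_of_classes C.edgeOf_surjective m.edgeOf_surjective
        (fun _ => True) P j (fun s _ => ⟨s, rfl⟩) ?_ ?_ _ _ ?_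
      · intro s t _ _
        rw [edgeOf_eq_iff, edgeOf_eq_iff, ← h.j_flip, h.inj.eq_iff, h.inj.eq_iff]
      · rintro d ⟨s, hs⟩
        exact ⟨s, trivial, hs.symm⟩
      · intro s _
        exact congrArg g ((hb _ _ (h.isBoundaryEdge_inr rfl)).symm.trans
          (h.color_inr (x := (Ψ (Sum.inr s)).2) rfl))
    rw [← h1, Finset.filter_true, Finset.prod_const, Finset.card_univ, Nat.card_eq_fintype_card]
  · rw [← prod_sigma_filter (fun f (e : (J f).Edge) => ¬ (J f).IsBoundaryEdge e)
      fun f e => g (κJ f e)]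
    refine prod_filter_eq_of_classes m.edgeOf_surjective (sigmaEdge_surjective (J := J))
      (fun e => ¬ P e) (fun x => ¬ (J x.1).IsBoundaryEdge x.2) (fun d => Ψ (Sum.inl d)) ?_ ?_ ?_ _ _ ?_
    · intro d hd
      rw [hP] at hd
      exact (h.not_isBoundaryEdge rfl).mpr hd
    · intro d d' hd _
      rw [hP] at hd
      rw [edgeOf_eq_iff, sigmaEdge_eq, h.α_inl d hd]
      simp
    · intro w hw
      obtain ⟨u, rfl⟩ := Ψ.surjective w
      rcases u with d | s
      · exact ⟨d, fun h' => (h.not_isBoundaryEdge rfl).mp hw ((hP d).mp h'), rfl⟩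
      · exact absurd (h.isBoundaryEdge_inr rfl) hw
    · intro d _
      rw [h.color]
      rfl

/-- The half-degrees of `C` sum to its number of edges, which distributes the factor `p` per edge of
`C` over the faces. -/
lemma weight_eq (h : IsGlue m κ C J κJ j Ψ) (hC : C.IsBipartite)
    (hb : ∀ f e, (J f).IsBoundaryEdge e → κJ f e = true) (q : ℕ → ℝ≥0) (p : ℝ≥0) :
    m.weight q * ∏ e : m.Edge, (if κ e then p else 1 - p) =
      ∏ f, (p ^ (C.degree f / 2) * (J f).islandWeight q p (κJ f)) := by
  have h1 := h.prod_face fun n => q (n / 2)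
  have h2 := h.prod_edge hb fun b => if b then p else 1 - p
  simp only [if_true] at h2
  rw [weight, h1, h2, Finset.prod_mul_distrib, Finset.prod_pow_eq_pow_sum, hC.sum_half_degree,
    mul_comm, mul_assoc, ← Finset.prod_mul_distrib]
  congr 1

end IsGlue

end CombMap

/-! ### Isomorphism classes, colourings and clusters -/

namespace MapClass
open CombMap

/-- The isomorphism class of a rooted map. -/
noncomputable def mk {D : Type} [Finite D] (m : CombMap D) : MapClass :=
  Quotient.mk CombMap.isoSetoid ⟨Nat.card D, m.relabel (Finite.equivFin D)⟩

lemma exists_isoOn_rep {D : Type} [Finite D] (m : CombMap D) : ∃ e, IsoOn m (mk m).rep e := by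
  have h1 : IsoOn m (m.relabel (Finite.equivFin D)) (Finite.equivFin D) := by
    constructor <;> simp [relabel, Equiv.permCongr_apply]
  obtain ⟨e, e1, e2, e3⟩ : CombMap.Iso (m.relabel (Finite.equivFin D)) (mk m).rep :=
    CombMap.isoSetoid.symm (Quotient.exact (Quotient.out_eq (mk m)))
  exact ⟨_, h1.trans ⟨e1, e2, e3⟩⟩

lemma eq_of_isoOn {c c' : MapClass} {e} (h : IsoOn c.rep c'.rep e) : c = c' := by
  have : (Quotient.out c) ≈ (Quotient.out c') := ⟨e, h.next, h.flip, h.root⟩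
  rw [← Quotient.out_eq c, ← Quotient.out_eq c']
  exact Quotient.sound this

lemma mk_eq_iff {D : Type} [Finite D] (m : CombMap D) (c : MapClass) :
    mk m = c ↔ ∃ e, IsoOn m c.rep e := by
  constructor
  · rintro rfl
    exact exists_isoOn_rep m
  · rintro ⟨e, he⟩
    obtain ⟨e', he'⟩ := exists_isoOn_rep m
    exact eq_of_isoOn (he'.symm.trans he)

/-- A coloured rooted connected map has no nontrivial automorphism. -/
lemma ext_color {c c' : MapClass} {κ : c.rep.Edge → Bool} {κ' : c'.rep.Edge → Bool}
    (hc : c.rep.IsConnected) {e} (h : IsoOn c.rep c'.rep e)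
    (hκ : ∀ d, κ' (c'.rep.edgeOf (e d)) = κ (c.rep.edgeOf d)) :
    (⟨c, κ⟩ : Σ c : MapClass, (c.rep.Edge → Bool)) = ⟨c', κ'⟩ := by
  obtain rfl := eq_of_isoOn h
  -- By rigidity the isomorphism is the identity, so the colourings are equal and not merely related
  -- by an automorphism.
  have := h.unique (e' := Equiv.refl _) ⟨fun _ => rfl, fun _ => rfl, rfl⟩ hc
  subst this
  congr 1
  funext b
  obtain ⟨d, rfl⟩ := c.rep.edgeOf_surjective b
  exact (hκ d).symm

/-- Transport of a colouring to the representative. -/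
lemma exists_color {D : Type} [Finite D] (m : CombMap D) (κ : m.Edge → Bool) :
    ∃ e, ∃ κ' : (mk m).rep.Edge → Bool, IsoOn m (mk m).rep e ∧
      ∀ d, κ' ((mk m).rep.edgeOf (e d)) = κ (m.edgeOf d) := by
  obtain ⟨e, he⟩ := exists_isoOn_rep m
  refine ⟨e, fun b => κ (m.edgeOf (e.symm (Quotient.out b))), he, fun d => ?_⟩
  have : (mk m).rep.edgeOf (Quotient.out ((mk m).rep.edgeOf (e d))) = (mk m).rep.edgeOf (e d) :=
    Quotient.out_eq _
  rw [← e.apply_symm_apply (Quotient.out ((mk m).rep.edgeOf (e d))), he.edgeOf_eq] at this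
  exact congrArg κ this

end MapClass

lemma ENNReal.prod_tsum_eq_tsum_prod {ι : Type*} [Fintype ι] {β : ι → Type*}
    (g : ∀ i, β i → ℝ≥0∞) : ∏ i, ∑' b, g i b = ∑' b : ∀ i, β i, ∏ i, g i (b i) := by
  revert β
  refine Fintype.induction_empty_option (P := fun ι _ => ∀ {β : ι → Type _} (g : ∀ i, β i → ℝ≥0∞),
    ∏ i, ∑' b, g i b = ∑' b : ∀ i, β i, ∏ i, g i (b i)) ?_ ?_ ?_ ι
  · intro α α' _ e ih β g
    let _ : Fintype α := Fintype.ofEquiv α' e.symm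
    have h1 := ih (β := fun a => β (e a)) fun a => g (e a)
    rw [← e.prod_comp (fun i => ∑' b, g i b)]
    refine Eq.trans ?_ (h1.trans ?_)
    · exact Finset.prod_congr (by ext; simp) fun _ _ => rfl
    · rw [← (Equiv.piCongrLeft β e).tsum_eq]
      refine tsum_congr fun b => ?_
      rw [← e.prod_comp fun i => g i _]
      refine Finset.prod_congr (by ext; simp) fun a _ => ?_
      rw [Equiv.piCongrLeft_apply_apply]
  · intro β g
    simp
  · intro α _ ih β g
    rw [Fintype.prod_option, ih, ← (Equiv.piOptionEquivProd (β := β)).symm.tsum_eq,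
      ENNReal.tsum_prod', ← ENNReal.tsum_mul_right]
    refine tsum_congr fun a => ?_
    rw [← ENNReal.tsum_mul_left]
    refine tsum_congr fun b => ?_
    rw [Fintype.prod_option]
    rfl

lemma exists_equiv_of_rel {A B : Type*} {R : A → B → Prop} (h1 : ∀ a, ∃ b, R a b)
    (h2 : ∀ b, ∃ a, R a b) (h3 : ∀ a a' b, R a b → R a' b → a = a')
    (h4 : ∀ a b b', R a b → R a b' → b = b') : ∃ e : A ≃ B, ∀ a, R a (e a) := by
  choose f hf using h1
  choose g hg using h2
  exact ⟨⟨f, g, fun a => h3 _ _ _ (hg _) (hf _), fun b => h4 _ _ _ (hf _) (hg _)⟩, hf⟩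

namespace CombMap
open Equiv Equiv.Perm

variable {D E : Type}

section Cluster

variable [Finite D] {m : CombMap D} {κ : m.Edge → Bool} {h : κ (m.edgeOf m.root) = true}
  {C : CombMap E}

lemma isInduced_cluster : IsInduced m (m.cluster κ h) Subtype.val := by
  classical
  intro s
  have hspec := Nat.find_spec (exists_return m.next (m.clusterDarts κ) s)
  refine ⟨Nat.find (exists_return m.next (m.clusterDarts κ) s), hspec.1, ?_, ?_⟩
  · show _ = ((firstReturn m.next (m.clusterDarts κ) s : m.clusterDarts κ) : D)
    unfold firstReturn
    congr!
  · rintro i hi hik ⟨t, ht⟩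
    exact Nat.find_min (exists_return m.next (m.clusterDarts κ) s) hik ⟨hi, ht ▸ t.2⟩

lemma IsoOn.isInduced {e : m.clusterDarts κ ≃ E} (he : IsoOn (m.cluster κ h) C e) :
    IsInduced m C (Subtype.val ∘ e.symm) := by
  intro s
  obtain ⟨k, hk0, hk, hmin⟩ := isInduced_cluster (h := h) (e.symm s)
  refine ⟨k, hk0, ?_, ?_⟩
  · rw [← he.symm.next] at hk
    exact hk
  · rw [e.symm.surjective.range_comp]
    exact hmin

/-- Characterises the cluster without first returns: any induced submap on the same darts, with the
same root, is isomorphic to it. -/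
lemma exists_isoOn_cluster {j : E → D} (hj : Function.Injective j)
    (j_flip : ∀ s, j (C.flip s) = m.flip (j s)) (j_root : j C.root = m.root)
    (hI : IsInduced m C j) (hr : Set.range j = m.clusterDarts κ) :
    ∃ e, IsoOn (m.cluster κ h) C e := by
  let e : E ≃ m.clusterDarts κ := (Equiv.ofInjective j hj).trans (Equiv.setCongr hr)
  have he : ∀ s, (e s : D) = j s := fun s => rfl
  have : IsoOn C (m.cluster κ h) e :=
    { next := fun s => Subtype.ext (hI.next_eq (isInduced_cluster (h := h))
        (by rw [hr, Subtype.range_coe]) (he s).symm)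
      flip := fun s => Subtype.ext (j_flip s)
      root := Subtype.ext j_root }
  exact ⟨_, this.symm⟩

end Cluster

end CombMap

/-! ### The bijection between percolated maps with cluster `c` and families of islands -/

open CombMap

/-- Isomorphism classes of coloured maps. -/
abbrev ColoredClass : Type := Σ d : MapClass, (d.rep.Edge → Bool)

/-- Isomorphism classes of islands of perimeter `2 * k`. -/
abbrev IslandClass (k : ℕ) : Type := Σ d : MapClass, {κ : d.rep.Edge → Bool // d.rep.IsIsland k κ}

namespace MapClass

/-- Planar bipartite maps. -/
structure IsPB (c : MapClass) : Prop where
  connected : c.rep.IsConnected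
  planar : c.rep.IsPlanar
  bipartite : c.rep.IsBipartite

/-- The percolated planar bipartite map `y` has cluster `c`. -/
def HasCluster (c : MapClass) (y : ColoredClass) : Prop :=
  y.1.IsPB ∧ ∃ h : y.2 (y.1.rep.edgeOf y.1.rep.root) = true, mk (y.1.rep.cluster y.2 h) = c

/-- The percolated map `y` is obtained by gluing the islands `I f` into the faces of `c`. -/
def GlueRel (c : MapClass) (y : ColoredClass) (I : ∀ f, IslandClass (c.rep.degree f / 2)) : Prop :=
  ∃ j Ψ, IsGlue y.1.rep y.2 c.rep (fun f => (I f).1.rep) (fun f => (I f).2.1) j Ψ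

variable {c : MapClass} {y y' : ColoredClass} {I I' : ∀ f, IslandClass (c.rep.degree f / 2)}

lemma HasCluster.exists_glueRel (h : c.HasCluster y) : c.IsPB ∧ ∃ I, c.GlueRel y I := by
  obtain ⟨⟨h1, h2, h3⟩, hroot, hc⟩ := h
  obtain ⟨e, he⟩ := (mk_eq_iff _ _).mp hc
  obtain ⟨c1, c2, c3, X, _, J, κJ, Ψ, hG, hJ⟩ := exists_isGlue (j := Subtype.val ∘ e.symm)
    (C := c.rep) h1 h2 h3 (Subtype.val_injective.comp e.symm.injective)
    (fun s => congrArg Subtype.val (he.symm.flip s)) (congrArg Subtype.val he.symm.root)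
    he.isInduced (by rw [e.symm.surjective.range_comp, Subtype.range_coe])
  choose e' κ' he' hκ' using fun f => exists_color (J f) (κJ f)
  refine ⟨⟨c1, c2, c3⟩, fun f => ⟨mk (J f), κ' f, (he' f).isIsland (hκ' f) (hJ f)⟩, ?_⟩
  obtain ⟨Ψ', hΨ'⟩ := hG.congr (m' := y.1.rep) (κ' := y.2) (e := Equiv.refl _)
    ⟨fun _ => rfl, fun _ => rfl, rfl⟩ (fun _ => rfl) he' hκ'
  exact ⟨_, Ψ', hΨ'⟩

lemma exists_glueRel (hc : c.IsPB) (I : ∀ f, IslandClass (c.rep.degree f / 2)) :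
    ∃ y, c.GlueRel y I := by
  obtain ⟨D, _, m, κ, j, Ψ, hG⟩ := exists_glue c.rep (fun f => (I f).1.rep) (fun f => (I f).2.1)
    (fun f => by
      rw [(I f).2.2.perimeter, Nat.two_mul_div_two_of_even (hc.bipartite f)])
    (fun f => (I f).2.2.simple) (fun f => (I f).2.2.boundary_black)
  obtain ⟨e, κ', he, hκ'⟩ := exists_color m κ
  obtain ⟨Ψ', hΨ'⟩ := hG.congr he hκ' (e' := fun f => Equiv.refl _)
    (fun f => ⟨fun _ => rfl, fun _ => rfl, rfl⟩) (fun _ _ => rfl)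
  exact ⟨⟨mk m, κ'⟩, _, Ψ', hΨ'⟩

lemma isInduced_of_isGlue {D : Type} [Finite D] {m : CombMap D} {κ : m.Edge → Bool}
    {j : Fin (Quotient.out c).1 → D} {Ψ}
    (h : IsGlue m κ c.rep (fun f => (I f).1.rep) (fun f => (I f).2.1) j Ψ) :
    IsInduced m c.rep j :=
  h.isInduced_of_simple (h.simple_iff.mpr fun f => (I f).2.2.simple.1)

lemma range_eq_of_isGlue (hc : c.IsPB) {D : Type} [Finite D] {m : CombMap D} {κ : m.Edge → Bool}
    {j : Fin (Quotient.out c).1 → D} {Ψ}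
    (h : IsGlue m κ c.rep (fun f => (I f).1.rep) (fun f => (I f).2.1) j Ψ) :
    Set.range j = m.clusterDarts κ :=
  h.range_eq_clusterDarts (isInduced_of_isGlue h) hc.connected
    (fun f => (I f).2.2.boundary_black) (fun f => (I f).2.2.incident_white)

lemma GlueRel.isPB (hc : c.IsPB) (h : c.GlueRel y I) : y.1.IsPB := by
  obtain ⟨j, Ψ, h⟩ := h
  have hI := isInduced_of_isGlue h
  exact ⟨h.isConnected hc.connected hI fun f => (I f).2.2.connected,
    h.isPlanar hI hc.planar fun f => (I f).2.2.planar,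
    h.isBipartite fun f => (I f).2.2.bipartite⟩

lemma GlueRel.hasCluster (hc : c.IsPB) (h : c.GlueRel y I) : c.HasCluster y := by
  refine ⟨h.isPB hc, ?_⟩
  obtain ⟨j, Ψ, h⟩ := h
  have hr := range_eq_of_isGlue hc h
  have hroot : y.1.rep.root ∈ y.1.rep.clusterDarts y.2 := by
    rw [← hr, ← h.j_root]
    exact ⟨_, rfl⟩
  exact ⟨hroot.1, (mk_eq_iff _ _).mpr
    (exists_isoOn_cluster h.inj h.j_flip h.j_root (isInduced_of_isGlue h) hr)⟩

lemma GlueRel.eq_left (hc : c.IsPB) (h : c.GlueRel y I) (h' : c.GlueRel y' I) : y = y' := by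
  have hy := (h.isPB hc).connected
  obtain ⟨j, Ψ, h⟩ := h
  obtain ⟨j', Ψ', h'⟩ := h'
  obtain ⟨e, he, hκ⟩ := h.exists_isoOn_glued h'
  exact ext_color hy he hκ

/-- The embedding of `c` is determined by its root and its range, which is the cluster in both
gluings. For a common embedding, the islands are compared by `exists_isoOn_piece`. -/
lemma GlueRel.eq_right (hc : c.IsPB) (h : c.GlueRel y I) (h' : c.GlueRel y I') : I = I' := by
  obtain ⟨j, Ψ, h⟩ := h
  obtain ⟨j', Ψ', h'⟩ := h'
  obtain rfl : j = j' := (isInduced_of_isGlue h).eq hc.connected (isInduced_of_isGlue h')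
    (by rw [h.j_root, h'.j_root]) h.j_flip h'.j_flip
    (by rw [range_eq_of_isGlue hc h, range_eq_of_isGlue hc h'])
  funext f
  obtain ⟨e, he, hκ⟩ := h.exists_isoOn_piece h' (fun f => (I f).2.2.connected) f
  have := ext_color (I f).2.2.connected he hκ
  generalize I f = a at this
  generalize I' f = b at this
  obtain ⟨d, κ, hκ⟩ := a
  obtain ⟨d', κ', hκ'⟩ := b
  obtain rfl : d = d' := congrArg Sigma.fst this
  obtain rfl : κ = κ' := eq_of_heq (Sigma.mk.inj this).2
  rfl

/-- The weight of a percolated map. -/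
noncomputable def percWeight (q : ℕ → ℝ≥0) (p : ℝ≥0) (y : ColoredClass) : ℝ≥0 :=
  y.1.rep.weight q * ∏ e : y.1.rep.Edge, (if y.2 e then p else 1 - p)

lemma GlueRel.percWeight_eq (hc : c.IsPB) (h : c.GlueRel y I) (q : ℕ → ℝ≥0) (p : ℝ≥0) :
    percWeight q p y =
      ∏ f, (p ^ (c.rep.degree f / 2) * (I f).1.rep.islandWeight q p (I f).2.1) := by
  obtain ⟨j, Ψ, h⟩ := h
  exact h.weight_eq hc.bipartite (fun f => (I f).2.2.boundary_black) q p

/-- The total weight of percolated maps with a given cluster. -/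
theorem tsum_percWeight (hc : c.IsPB) (q : ℕ → ℝ≥0) (p : ℝ≥0) :
    ∑' y : {y // c.HasCluster y}, (percWeight q p y.1 : ℝ≥0∞) =
      ∏ f, ((p : ℝ≥0∞) ^ (c.rep.degree f / 2) * islandPartition q p (c.rep.degree f / 2)) := by
  -- Cutting and gluing give existence on either side, and the uniqueness lemmas make the relation a
  -- bijection. A product of island sums then expands as a sum over families of islands.
  obtain ⟨e, he⟩ : ∃ e : {y // c.HasCluster y} ≃ ∀ f, IslandClass (c.rep.degree f / 2),
      ∀ y, c.GlueRel y.1 (e y) := by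
    refine exists_equiv_of_rel (fun y => y.2.exists_glueRel.2) (fun I => ?_)
      (fun y y' I h h' => Subtype.ext (h.eq_left hc h')) (fun y I I' h h' => h.eq_right hc h')
    obtain ⟨y, hy⟩ := exists_glueRel hc I
    exact ⟨⟨y, hy.hasCluster hc⟩, hy⟩
  have h1 : ∀ k, islandPartition q p k =
      ∑' x : IslandClass k, (x.1.rep.islandWeight q p x.2.1 : ℝ≥0∞) := fun k => by
    rw [ENNReal.tsum_sigma']
    rfl
  simp only [h1, ← ENNReal.tsum_mul_left]
  rw [ENNReal.prod_tsum_eq_tsum_prod, ← e.tsum_eq]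
  refine tsum_congr fun y => ?_
  rw [(he y).percWeight_eq hc]
  push_cast
  rfl

end MapClass

/-! ### Stars: planar maps with one face of given degree -/

namespace CombMap
open Equiv Equiv.Perm

/-- The star with `k` edges. -/
def star (k : ℕ) : CombMap (ZMod k ⊕ ZMod k) where
  -- The darts `inl i` leave the centre and the darts `inr i` leave the leaves.
  next := Equiv.sumCongr (Equiv.addRight 1) (Equiv.refl _)
  flip := Equiv.sumComm _ _
  root := Sum.inl 0
  flip_flip d := by cases d <;> rfl
  flip_ne d := by cases d <;> simp

section Star

variable (k : ℕ)

lemma star_invariant [NeZero k] {P : ZMod k → Prop} (h0 : P 0) (h : ∀ i, P i → P (i + 1))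
    (i : ZMod k) : P i := by
  obtain ⟨n, rfl⟩ := ZMod.natCast_zmod_surjective i
  induction n with
  | zero => simpa using h0
  | succ n ih => rw [Nat.cast_succ]; exact h _ ih

lemma star_isConnected [NeZero k] : (star k).IsConnected := by
  rw [isConnected_iff]
  intro P h0 h1 h2
  have h3 : ∀ i, P (Sum.inl i) := star_invariant k h0 fun i hi => h1 _ hi
  rintro (i | i)
  · exact h3 i
  · exact h2 _ (h3 i)

/-- The face walk goes `inl i`, `inr i`, `inl (i + 1)`, and so on through all darts. -/
lemma star_faceOf [NeZero k] (d : ZMod k ⊕ ZMod k) : (star k).faceOf d = (star k).rootFace := by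
  have h1 : ∀ i, (star k).faceOf (Sum.inr i) = (star k).faceOf (Sum.inl i) := fun i =>
    (star k).faceOf_faceNext (Sum.inl i)
  have h2 : ∀ i, (star k).faceOf (Sum.inl (i + 1)) = (star k).faceOf (Sum.inr i) := fun i =>
    (star k).faceOf_faceNext (Sum.inr i)
  have h3 : ∀ i, (star k).faceOf (Sum.inl i) = (star k).rootFace :=
    star_invariant k rfl fun i hi => by rw [h2, h1, hi]
  rcases d with i | i
  · exact h3 i
  · rw [h1, h3]

lemma star_degree [NeZero k] (f : (star k).Face) : (star k).degree f = 2 * k := by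
  obtain ⟨d, rfl⟩ := (star k).faceOf_surjective f
  rw [degree_eq_ncard]
  have : {d' | (star k).faceOf d' = (star k).faceOf d} = Set.univ := by
    ext d'
    simp [star_faceOf]
  rw [this, Set.ncard_univ, Nat.card_sum, Nat.card_zmod]
  ring

lemma star_card_face [NeZero k] : Nat.card (star k).Face = 1 := by
  rw [Nat.card_eq_one_iff_unique]
  refine ⟨⟨fun f f' => ?_⟩, ⟨(star k).rootFace⟩⟩
  obtain ⟨d, rfl⟩ := (star k).faceOf_surjective f
  obtain ⟨d', rfl⟩ := (star k).faceOf_surjective f'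
  rw [star_faceOf, star_faceOf]

lemma star_card_edge [NeZero k] : Nat.card (star k).Edge = k := by
  have := (star k).two_mul_card_edge
  rw [Nat.card_sum, Nat.card_zmod] at this
  omega

lemma star_card_vertex [NeZero k] : Nat.card (star k).Vertex = k + 1 := by
  let cl : ZMod k ⊕ ZMod k → Option (ZMod k) := Sum.elim (fun _ => none) some
  obtain ⟨e, -⟩ := exists_equiv_of_classes (cl := cl) (cl' := (star k).vertexOf)
    (P := fun _ => True) (P' := fun _ => True)
    (by rintro (_ | i); exacts [⟨Sum.inl 0, rfl⟩, ⟨Sum.inr i, rfl⟩]) (star k).vertexOf_surjective id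
    (fun _ _ => trivial) (fun d d' _ _ => by
      constructor
      · have h1 : ∀ i, (star k).vertexOf (Sum.inl i) = (star k).vertexOf (Sum.inl 0) :=
          star_invariant k rfl fun i hi => ((star k).vertexOf_next (Sum.inl i)).trans hi
        rcases d with i | i <;> rcases d' with i' | i' <;> simp [cl, h1]
        rintro rfl
        rfl
      · intro h
        refine ((star k).vertexOf_eq_iff.mp h).of_invariant (g := cl) ?_
        rintro (i | i) <;> rfl)
    (fun y _ => ⟨y, trivial, rfl⟩)
  rw [← Nat.card_congr ((Equiv.subtypeUnivEquiv fun _ => trivial).symm.trans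
    (e.trans (Equiv.subtypeUnivEquiv fun _ => trivial))), Nat.card_eq_fintype_card,
    Fintype.card_option, ZMod.card]

end Star

instance (n : ℕ) : Finite (CombMap (Fin n)) :=
  Finite.of_injective (β := Equiv.Perm (Fin n) × Equiv.Perm (Fin n) × Fin n)
    (fun m => (m.next, m.flip, m.root)) (by
      rintro ⟨a, b, c, _, _⟩ ⟨a', b', c', _, _⟩ h
      simp only [Prod.mk.injEq] at h
      obtain ⟨rfl, rfl, rfl⟩ := h
      rfl)

end CombMap

/-! ### Boltzmann measures and percolation as weighted sums -/

open CombMap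

instance : Countable MapClass := inferInstanceAs (Countable (Quotient _))

instance : Countable RootedMap := inferInstanceAs (Countable (Option MapClass))

namespace MapClass

/-- There is a planar bipartite map with a single face, of any given degree. -/
lemma exists_one_face {k : ℕ} (hk : 1 ≤ k) :
    ∃ c : MapClass, c.IsPB ∧ (∀ f, c.rep.degree f = 2 * k) ∧ Nat.card c.rep.Face = 1 := by
  have : NeZero k := ⟨by omega⟩
  obtain ⟨e, he⟩ := exists_isoOn_rep (star k)
  refine ⟨mk (star k), ⟨he.isConnected (star_isConnected k), he.isPlanar ?_, he.isBipartite ?_⟩,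
    ?_, ?_⟩
  · rw [IsPlanar, star_card_vertex, star_card_face, star_card_edge]
  · intro f
    rw [star_degree]
    exact even_two_mul k
  · intro f
    obtain ⟨d, rfl⟩ := (mk (star k)).rep.faceOf_surjective f
    obtain ⟨d, rfl⟩ := e.surjective d
    rw [he.degree_faceOf, star_degree]
  · rw [← he.card_face, star_card_face]

end MapClass

lemma ENNReal.tsum_option {α : Type*} (f : Option α → ℝ≥0∞) :
    ∑' x, f x = f none + ∑' a, f (some a) := by
  classical
  rw [ENNReal.tsum_eq_add_tsum_ite none]
  congr 1
  rw [← (Option.some_injective α).tsum_eq]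
  · simp
  · rintro (_ | a) h
    · simp at h
    · exact ⟨a, rfl⟩

lemma ENNReal.inv_mul_mul_cancel {a b c : ℝ≥0∞} (ha : a ≠ 0) (ha' : a ≠ ∞) :
    (a * b)⁻¹ * (a * c) = b⁻¹ * c := by
  rw [ENNReal.mul_inv (Or.inl ha) (Or.inl ha'), mul_mul_mul_comm, ENNReal.inv_mul_cancel ha ha',
    one_mul]

namespace RootedMap

/-- A map with at least one edge, as a rooted map. -/
def ofClass (c : MapClass) : RootedMap := some c

lemma ofClass_injective : Function.Injective ofClass := Option.some_injective _

lemma ofClass_ne_vertexMap (c : MapClass) : ofClass c ≠ vertexMap := Option.some_ne_none c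

lemma eq_vertexMap_or_ofClass (m : RootedMap) : m = vertexMap ∨ ∃ c, m = ofClass c := by
  obtain _ | c := m
  exacts [Or.inl rfl, Or.inr ⟨c, rfl⟩]

lemma tsum_eq_add (f : RootedMap → ℝ≥0∞) :
    ∑' m, f m = f vertexMap + ∑' c, f (ofClass c) :=
  ENNReal.tsum_option f

lemma measurableSet (A : Set RootedMap) : MeasurableSet A := trivial

/-- The Boltzmann weight, set to `0` outside planar bipartite maps. -/
noncomputable def pbWeight (q : ℕ → ℝ≥0) : RootedMap → ℝ≥0∞ :=
  planarBipartite.indicator fun m => (m.weight q : ℝ≥0∞)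

lemma ofClass_mem_planarBipartite {c : MapClass} :
    ofClass c ∈ planarBipartite ↔ c.IsPB :=
  ⟨fun h => ⟨h.1, h.2.1, h.2.2⟩, fun h => ⟨h.1, h.2, h.3⟩⟩

lemma pbWeight_vertexMap (q : ℕ → ℝ≥0) : pbWeight q vertexMap = 1 :=
  (Set.indicator_of_mem (show vertexMap ∈ planarBipartite from trivial) _).trans ENNReal.coe_one

lemma pbWeight_ofClass (q : ℕ → ℝ≥0) {c : MapClass} (hc : c.IsPB) :
    pbWeight q (ofClass c) = (c.rep.weight q : ℝ≥0∞) :=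
  Set.indicator_of_mem (ofClass_mem_planarBipartite.mpr hc) _

lemma pbWeight_ofClass_of_not (q : ℕ → ℝ≥0) {c : MapClass} (hc : ¬ c.IsPB) :
    pbWeight q (ofClass c) = 0 :=
  Set.indicator_of_notMem (fun h => hc (ofClass_mem_planarBipartite.mp h)) _

end RootedMap

open RootedMap

lemma partitionFunction_eq_tsum (q : ℕ → ℝ≥0) :
    partitionFunction q = ∑' m : RootedMap, pbWeight q m :=
  tsum_subtype planarBipartite fun m => (RootedMap.weight q m : ℝ≥0∞)

lemma partitionFunction_eq_add (q : ℕ → ℝ≥0) :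
    partitionFunction q = 1 + ∑' c : MapClass, pbWeight q (ofClass c) := by
  rw [partitionFunction_eq_tsum, ← pbWeight_vertexMap q]
  exact tsum_eq_add _

lemma partitionFunction_ne_zero (q : ℕ → ℝ≥0) : partitionFunction q ≠ 0 := by
  rw [partitionFunction_eq_add]
  simp

lemma boltzmann_apply (q : ℕ → ℝ≥0) (A : Set RootedMap) :
    boltzmann q A = (partitionFunction q)⁻¹ * ∑' m, A.indicator (pbWeight q) m := by
  rw [boltzmann, MeasureTheory.Measure.sum_apply _ (measurableSet A), ← ENNReal.tsum_mul_left]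
  have h1 : ∀ m : RootedMap, (partitionFunction q)⁻¹ * A.indicator (pbWeight q) m =
      planarBipartite.indicator (fun m => (RootedMap.weight q m / partitionFunction q : ℝ≥0∞) *
        A.indicator 1 m) m := by
    intro m
    by_cases hm : m ∈ planarBipartite <;> by_cases hA : m ∈ A <;>
      simp [hm, hA, pbWeight, div_eq_mul_inv, mul_comm]
  simp only [h1]
  rw [← tsum_subtype planarBipartite fun m => (RootedMap.weight q m / partitionFunction q : ℝ≥0∞) *
        A.indicator 1 m]
  refine tsum_congr fun m => ?_
  rw [MeasureTheory.Measure.smul_apply, MeasureTheory.Measure.dirac_apply' _ (measurableSet A), smul_eq_mul]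

namespace PercolatedMap

lemma measurableSet (A : Set PercolatedMap) : MeasurableSet A := trivial

/-- The weight of a percolated map. -/
noncomputable def percWeight (q : ℕ → ℝ≥0) (p : ℝ≥0) (x : PercolatedMap) : ℝ≥0∞ :=
  pbWeight q x.1 * ((∏ e : x.1.Edge, if x.2 e then p else 1 - p : ℝ≥0) : ℝ≥0∞)

/-- A coloured class, as a percolated map. -/
def ofColoredClass (y : ColoredClass) : PercolatedMap := ⟨ofClass y.1, y.2⟩

lemma ofColoredClass_injective : Function.Injective ofColoredClass := by
  rintro ⟨c, κ⟩ ⟨c', κ'⟩ h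
  obtain rfl : c = c' := ofClass_injective (congrArg Sigma.fst h)
  obtain rfl : κ = κ' := eq_of_heq (Sigma.mk.inj h).2
  rfl

lemma percolatedBoltzmann_apply (q : ℕ → ℝ≥0) (p : ℝ≥0) (A : Set PercolatedMap) :
    percolatedBoltzmann q p A =
      (partitionFunction q)⁻¹ * ∑' x, A.indicator (percWeight q p) x := by
  rw [percolatedBoltzmann, MeasureTheory.Measure.sum_apply _ (measurableSet A), ← ENNReal.tsum_mul_left]
  refine tsum_congr fun x => ?_
  have h1 : ∑' m, ({x.1} : Set RootedMap).indicator (pbWeight q) m = pbWeight q x.1 := by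
    rw [tsum_eq_single x.1 (fun m hm => by simp [hm])]
    simp
  rw [MeasureTheory.Measure.smul_apply, MeasureTheory.Measure.dirac_apply' _ (measurableSet A), smul_eq_mul,
    boltzmann_apply, h1]
  by_cases hA : x ∈ A <;> simp [hA, percWeight, mul_assoc]

/-- Given the map, the probabilities of its colourings sum to `1`; `hp` is needed because `1 - p` is
truncated. -/
lemma tsum_percWeight (q : ℕ → ℝ≥0) {p : ℝ≥0} (hp : p ≤ 1) :
    ∑' x, percWeight q p x = partitionFunction q := by
  classical
  rw [partitionFunction_eq_tsum]
  refine (ENNReal.tsum_sigma' _).trans (tsum_congr fun m => ?_)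
  simp only [percWeight]
  rw [ENNReal.tsum_mul_left, tsum_fintype, ← ENNReal.ofNNReal_finsetSum]
  have h1 : ∑ κ : m.Edge → Bool, ∏ e, (if κ e then p else 1 - p) = 1 := by
    rw [← Fintype.prod_sum fun (_ : m.Edge) (b : Bool) => if b then p else 1 - p]
    simp [add_tsub_cancel_of_le hp]
  rw [h1]
  simp

lemma ofColoredClass_mem_rootBlack {y : ColoredClass} :
    ofColoredClass y ∈ rootBlack ↔ y.2 (y.1.rep.edgeOf y.1.rep.root) = true := Iff.rfl

lemma cluster_ofColoredClass {y : ColoredClass}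
    (h : y.2 (y.1.rep.edgeOf y.1.rep.root) = true) :
    cluster (ofColoredClass y) = ofClass (MapClass.mk (y.1.rep.cluster y.2 h)) :=
  dif_pos h

lemma exists_ofColoredClass {x : PercolatedMap} (hx : x ∈ rootBlack) :
    ∃ y, ofColoredClass y = x := by
  obtain ⟨_ | c, κ⟩ := x
  · exact absurd hx id
  · exact ⟨⟨c, κ⟩, rfl⟩

lemma percWeight_ofColoredClass (q : ℕ → ℝ≥0) (p : ℝ≥0) {y : ColoredClass} (hy : y.1.IsPB) :
    percWeight q p (ofColoredClass y) = (MapClass.percWeight q p y : ℝ≥0∞) := by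
  have : pbWeight q (ofColoredClass y).1 = (y.1.rep.weight q : ℝ≥0∞) := pbWeight_ofClass q hy
  rw [percWeight, this, ← ENNReal.coe_mul]
  rfl

lemma percWeight_ofColoredClass_of_not (q : ℕ → ℝ≥0) (p : ℝ≥0) {y : ColoredClass}
    (hy : ¬ y.1.IsPB) : percWeight q p (ofColoredClass y) = 0 := by
  have : pbWeight q (ofColoredClass y).1 = 0 := pbWeight_ofClass_of_not q hy
  rw [percWeight, this, zero_mul]

/-- The vertex map has no black root, and maps that are not planar bipartite weigh `0`; what remains
is `HasCluster`. -/
lemma tsum_indicator_cluster (q : ℕ → ℝ≥0) (p : ℝ≥0) (c : MapClass) :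
    ∑' x, (rootBlack ∩ cluster ⁻¹' {ofClass c}).indicator (percWeight q p) x =
      ∑' y : {y // c.HasCluster y}, (MapClass.percWeight q p y.1 : ℝ≥0∞) := by
  rw [← ofColoredClass_injective.tsum_eq]
  · refine Eq.trans ?_ (tsum_subtype {y | c.HasCluster y}
      fun y => (MapClass.percWeight q p y : ℝ≥0∞)).symm
    refine tsum_congr fun y => ?_
    by_cases hy : y.1.IsPB
    · have : ofColoredClass y ∈ rootBlack ∩ cluster ⁻¹' {ofClass c} ↔
          c.HasCluster y := by
        constructor
        · rintro ⟨h1, h2⟩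
          have h2 : cluster (ofColoredClass y) = ofClass c := h2
          rw [cluster_ofColoredClass h1] at h2
          exact ⟨hy, h1, ofClass_injective h2⟩
        · rintro ⟨-, h1, h2⟩
          refine ⟨h1, ?_⟩
          show cluster (ofColoredClass y) = ofClass c
          rw [cluster_ofColoredClass h1, h2]
      by_cases hc : c.HasCluster y
      · rw [Set.indicator_of_mem (this.mpr hc), Set.indicator_of_mem (s := {y | c.HasCluster y}) hc,
          percWeight_ofColoredClass q p hy]
      · rw [Set.indicator_of_notMem (fun h => hc (this.mp h)),
          Set.indicator_of_notMem (s := {y | c.HasCluster y}) hc]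
    · rw [Set.indicator_of_notMem (s := {y | c.HasCluster y}) (fun h => hy h.1),
        Set.indicator_apply_eq_zero]
      exact fun _ => percWeight_ofColoredClass_of_not q p hy
  · intro x hx
    exact exists_ofColoredClass (Set.mem_of_indicator_ne_zero hx).1

lemma tsum_indicator_rootBlack (q : ℕ → ℝ≥0) (p : ℝ≥0) :
    ∑' x, rootBlack.indicator (percWeight q p) x =
      ∑' c : MapClass, ∑' x,
        (rootBlack ∩ cluster ⁻¹' {ofClass c}).indicator (percWeight q p) x := by
  rw [ENNReal.tsum_comm]
  refine tsum_congr fun x => ?_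
  by_cases hx : x ∈ rootBlack
  · obtain ⟨y, rfl⟩ := exists_ofColoredClass hx
    have h1 := cluster_ofColoredClass hx
    rw [tsum_eq_single (MapClass.mk (y.1.rep.cluster y.2 hx)), Set.indicator_of_mem hx,
      Set.indicator_of_mem]
    · exact ⟨hx, h1⟩
    · intro c hc
      refine Set.indicator_of_notMem (fun h => hc ?_) _
      have h2 : cluster (ofColoredClass y) = ofClass c := h.2
      rw [h1] at h2
      exact (ofClass_injective h2).symm
  · simp [hx]

end PercolatedMap

/-! ### The law of the cluster -/

namespace MapClass

lemma isEmpty_hasCluster {c : MapClass} (hc : ¬ c.IsPB) : IsEmpty {y // c.HasCluster y} :=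
  ⟨fun y => hc y.2.exists_glueRel.1⟩

lemma tsum_hasCluster_eq_pbWeight {q : ℕ → ℝ≥0} {p : ℝ≥0}
    (hfin : ∀ k, 1 ≤ k → islandPartition q p k ≠ ∞) (c : MapClass) :
    ∑' y : {y // c.HasCluster y}, (percWeight q p y.1 : ℝ≥0∞) =
      pbWeight (clusterWeights q p) (ofClass c) := by
  by_cases hc : c.IsPB
  · rw [tsum_percWeight hc, pbWeight_ofClass _ hc, CombMap.weight, ENNReal.ofNNReal_finsetProd]
    refine Finset.prod_congr rfl fun f _ => ?_
    -- Faces are nonempty of even degree, so the index `0`, where finiteness is not known, never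
    -- occurs and `toNNReal` loses nothing.
    have h1 : 1 ≤ c.rep.degree f / 2 := by
      have h2 : 0 < c.rep.degree f := by
        obtain ⟨d, rfl⟩ := c.rep.faceOf_surjective f
        rw [CombMap.degree_eq_ncard, Set.ncard_pos]
        exact ⟨d, rfl⟩
      have h3 := Nat.two_mul_div_two_of_even (hc.bipartite f)
      omega
    rw [clusterWeights, ENNReal.coe_mul, ENNReal.coe_toNNReal (hfin _ h1), ENNReal.coe_pow]
  · have := isEmpty_hasCluster hc
    rw [pbWeight_ofClass_of_not _ hc, tsum_empty]

end MapClass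

/-- For the star with `k` edges the cluster identity reads `p ^ k * I_k(p)`, which is at most the
total weight of all percolated maps. -/
lemma islandPartition_ne_top {q : ℕ → ℝ≥0} (hq : Admissible q) {p : ℝ≥0} (hp0 : 0 < p)
    (hp1 : p ≤ 1) {k : ℕ} (hk : 1 ≤ k) : islandPartition q p k ≠ ∞ := by
  obtain ⟨c, hc, hdeg, hcard⟩ := MapClass.exists_one_face hk
  have h1 := MapClass.tsum_percWeight hc q p
  have h2 : ∀ f, c.rep.degree f / 2 = k := fun f => by rw [hdeg f]; omega
  simp only [h2] at h1
  rw [Finset.prod_const, Finset.card_univ, ← Nat.card_eq_fintype_card, hcard, pow_one,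
    ← PercolatedMap.tsum_indicator_cluster] at h1
  have h3 : (p : ℝ≥0∞) ^ k * islandPartition q p k ≤ partitionFunction q := by
    rw [← h1, ← PercolatedMap.tsum_percWeight q hp1]
    exact ENNReal.tsum_le_tsum fun x => Set.indicator_le_self _ _ x
  intro h4
  rw [h4, ENNReal.mul_top (by positivity)] at h3
  exact hq (top_le_iff.mp h3)

/-- The entirely black star with `k` edges has weight `q k * p ^ k`, which is positive. -/
lemma tsum_indicator_rootBlack_ne_zero {q : ℕ → ℝ≥0} (hq0 : ∃ k, 1 ≤ k ∧ q k ≠ 0) {p : ℝ≥0}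
    (hp0 : 0 < p) :
    ∑' x, PercolatedMap.rootBlack.indicator (PercolatedMap.percWeight q p) x ≠ 0 := by
  obtain ⟨k, hk, hqk⟩ := hq0
  obtain ⟨c, hc, hdeg, hcard⟩ := MapClass.exists_one_face hk
  rw [Ne, ENNReal.tsum_eq_zero]
  push Not
  refine ⟨PercolatedMap.ofColoredClass ⟨c, fun _ => true⟩, ?_⟩
  rw [Set.indicator_of_mem (PercolatedMap.ofColoredClass_mem_rootBlack.mpr rfl),
    PercolatedMap.percWeight_ofColoredClass q p hc, ENNReal.coe_ne_zero]
  have h2 : ∀ f, c.rep.degree f / 2 = k := fun f => by rw [hdeg f]; omega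
  simp only [MapClass.percWeight, CombMap.weight, h2, if_true]
  simp [hqk, hp0.ne']

theorem proposition3p1 (q : ℕ → ℝ≥0) (hq : Admissible q) (hq0 : ∃ k, 1 ≤ k ∧ q k ≠ 0)
    (p : ℝ≥0) (hp0 : 0 < p) (hp1 : p ≤ 1) :
    (∀ k, 1 ≤ k → islandPartition q p k ≠ ∞) ∧
    Admissible (clusterWeights q p) ∧
    MeasureTheory.IsProbabilityMeasure ((percolatedBoltzmann q p)[|PercolatedMap.rootBlack]) ∧
    ((percolatedBoltzmann q p)[|PercolatedMap.rootBlack]).map PercolatedMap.cluster =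
      (boltzmann (clusterWeights q p))[|{m | m ≠ RootedMap.vertexMap}] := by
  have hfin : ∀ k, 1 ≤ k → islandPartition q p k ≠ ∞ := fun k hk =>
    islandPartition_ne_top hq hp0 hp1 hk
  set T : ℝ≥0∞ := ∑' x, PercolatedMap.rootBlack.indicator (PercolatedMap.percWeight q p) x with hT
  have hT0 : T ≠ 0 := tsum_indicator_rootBlack_ne_zero hq0 hp0
  have hTop : T ≠ ∞ := by
    refine ne_top_of_le_ne_top hq ?_
    rw [← PercolatedMap.tsum_percWeight q hp1]
    exact ENNReal.tsum_le_tsum fun x => Set.indicator_le_self _ _ x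
  have hcl : ∀ c : MapClass, ∑' x, (PercolatedMap.rootBlack ∩
      PercolatedMap.cluster ⁻¹' {ofClass c}).indicator (PercolatedMap.percWeight q p) x =
        pbWeight (clusterWeights q p) (ofClass c) := fun c => by
    rw [PercolatedMap.tsum_indicator_cluster, MapClass.tsum_hasCluster_eq_pbWeight hfin]
  -- Splitting the event according to the cluster shows that both conditionings have the same total
  -- weight `T`; its finiteness yields admissibility.
  have hTsum : ∑' c : MapClass, pbWeight (clusterWeights q p) (ofClass c) = T := by
    rw [hT, PercolatedMap.tsum_indicator_rootBlack]
    exact tsum_congr fun c => (hcl c).symm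
  have hadm : Admissible (clusterWeights q p) := by
    rw [Admissible, partitionFunction_eq_add, hTsum]
    exact ENNReal.add_ne_top.mpr ⟨ENNReal.one_ne_top, hTop⟩
  have hZ : (partitionFunction q)⁻¹ ≠ 0 := ENNReal.inv_ne_zero.mpr hq
  have hZ' : (partitionFunction q)⁻¹ ≠ ∞ := ENNReal.inv_ne_top.mpr (partitionFunction_ne_zero q)
  have hB := PercolatedMap.percolatedBoltzmann_apply q p PercolatedMap.rootBlack
  rw [← hT] at hB
  refine ⟨hfin, hadm, ?_, ?_⟩
  · refine ProbabilityTheory.cond_isProbabilityMeasure_of_finite ?_ ?_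
    · rw [hB]; exact mul_ne_zero hZ hT0
    · rw [hB]; exact ENNReal.mul_ne_top hZ' hTop
  · refine MeasureTheory.Measure.ext_of_singleton fun r => ?_
    have hY : (partitionFunction (clusterWeights q p))⁻¹ ≠ 0 := ENNReal.inv_ne_zero.mpr hadm
    have hY' : (partitionFunction (clusterWeights q p))⁻¹ ≠ ∞ :=
      ENNReal.inv_ne_top.mpr (partitionFunction_ne_zero _)
    have hN : ∑' m : RootedMap, {m | m ≠ RootedMap.vertexMap}.indicator
        (pbWeight (clusterWeights q p)) m = T := by
      rw [← hTsum]
      refine (RootedMap.tsum_eq_add _).trans ?_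
      rw [Set.indicator_of_notMem (s := {m | m ≠ RootedMap.vertexMap}) (fun h : RootedMap.vertexMap ∈ _ => h rfl),
        zero_add]
      refine tsum_congr fun c => Set.indicator_of_mem ?_ _
      exact RootedMap.ofClass_ne_vertexMap c
    -- The two partition functions cancel in the conditional probabilities, leaving the factor `T⁻¹`
    -- on both sides.
    rw [MeasureTheory.Measure.map_apply measurable_from_top (RootedMap.measurableSet _),
      ProbabilityTheory.cond_apply (PercolatedMap.measurableSet _),
      ProbabilityTheory.cond_apply (RootedMap.measurableSet _), hB,
      PercolatedMap.percolatedBoltzmann_apply, boltzmann_apply, boltzmann_apply, hN,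
      ENNReal.inv_mul_mul_cancel hZ hZ', ENNReal.inv_mul_mul_cancel hY hY']
    congr 1
    obtain rfl | ⟨c, rfl⟩ := r.eq_vertexMap_or_ofClass
    · have h1 : PercolatedMap.rootBlack ∩ PercolatedMap.cluster ⁻¹' {RootedMap.vertexMap} = ∅ := by
        rw [Set.eq_empty_iff_forall_notMem]
        rintro x ⟨h1, h2⟩
        obtain ⟨y, rfl⟩ := PercolatedMap.exists_ofColoredClass h1
        have h2 : PercolatedMap.cluster (PercolatedMap.ofColoredClass y) = RootedMap.vertexMap := h2
        rw [PercolatedMap.cluster_ofColoredClass h1] at h2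
        exact absurd h2 (RootedMap.ofClass_ne_vertexMap _)
      have h2 : {m | m ≠ RootedMap.vertexMap} ∩ {RootedMap.vertexMap} = ∅ := by
        rw [Set.eq_empty_iff_forall_notMem]
        rintro x ⟨h1, h2⟩
        exact h1 h2
      rw [h1, h2]
      simp
    · rw [hcl c, tsum_eq_single (RootedMap.ofClass c)]
      · exact (Set.indicator_of_mem
          (s := {m | m ≠ RootedMap.vertexMap} ∩ {RootedMap.ofClass c}) ⟨RootedMap.ofClass_ne_vertexMap c, rfl⟩ _).symm
      · intro m hm
        exact Set.indicator_of_notMem (fun h => hm h.2) _
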